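/- **Setting.** Let $X$ be an $\mathbb R^d$-valued random vector on $(\Omega,\mathbb P)$ with a density, and let $\ell:\mathbb R^d\to\mathbb R$ be a loss function: increasing, convex, lower semicontinuous, with $\inf\ell<0$ and $\ell(x)\ge\sum_k x_k-c$ for some $c$. Assume $\mathbb E[\ell(t|X|)]<\infty$ for all $t>0$, and that for every $m_0$ the map $m\mapsto\ell(X-m)$ is a.s. differentiable at $m_0$. Put $g(m)=\mathbb E[\ell(X-m)]$; below, $\nabla\ell$ is the gradient of $\ell$ in its argument. The exact KKT system for $z=(m,\lambda)$ is $\lambda\,\mathbb E[\nabla\ell(X-m)]=\mathbf 1$, $\mathbb E[\ell(X-m)]=0$. **Fourier representation.** Let $\ell(x)=c_0+\langle b,x\rangle+\sum_{i}\ell_i(x_{p_i})$, a finite sum, where $x_{p_i}\in\mathbb R^{k_i}$ is the vector of the coordinates of $x$ selected by an increasing $k_i$-tuple $p_i$, and $\ell_i:\mathbb R^{k_i}\to\mathbb R$ is differentiable almost everywhere. The affine part is integrated exactly. For each pair $(\varphi,K)$ equal to $(\ell_i,K^{(0)}_i)$ or $(\partial_r\ell_i,K^{(1)}_i)$, $1\le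 r\le k_i$, with fixed damping vectors $K^{(\nu)}_i\in\mathbb R^{k_i}$, and with $Y=X_{p_i}$, $k=k_i$, put $$\Phi_Y(y)=\mathbb E\,e^{\mathrm i\langle y,Y\rangle},\quad \hat\varphi(y)=\int e^{-\mathrm i\langle y,x\rangle}\varphi(x)\,dx,\quad h(w;m)=(2\pi)^{-k}e^{\langle K-\mathrm iw,m\rangle}\Phi_Y(w+\mathrm iK)\,\hat\varphi(w+\mathrm iK).$$ Assume that $\mathbb E\,e^{-\langle K,Y\rangle}<\infty$, and that $e^{\langle K,\cdot\rangle}\varphi$ and $\Phi_Y(\cdot+\mathrm iK)\hat\varphi(\cdot+\mathrm iK)$ are in $L^1(\mathbb R^k)$. Let $G_i^{-1}:[0,1]^{D_i}\to\mathbb R^{k_i}$ be a measurable inverse domain transformation with a measurable weight $J_i\ge0$ such that $\int_{\mathbb R^{k_i}}f(u)\,du=\int_{[0,1]^{D_i}}f(G_i^{-1}(v))J_i(v)\,dv$ for all measurable $f\ge0$ (for an a.e. diffeomorphism, $J_i=|\det J_{G_i^{-1}}|$), and put $\tilde h(v;m)=h(G_i^{-1}(v);m)\,J_i(v)$. For a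 given compact $M\subset\mathbb R^d$, assume that $\tilde h(\cdot;m_{p_i})$ and its partial derivatives with respect to $m_{p_i}$ are in $L^2([0,1]^{D_i})$ for all $m\in M$. Let $\hat g^{(0)}(m)\in\mathbb R$ and $\hat g^{(1)}(m)\in\mathbb R^d$ be obtained from $c_0+\langle b,\mathbb E X-m\rangle+\sum_i\mathbb E[\ell_i(X_{p_i}-m_{p_i})]$ and its analogue $b+\sum_i P_i^\top\mathbb E[\nabla\ell_i(X_{p_i}-m_{p_i})]$ (where $P_i x=x_{p_i}$) by replacing each expectation of a component by $\Re\int h(w;m_{p_i})\,dw$, and put $$\hat{\mathcal L}_\nabla(z)=\big(\mathbf 1-\lambda\,\hat g^{(1)}(m),\;-\hat g^{(0)}(m)\big).$$ **RQMC.** Fix $\bar S\ge1$. For each dimension $D$ take a Sobol sequence $(v_n)$ in $[0,1]^D$ (base 2, indices starting at $0$; van der Corput sequence in the first coordinate, distinct primitive polynomials over $\mathbb F_2$ with arbitrary admissible initial direction numbers in the others) and $\bar S$ independent nested uniform (Owen) scrambles $(v_n^{(s)})$ of it, on a probability space $(\Omega',\mathbb Q)$. The Fourier–RQMC map $\hat{\mathcal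 L}_{\nabla,N}$ is $\hat{\mathcal L}_\nabla$ with each $\Re\int h(w;m_{p_i})\,dw$ replaced by $\frac1{\bar S}\sum_{s\le\bar S}\frac1N\sum_{n\le N}\Re\,\tilde h(v^{(s)}_n;m_{p_i})$, with the points of dimension $D_i$. **Theorem.** Let $\mathcal Z=M\times(0,\bar\lambda]$ and let $z^*=(m^*,\lambda^*)$, $\lambda^*>0$, be a solution of the exact KKT system in the interior of $\mathcal Z$. Assume: * (C1) for every $m_0$, $m\mapsto\nabla\ell(X-m)$ is a.s. differentiable at $m_0$; * (C2) $a^\top\nabla^2g(m^*)a\neq0$ for all $a\ne0$ with $\nabla g(m^*)^\top a=0$, i.e. this form is (positive or negative) definite on the tangent space; * $z^*$ is strongly regular: $\hat{\mathcal L}_\nabla$ is continuously differentiable near $z^*$ and there are neighbourhoods $U_1$ of $0$ and $U_2$ of $z^*$ such that for every $\delta\in U_1$ the equation $\delta+\hat{\mathcal L}_\nabla(z^*)+\hat{\mathcal L}_\nabla'(z^*)(z-z^*)=0$ has a unique solution $z=\tilde z(\delta)$ in $U_2$, and $\tilde z$ is Lipschitz on $U_1$. Then there are $\eta>0$ and random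 vectors $z_N:\Omega'\to\mathbb R^{d+1}$, $N\ge0$, such that almost surely $z_N\to z^*$ as $N\to\infty$ and, for all sufficiently large $N$, $z_N\in\mathcal Z$ and $z_N$ is the unique solution of $\hat{\mathcal L}_{\nabla,N}(z)=0$ in the closed ball of radius $\eta$ around $z^*$. -/

import Mathlib

open MeasureTheory ProbabilityTheory Filter Topology

namespace MSRM

noncomputable section

/-- `ℝᵏ` with the Euclidean norm. -/
abbrev Euc (k : ℕ) : Type := EuclideanSpace ℝ (Fin k)

/-- The primal–dual space of pairs `z = (m, lam)`. -/
abbrev PrimalDual (d : ℕ) : Type := Euc d × ℝ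

/-- The partial derivative `∂_r f (x)`. -/
def partialDeriv {k : ℕ} {F : Type*} [NormedAddCommGroup F] [NormedSpace ℝ F]
    (r : Fin k) (f : Euc k → F) (x : Euc k) : F :=
  fderiv ℝ f x (EuclideanSpace.single r 1)

/-- The coordinate projection `x ↦ (x_{p 0}, …, x_{p (k-1)})`, for an increasing tuple `p`. -/
def proj {k d : ℕ} (p : Fin k ↪o Fin d) (x : Euc d) : Euc k :=
  WithLp.toLp 2 fun r => x (p r)

/-- The unit cube `[0,1]^D`. -/
def cube (D : ℕ) : Set (Euc D) := {v | ∀ j, v j ∈ Set.Icc (0 : ℝ) 1}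

/-! ### The shortfall risk problem -/

/-- Multivariate loss functions (increasing, convex, lower semicontinuous, negative somewhere,
and dominating `∑ xₖ - c`). -/
structure IsLossFunction {d : ℕ} (ell : Euc d → ℝ) : Prop where
  mono : ∀ x y : Euc d, (∀ j, y j ≤ x j) → ell y ≤ ell x
  convex : ConvexOn ℝ Set.univ ell
  lsc : LowerSemicontinuous ell
  exists_neg : ∃ x, ell x < 0
  lower : ∃ c : ℝ, ∀ x : Euc d, (∑ j, x j) - c ≤ ell x

/-- The multivariate Orlicz heart of `ell`: `E[ell(t|X|)] < ∞` for every `t > 0`, with `|X|` the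
componentwise absolute value. -/
def MemOrliczHeart {d : ℕ} {Ω : Type*} [MeasurableSpace Ω] (P : Measure Ω)
    (ell : Euc d → ℝ) (X : Ω → Euc d) : Prop :=
  ∀ t : ℝ, 0 < t → Integrable (fun ω => ell (WithLp.toLp 2 fun j => t * |X ω j|)) P

/-- `g(m) = E[ell(X - m)]`. -/
def expectedLoss {d : ℕ} {Ω : Type*} [MeasurableSpace Ω] (P : Measure Ω)
    (ell : Euc d → ℝ) (X : Ω → Euc d) (m : Euc d) : ℝ :=
  ∫ ω, ell (X ω - m) ∂P

/-- `z = (m, lam)` solves the exact KKT system: `lam > 0`, `lam * E[∇ell(X - m)] = (1,…,1)` and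
`E[ell(X - m)] = 0`. -/
def IsExactKKT {d : ℕ} {Ω : Type*} [MeasurableSpace Ω] (P : Measure Ω)
    (ell : Euc d → ℝ) (X : Ω → Euc d) (z : PrimalDual d) : Prop :=
  0 < z.2 ∧ (∀ j, z.2 * (∫ ω, partialDeriv j ell (X ω - z.1) ∂P) - 1 = 0) ∧
    expectedLoss P ell X z.1 = 0

/-- The quadratic form of `∇²g(m)` does not vanish at any nonzero vector of the tangent space
`{a : ∇g(m)ᵀ a = 0}`; equivalently it is (positive or negative) definite there. -/
def SecondOrderCondition {d : ℕ} (g : Euc d → ℝ) (m : Euc d) : Prop :=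
  ∀ a : Euc d, a ≠ 0 → fderiv ℝ g m a = 0 → fderiv ℝ (fderiv ℝ g) m a a ≠ 0

/-! ### Fourier representation -/

/-- The complex vector `w + i K`. -/
def contour {k : ℕ} (K w : Euc k) : Fin k → ℂ := fun r => (w r : ℂ) + Complex.I * (K r : ℂ)

/-- The extended characteristic function `E[exp(i⟨y, Y⟩)]`, `y ∈ ℂᵏ`. -/
def extCharFun {k : ℕ} {Ω : Type*} [MeasurableSpace Ω] (P : Measure Ω) (Y : Ω → Euc k)
    (y : Fin k → ℂ) : ℂ :=
  ∫ ω, Complex.exp (Complex.I * ∑ r, y r * (Y ω r : ℂ)) ∂P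

/-- The extended Fourier transform `∫ exp(-i⟨y, x⟩) φ(x) dx`, `y ∈ ℂᵏ`. -/
def extFourier {k : ℕ} (φ : Euc k → ℝ) (y : Fin k → ℂ) : ℂ :=
  ∫ x : Euc k, Complex.exp (-(Complex.I * ∑ r, y r * (x r : ℂ))) * (φ x : ℂ)

/-- The Fourier integrand
`(2π)⁻ᵏ exp(⟨K - i w, m⟩) Φ_Y(w + iK) φ̂(w + iK)`. -/
def fourierIntegrand {k : ℕ} {Ω : Type*} [MeasurableSpace Ω] (P : Measure Ω) (Y : Ω → Euc k)
    (φ : Euc k → ℝ) (K m w : Euc k) : ℂ :=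
  (((2 * Real.pi) ^ k)⁻¹ : ℝ) *
    Complex.exp (∑ r, ((K r : ℂ) - Complex.I * (w r : ℂ)) * (m r : ℂ)) *
    extCharFun P Y (contour K w) * extFourier φ (contour K w)

/-- The real part of the integral of the Fourier integrand over `ℝᵏ`. -/
def fourierValue {k : ℕ} {Ω : Type*} [MeasurableSpace Ω] (P : Measure Ω) (Y : Ω → Euc k)
    (φ : Euc k → ℝ) (K m : Euc k) : ℝ :=
  (∫ w : Euc k, fourierIntegrand P Y φ K m w).re

/-- `K` is an admissible contour shift (damping vector) for the law of `Y` and the function `φ`: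
the exponential moment that defines `Φ_Y(· + iK)` is finite, `x ↦ exp(⟨K,x⟩) φ(x)` is integrable,
and so is `w ↦ Φ_Y(w + iK) φ̂(w + iK)`. -/
structure IsAdmissibleShift {k : ℕ} {Ω : Type*} [MeasurableSpace Ω] (P : Measure Ω)
    (Y : Ω → Euc k) (φ : Euc k → ℝ) (K : Euc k) : Prop where
  moment : Integrable (fun ω => Real.exp (-∑ r, K r * Y ω r)) P
  damped : Integrable (fun x : Euc k => Real.exp (∑ r, K r * x r) * φ x)
  product : Integrable (fun w : Euc k =>
    extCharFun P Y (contour K w) * extFourier φ (contour K w))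

/-! ### Domain transformations -/

/-- A change of variables from `ℝᵏ` to the cube `[0,1]^D`: a map `inv` from the cube to `ℝᵏ`
(the inverse transformation `G⁻¹`) and a weight `jac ≥ 0` on the cube for which
`∫_{ℝᵏ} f(u) du = ∫_{[0,1]^D} f(inv v) jac(v) dv`, in the form: `inv` pushes the measure
`jac(v) dv` to Lebesgue measure.  For `D = k` and an a.e. diffeomorphism the weight is
`|det J_{G⁻¹}|` (see `DomainTransform.ofInverse`); if `inv` maps the uniform law of the cube to a
law with a positive density `ψ` (`D = k + 1` is possible, by a mixing variable), then the weight is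
`1 / ψ(inv v)`. -/
structure DomainTransform (k D : ℕ) where
  inv : Euc D → Euc k
  jac : Euc D → ℝ
  measurable_inv : Measurable inv
  measurable_jac : Measurable jac
  jac_nonneg : ∀ v, 0 ≤ jac v
  map_eq : Measure.map inv
    ((volume.restrict (cube D)).withDensity fun v => ENNReal.ofReal (jac v)) = volume

/-- An a.e. defined, a.e. onto, injective and differentiable inverse transformation
`T : [0,1]^k → ℝᵏ` gives a domain transformation with weight `|det DT|`. -/
def DomainTransform.ofInverse {k : ℕ} (T : Euc k → Euc k) (T' : Euc k → Euc k →L[ℝ] Euc k)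
    (s : Set (Euc k)) (hs : MeasurableSet s) (hsc : s =ᵐ[volume] cube k)
    (hT : Measurable T) (hT' : Measurable fun v => |(T' v).det|)
    (hd : ∀ v ∈ s, HasFDerivAt T (T' v) v) (hinj : Set.InjOn T s)
    (hsurj : T '' s =ᵐ[volume] (Set.univ : Set (Euc k))) : DomainTransform k k where
  inv := T
  jac v := |(T' v).det|
  measurable_inv := hT
  measurable_jac := hT'
  jac_nonneg _ := abs_nonneg _
  map_eq := by
    rw [← Measure.restrict_congr_set hsc,
      map_withDensity_abs_det_fderiv_eq_addHaar volume hs.nullMeasurableSet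
        (fun v hv => (hd v hv).hasFDerivWithinAt) hinj,
      Measure.restrict_congr_set hsurj, Measure.restrict_univ]

/-- The transformed integrand `h̃(v; m) = h(G⁻¹(v); m) |det J_{G⁻¹}(v)|` on the cube. -/
def transformedIntegrand {k D : ℕ} {Ω : Type*} [MeasurableSpace Ω] (G : DomainTransform k D)
    (P : Measure Ω) (Y : Ω → Euc k) (φ : Euc k → ℝ) (K m : Euc k) (v : Euc D) : ℂ :=
  fourierIntegrand P Y φ K m (G.inv v) * (G.jac v : ℂ)

/-- Square-integrability over the cube of the transformed integrand and of its first-order partial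
derivatives with respect to `m`. -/
def SquareIntegrableAt {k D : ℕ} {Ω : Type*} [MeasurableSpace Ω] (G : DomainTransform k D)
    (P : Measure Ω) (Y : Ω → Euc k) (φ : Euc k → ℝ) (K m : Euc k) : Prop :=
  MemLp (fun v => transformedIntegrand G P Y φ K m v) 2 (volume.restrict (cube D)) ∧
  ∀ r, MemLp (fun v => partialDeriv r (fun m' => transformedIntegrand G P Y φ K m' v) m) 2
    (volume.restrict (cube D))

/-! ### Decomposed loss functions -/

/-- A loss component: a function `loss` of the `k` coordinates selected by `p`, with damping
vectors `K0` (for the function) and `K1` (for its gradient), and the domain transformation used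
for its Fourier integrals. -/
structure FourierComponent (d : ℕ) where
  k : ℕ
  p : Fin k ↪o Fin d
  loss : Euc k → ℝ
  K0 : Euc k
  K1 : Euc k
  D : ℕ
  G : DomainTransform k D

/-- The data of a loss function `const + ⟨lin, x⟩ + ∑ᵢ lossᵢ(x_{pᵢ})`.  The affine part (possibly
zero) is integrated exactly and is not Fourier transformed. -/
structure LossDecomposition (d : ℕ) (ι : Type*) where
  const : ℝ
  lin : Euc d
  comp : ι → FourierComponent d

namespace LossDecomposition

variable {d : ℕ} {ι : Type*} [Fintype ι]

/-- The decomposed loss function. -/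
def loss (A : LossDecomposition d ι) (x : Euc d) : ℝ :=
  A.const + (∑ j, A.lin j * x j) + ∑ i, (A.comp i).loss (proj (A.comp i).p x)

/-- The standing conditions on the components, for `m` in the set `M`: each component function is
differentiable almost everywhere; the damping vectors are admissible; the transformed integrands
are square-integrable, together with their first-order derivatives in `m`. -/
structure Admissible {Ω : Type*} [MeasurableSpace Ω] (A : LossDecomposition d ι)
    (P : Measure Ω) (X : Ω → Euc d) (M : Set (Euc d)) : Prop where
  differentiable : ∀ i, ∀ᵐ x : Euc (A.comp i).k, DifferentiableAt ℝ (A.comp i).loss x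
  shift0 : ∀ i, IsAdmissibleShift P (fun ω => proj (A.comp i).p (X ω)) (A.comp i).loss
    (A.comp i).K0
  shift1 : ∀ i r, IsAdmissibleShift P (fun ω => proj (A.comp i).p (X ω))
    (partialDeriv r (A.comp i).loss) (A.comp i).K1
  square0 : ∀ i, ∀ m ∈ M, SquareIntegrableAt (A.comp i).G P
    (fun ω => proj (A.comp i).p (X ω)) (A.comp i).loss (A.comp i).K0 (proj (A.comp i).p m)
  square1 : ∀ i r, ∀ m ∈ M, SquareIntegrableAt (A.comp i).G P
    (fun ω => proj (A.comp i).p (X ω)) (partialDeriv r (A.comp i).loss) (A.comp i).K1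
    (proj (A.comp i).p m)

/-- The affine part at `m` of the expected loss, plus the sum over the components of the values
`ev i φ K (m_p)` for `φ` the component function and `K` its damping vector. -/
def aggregate0 (A : LossDecomposition d ι) (mean : Euc d)
    (ev : ∀ i, (Euc (A.comp i).k → ℝ) → Euc (A.comp i).k → Euc (A.comp i).k → ℝ)
    (m : Euc d) : ℝ :=
  A.const + (∑ j, A.lin j * (mean j - m j)) +
    ∑ i, ev i (A.comp i).loss (A.comp i).K0 (proj (A.comp i).p m)

/-- The same for the gradient, `lin + ∑ᵢ Pᵢᵀ (ev i (∂_r lossᵢ) K (m_p))_r`. -/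
def aggregate1 (A : LossDecomposition d ι) 
    (ev : ∀ i, (Euc (A.comp i).k → ℝ) → Euc (A.comp i).k → Euc (A.comp i).k → ℝ)
    (m : Euc d) : Euc d :=
  WithLp.toLp 2 fun j => A.lin j + ∑ i, ∑ r, if (A.comp i).p r = j then
    ev i (partialDeriv r (A.comp i).loss) (A.comp i).K1 (proj (A.comp i).p m) else 0

/-- The first-order map `z = (m, lam) ↦ (1 - lam * G₁(m), -G₀(m))`, with `G₀` and `G₁` the
aggregates computed with the evaluation rule `ev`. -/
def kktMap (A : LossDecomposition d ι) (mean : Euc d)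
    (ev : ∀ i, (Euc (A.comp i).k → ℝ) → Euc (A.comp i).k → Euc (A.comp i).k → ℝ)
    (z : PrimalDual d) : PrimalDual d :=
  (WithLp.toLp 2 fun j => 1 - z.2 * A.aggregate1 ev z.1 j, -A.aggregate0 mean ev z.1)

/-- The mean vector `E[X]`. -/
def mean {Ω : Type*} [MeasurableSpace Ω] (P : Measure Ω) (X : Ω → Euc d) : Euc d :=
  WithLp.toLp 2 fun j => ∫ ω, X ω j ∂P

/-- The Fourier representation of the Lagrangian gradient (exact Fourier integrals). -/
def fourierKKT {Ω : Type*} [MeasurableSpace Ω] (A : LossDecomposition d ι) (P : Measure Ω)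
    (X : Ω → Euc d) : PrimalDual d → PrimalDual d :=
  A.kktMap (mean P X) fun i φ K m => fourierValue P (fun ω => proj (A.comp i).p (X ω)) φ K m

end LossDecomposition

/-! ### Strong regularity -/

/-- Strong regularity of `z0` for the equation `F = 0`: `F` is continuously differentiable near
`z0`, and for all `δ` in a neighbourhood `U₁` of `0` the linearized equation
`δ + F(z0) + F'(z0)(z - z0) = 0` has exactly one solution in a neighbourhood `U₂` of `z0`, which is
a Lipschitz function of `δ ∈ U₁`. -/
def IsStronglyRegular {E : Type*} [NormedAddCommGroup E] [NormedSpace ℝ E]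
    (F : E → E) (z0 : E) : Prop :=
  ContDiffAt ℝ 1 F z0 ∧
  ∃ U₁ ∈ 𝓝 (0 : E), ∃ U₂ ∈ 𝓝 z0, ∃ ζ : E → E, (∃ L, LipschitzOnWith L ζ U₁) ∧
    ∀ δ ∈ U₁, ζ δ ∈ U₂ ∧ δ + F z0 + fderiv ℝ F z0 (ζ δ - z0) = 0 ∧
      ∀ z ∈ U₂, δ + F z0 + fderiv ℝ F z0 (z - z0) = 0 → z = ζ δ

/-! ### Sobol points and nested uniform scrambling -/

/-- Primitive polynomials over the field with two elements. -/
def IsPrimitivePoly (q : Polynomial (ZMod 2)) : Prop :=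
  Irreducible q ∧ orderOf (AdjoinRoot.root q) = 2 ^ q.natDegree - 1

/-- `C r i` is the binary digit of weight `2^{-(r+1)}` of the `i`-th direction number of a Sobol
coordinate with polynomial `q = x^e + a₁ x^{e-1} + ⋯ + a_e`: column `i` is zero below the diagonal
and one on it (the direction number is an odd multiple of `2^{-(i+1)}` in `(0,1)`), and
`v_i = a₁ v_{i-1} ⊕ ⋯ ⊕ a_e v_{i-e} ⊕ (v_{i-e} / 2^e)` for `i ≥ e`. -/
structure IsSobolMatrix (q : Polynomial (ZMod 2)) (C : ℕ → ℕ → ZMod 2) : Prop where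
  diag : ∀ i, C i i = 1
  upper : ∀ r i, i < r → C r i = 0
  recurrence : ∀ r i, q.natDegree ≤ i →
    C r i = (∑ l ∈ Finset.Icc 1 q.natDegree, q.coeff (q.natDegree - l) * C r (i - l)) +
      if q.natDegree ≤ r then C (r - q.natDegree) (i - q.natDegree) else 0

/-- A `D`-dimensional Sobol generator: the identity matrix (van der Corput sequence) in the first
coordinate, and direction numbers for pairwise distinct primitive polynomials in the others (with
arbitrary admissible initial direction numbers). -/
structure SobolGenerator (D : ℕ) where
  poly : Fin D → Polynomial (ZMod 2)
  matrix : Fin D → ℕ → ℕ → ZMod 2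
  first : ∀ j : Fin D, j.val = 0 → ∀ r i, matrix j r i = if r = i then 1 else 0
  primitive : ∀ j : Fin D, j.val ≠ 0 → IsPrimitivePoly (poly j)
  distinct : ∀ j j' : Fin D, j.val ≠ 0 → j'.val ≠ 0 → poly j = poly j' → j = j'
  sobol : ∀ j : Fin D, j.val ≠ 0 → IsSobolMatrix (poly j) (matrix j)

/-- The binary digit of weight `2^{-(r+1)}` of coordinate `j` of the Sobol point with index
`n = 0, 1, 2, …`. -/
def SobolGenerator.digit {D : ℕ} (g : SobolGenerator D) (n : ℕ) (j : Fin D) (r : ℕ) : Bool :=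
  decide ((∑ i ∈ Finset.range n.size, if n.testBit i then g.matrix j r i else 0) = 1)

/-- The real number with binary expansion `0.b₀b₁b₂…`. -/
def binaryValue (b : ℕ → Bool) : ℝ := ∑' r : ℕ, (if b r then (1 : ℝ) else 0) * (1 / 2) ^ (r + 1)

/-- Base-2 nested scrambling of a digit sequence: the digit `b r` is acted on by a permutation of
`{0,1}` that depends on the preceding digits `b 0, …, b (r-1)`.  A permutation of `{0,1}` is given
by the bit that it adds. -/
def scrambleDigits (π : List Bool → Bool) (b : ℕ → Bool) (r : ℕ) : Bool :=
  xor (b r) (π ((List.range r).map b))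

/-- The bits `ξ s j w` (randomization `s`, coordinate `j`, digit prefix `w`) that define the
permutations of `S` independent nested uniform scrambles in dimension `D`: independent and uniform
on `{0,1}`. -/
structure IsNestedUniformScramble {Ω' : Type*} [MeasurableSpace Ω'] (Q : Measure Ω') {S D : ℕ}
    (ξ : Fin S → Fin D → List Bool → Ω' → Bool) : Prop where
  measurable : ∀ s j w, Measurable (ξ s j w)
  uniform : ∀ s j w, Q {ω | ξ s j w ω = true} = 1 / 2
  independent : iIndepFun (fun a : Fin S × Fin D × List Bool => ξ a.1 a.2.1 a.2.2) Q

/-- The `n`-th scrambled Sobol point of the randomization `s`. -/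
def scrambledPoint {Ω' : Type*} {S D : ℕ} (g : SobolGenerator D)
    (ξ : Fin S → Fin D → List Bool → Ω' → Bool) (ω : Ω') (s : Fin S) (n : ℕ) : Euc D :=
  WithLp.toLp 2 fun j => binaryValue (scrambleDigits (fun w => ξ s j w ω) (g.digit n j))

/-- The RQMC estimator `S⁻¹ ∑ₛ N⁻¹ ∑_{n < N} Re f(pts s n)`. -/
def rqmc {S D : ℕ} (pts : Fin S → ℕ → Euc D) (N : ℕ) (f : Euc D → ℂ) : ℝ :=
  (S : ℝ)⁻¹ * ∑ s, (N : ℝ)⁻¹ * ∑ n ∈ Finset.range N, (f (pts s n)).re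

/-- The Fourier–RQMC approximation of the Lagrangian gradient: each Fourier integral of a component
is replaced by the RQMC estimator of its transformed integrand.  For each dimension `D` one
randomized point set is used by all the components whose integrands live on `[0,1]^D`. -/
def rqmcKKT {d : ℕ} {ι : Type*} [Fintype ι] {Ω Ω' : Type*} [MeasurableSpace Ω]
    (A : LossDecomposition d ι) (P : Measure Ω) (X : Ω → Euc d) {S : ℕ}
    (g : ∀ D, SobolGenerator D) (ξ : ∀ D, Fin S → Fin D → List Bool → Ω' → Bool)
    (N : ℕ) (ω : Ω') : PrimalDual d → PrimalDual d :=
  A.kktMap (LossDecomposition.mean P X) fun i φ K m =>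
    rqmc (scrambledPoint (g (A.comp i).D) (ξ (A.comp i).D) ω) N
      (transformedIntegrand (A.comp i).G P (fun ω => proj (A.comp i).p (X ω)) φ K m)

end

end MSRM

namespace MSRM

/-! ### Linear recurrences and the rows of Sobol matrices -/

/-! The random map is a perturbation of the Fourier map, which vanishes at `zstar` with an
invertible derivative there. The proof combines four facts.

(1) The exact solution is a root of the Fourier map (`fourierKKT_eq_zero`). Fourier inversion of the
damped expectation holds only for almost every shift `m` (`ae_integral_eq_fourierValue`). Both sides
are continuous at the solution: the expectations by domination from the Orlicz heart, the Fourier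
side because strong regularity includes continuous differentiability. They therefore agree there.

(2) A strong law holds for averages of square-integrable functions over scrambled Sobol points
(`IsNestedUniformScramble.tendsto_average`). Let `t` be the total degree of the coordinate
polynomials. Coprimality of these polynomials makes every block of `2 ^ (t * q)` consecutive points
equidistributed in the `q`-digit prefixes (`SobolGenerator.card_filter_digit`), and a scramble only
permutes prefixes. Split `F` into its mean given the prefix and a residual. Block sums of the prefix
means are deterministic, and residuals are uncorrelated unless the two points share a `q`-digit
prefix in some coordinate, which is rare. With `N = k ^ (2 * t + 1)` and `2 ^ q` of order `k ^ 2`,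
the mean square error is `O(1 / k ^ 2)`, which is summable. For `F ≥ 0` monotone partial sums fill
the gaps between these `N`.

(3) The approximation is good to first order near the solution (`exists_strictAlong_rqmc`). The
integrand depends on `m` only through an exponential, so its first-order remainder on a small ball
is at most `‖m - m'‖` times a square-integrable function with small integral. The strong law,
applied to this one function and to the partial derivatives, gives a strict derivative for the
estimators along the filter `(ae Q).curry atTop`, meaning "for almost every `ω`, for all large `N`".
This is the notion `StrictAlong`; its neighbourhood of the base point does not depend on `ω`. The
Fourier map inherits the same strict derivative `L`.

(4) Strong regularity makes `L` injective (`IsStronglyRegular.injective_fderiv`), hence invertible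
in finite dimension. The simplified Newton step with the fixed derivative `L` is then a contraction
of a fixed ball for almost every `ω` and all large `N`. Its fixed point is the unique root in the
ball, it is measurable as a limit of Newton iterates, and its distance to `zstar` is at most twice
the length of the first step, which tends to zero. -/

/-- The shift `(u₀, u₁, …) ↦ (u₁, u₂, …)` on sequences. -/
def seqShift (K : Type*) [CommRing K] : Module.End K (ℕ → K) := LinearMap.funLeft K K Nat.succ

theorem seqShift_pow_apply {K : Type*} [CommRing K] (c : ℕ) (u : ℕ → K) (s : ℕ) :
    (seqShift K ^ c) u s = u (s + c) := by
  induction c generalizing s with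
  | zero => rfl
  | succ c ih =>
    rw [pow_succ', Module.End.mul_apply]
    change (seqShift K ^ c) u (s + 1) = _
    rw [ih]; congr 1; omega

theorem aeval_seqShift_apply {K : Type*} [CommRing K] (p : Polynomial K) (u : ℕ → K) (s : ℕ) :
    Polynomial.aeval (seqShift K) p u s =
      ∑ c ∈ Finset.range (p.natDegree + 1), p.coeff c * u (s + c) := by
  rw [Polynomial.aeval_eq_sum_range, LinearMap.sum_apply, Finset.sum_apply]
  refine Finset.sum_congr rfl fun c _ => ?_
  rw [LinearMap.smul_apply, Pi.smul_apply, seqShift_pow_apply, smul_eq_mul]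

/-- A monic recurrence determines each later term from the `p.natDegree` preceding ones. -/
theorem eq_zero_of_aeval_seqShift_eq_zero {K : Type*} [CommRing K] {p : Polynomial K}
    (hp : p.Monic) {u : ℕ → K} (h : Polynomial.aeval (seqShift K) p u = 0)
    (h0 : ∀ i < p.natDegree, u i = 0) : u = 0 := by
  funext i
  induction i using Nat.strong_induction_on with
  | _ i ih =>
    rcases lt_or_ge i p.natDegree with hi | hi
    · exact h0 i hi
    · have := congrFun h (i - p.natDegree)
      rw [aeval_seqShift_apply, Finset.sum_range_succ, hp.coeff_natDegree, one_mul,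
        Nat.sub_add_cancel hi, Finset.sum_eq_zero, zero_add] at this
      · exact this
      · intro c hc
        have hc' := Finset.mem_range.1 hc
        rw [ih _ (by omega)]; simp

/-- The Sobol recurrence, read along a row: the weighted sum over earlier columns cancels against
itself in characteristic 2, and only the displaced term `v_{i-e} / 2^e` survives, which belongs to
the row `e` places higher. -/
theorem IsSobolMatrix.aeval_seqShift {q : Polynomial (ZMod 2)} {C : ℕ → ℕ → ZMod 2}
    (hC : IsSobolMatrix q C) (hq : q.Monic) (r : ℕ) :
    Polynomial.aeval (seqShift (ZMod 2)) q (C r) =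
      if q.natDegree ≤ r then C (r - q.natDegree) else 0 := by
  funext s
  have hrec := hC.recurrence r (s + q.natDegree) (Nat.le_add_left _ _)
  have hre : ∑ l ∈ Finset.Icc 1 q.natDegree,
      q.coeff (q.natDegree - l) * C r (s + q.natDegree - l) =
      ∑ c ∈ Finset.range q.natDegree, q.coeff c * C r (s + c) := by
    refine Finset.sum_nbij' (fun l => q.natDegree - l) (fun c => q.natDegree - c) ?_ ?_ ?_ ?_ ?_
    · intro l hl; simp only [Finset.mem_Icc, Finset.mem_range] at *; omega
    · intro l hl; simp only [Finset.mem_Icc, Finset.mem_range] at *; omega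
    · intro l hl; simp only [Finset.mem_Icc] at *; omega
    · intro l hl; simp only [Finset.mem_range] at *; omega
    · intro l hl
      simp only [Finset.mem_Icc] at hl
      rw [show s + q.natDegree - l = s + (q.natDegree - l) by omega]
  rw [aeval_seqShift_apply, Finset.sum_range_succ, hq.coeff_natDegree, one_mul, hrec, hre,
    Nat.add_sub_cancel, ← add_assoc, CharTwo.add_self_eq_zero, zero_add]
  split_ifs <;> rfl

/-- Each application of `q` in the shift lowers the row index by `q.natDegree ≥ 1` or kills the row,
so `k` applications kill the first `k` rows. -/
theorem IsSobolMatrix.aeval_seqShift_pow {q : Polynomial (ZMod 2)} {C : ℕ → ℕ → ZMod 2}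
    (hC : IsSobolMatrix q C) (hq : q.Monic) (hdeg : 0 < q.natDegree) {r k : ℕ} (hr : r < k) :
    Polynomial.aeval (seqShift (ZMod 2)) (q ^ k) (C r) = 0 := by
  induction k generalizing r with
  | zero => omega
  | succ k ih =>
    rw [pow_succ, map_mul, Module.End.mul_apply, hC.aeval_seqShift hq]
    split_ifs with h
    · exact ih (by omega)
    · exact map_zero _

/-- The matrix is unitriangular: once the earlier coefficients vanish, column `r` sees only the
coefficient of row `r`. -/
theorem IsSobolMatrix.eq_zero_of_sum {q : Polynomial (ZMod 2)} {C : ℕ → ℕ → ZMod 2}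
    (hC : IsSobolMatrix q C) (k : ℕ) (c : ℕ → ZMod 2)
    (h : ∀ i, ∑ r ∈ Finset.range k, c r * C r i = 0) : ∀ r < k, c r = 0 := by
  intro r
  induction r using Nat.strong_induction_on with
  | _ r ih =>
    intro hr
    have := h r
    rw [Finset.sum_eq_single r, hC.diag, mul_one] at this
    · exact this
    · intro b hb hne
      rcases lt_or_gt_of_ne hne with hlt | hgt
      · rw [ih b hlt (Finset.mem_range.1 hb), zero_mul]
      · rw [hC.upper _ _ hgt, mul_zero]
    · intro h'; exact absurd (Finset.mem_range.2 hr) h'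

/-- The first rows of Sobol matrices for pairwise coprime polynomials are linearly independent,
already when truncated to the first columns. -/
theorem sobol_rows_independent {J : Type*} [Fintype J] {p : J → Polynomial (ZMod 2)}
    {C : J → ℕ → ℕ → ZMod 2} (hC : ∀ j, IsSobolMatrix (p j) (C j)) (hp : ∀ j, (p j).Monic)
    (hdeg : ∀ j, 0 < (p j).natDegree) (hcop : Pairwise fun j j' => IsCoprime (p j) (p j'))
    {k m : ℕ} (hm : (∑ j, (p j).natDegree) * k ≤ m) (c : J → ℕ → ZMod 2)
    (h : ∀ i < m, ∑ j, ∑ r ∈ Finset.range k, c j r * C j r i = 0) :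
    ∀ j, ∀ r < k, c j r = 0 := by
  classical
  set w : J → ℕ → ZMod 2 := fun j => ∑ r ∈ Finset.range k, c j r • C j r with hw
  have hann : ∀ j, Polynomial.aeval (seqShift (ZMod 2)) (p j ^ k) (w j) = 0 := by
    intro j
    rw [hw, map_sum]
    refine Finset.sum_eq_zero fun r hr => ?_
    rw [map_smul, (hC j).aeval_seqShift_pow (hp j) (hdeg j) (Finset.mem_range.1 hr), smul_zero]
  have hprod : ∀ (s : Finset J) j, j ∈ s →
      Polynomial.aeval (seqShift (ZMod 2)) (∏ i ∈ s, p i ^ k) (w j) = 0 := by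
    intro s j hj
    rw [← Finset.mul_prod_erase s _ hj, mul_comm, map_mul, Module.End.mul_apply, hann, map_zero]
  have hmonic : (∏ i, p i ^ k).Monic :=
    Polynomial.monic_prod_of_monic _ _ fun i _ => (hp i).pow k
  -- The sum satisfies the recurrence of the product polynomial, whose degree is at most `m`; the
  -- hypothesis supplies `m` vanishing initial terms.
  have hW : ∑ j, w j = 0 := by
    refine eq_zero_of_aeval_seqShift_eq_zero hmonic ?_ ?_
    · rw [map_sum]
      exact Finset.sum_eq_zero fun j _ => hprod _ j (Finset.mem_univ j)
    · intro i hi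
      rw [Polynomial.natDegree_prod_of_monic _ _ fun i _ => (hp i).pow k] at hi
      simp_rw [(hp _).natDegree_pow] at hi
      rw [← Finset.mul_sum, mul_comm] at hi
      have := h i (lt_of_lt_of_le hi hm)
      simpa [hw, Finset.sum_apply] using this
  -- `w j` is killed by `p j ^ k` and, being minus the sum of the others, by the product of the
  -- other powers. These are coprime, so a Bézout relation gives `w j = 0`.
  have hwz : ∀ j, w j = 0 := by
    intro j
    have h1 : Polynomial.aeval (seqShift (ZMod 2)) (∏ i ∈ Finset.univ.erase j, p i ^ k) (w j)
        = 0 := by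
      have h2 : w j = -∑ i ∈ Finset.univ.erase j, w i := by
        rw [eq_neg_iff_add_eq_zero, Finset.add_sum_erase _ _ (Finset.mem_univ j), hW]
      rw [h2, map_neg, map_sum, Finset.sum_eq_zero, neg_zero]
      intro i hi; exact hprod _ i hi
    have hco : IsCoprime (p j ^ k) (∏ i ∈ Finset.univ.erase j, p i ^ k) :=
      IsCoprime.prod_right fun i hi => (hcop (Finset.ne_of_mem_erase hi).symm).pow
    obtain ⟨a, b, hab⟩ := hco
    have := congrArg (fun P => Polynomial.aeval (seqShift (ZMod 2)) P (w j)) hab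
    simpa [h1, hann j, -map_pow, -map_prod] using this.symm
  intro j
  refine (hC j).eq_zero_of_sum k (c j) fun i => ?_
  have := congrFun (hwz j) i
  simpa [hw, Finset.sum_apply] using this

/-- This lets the van der Corput coordinate be treated like the others, with polynomial `X`: the sum
in the recurrence vanishes since `X` has no constant term, leaving a diagonal shift. -/
theorem isSobolMatrix_identity :
    IsSobolMatrix Polynomial.X fun r i => if r = i then 1 else 0 where
  diag i := by simp
  upper r i h := by simp [h.ne']
  recurrence r i h := by
    rw [Polynomial.natDegree_X] at *
    rcases r with _ | r
    · rw [if_neg (by omega)]; simp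
    · simp only [Finset.Icc_self, Finset.sum_singleton, Nat.sub_self, Polynomial.coeff_X_zero]
      simp; congr 1; apply propext; omega

/-- For `X` the root is `0`, whose multiplicative order is not `2 ^ 1 - 1 = 1`. This keeps the van
der Corput polynomial distinct from all the others. -/
theorem IsPrimitivePoly.ne_X {q : Polynomial (ZMod 2)} (hq : IsPrimitivePoly q) :
    q ≠ Polynomial.X := by
  rintro rfl
  have h := hq.2
  have hroot : AdjoinRoot.root (Polynomial.X : Polynomial (ZMod 2)) = 0 := by
    rw [← AdjoinRoot.mk_X, AdjoinRoot.mk_self]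
  have : Fact (Irreducible (Polynomial.X : Polynomial (ZMod 2))) := ⟨hq.1⟩
  rw [hroot, Polynomial.natDegree_X, pow_one] at h
  have := orderOf_eq_one_iff.1 h
  exact zero_ne_one this

theorem monic_of_ne_zero_zmod_two {q : Polynomial (ZMod 2)} (hq : q ≠ 0) : q.Monic := by
  have h : ∀ a : ZMod 2, a ≠ 0 → a = 1 := by decide
  exact h _ (Polynomial.leadingCoeff_ne_zero.2 hq)

/-- The polynomials of the coordinates, with `X` for the van der Corput coordinate. -/
noncomputable def SobolGenerator.coordPoly {D : ℕ} (g : SobolGenerator D) (j : Fin D) :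
    Polynomial (ZMod 2) :=
  if j.val = 0 then Polynomial.X else g.poly j

theorem SobolGenerator.irreducible_coordPoly {D : ℕ} (g : SobolGenerator D) (j : Fin D) :
    Irreducible (g.coordPoly j) := by
  unfold SobolGenerator.coordPoly
  split_ifs with h
  · exact Polynomial.irreducible_X
  · exact (g.primitive j h).1

theorem SobolGenerator.monic_coordPoly {D : ℕ} (g : SobolGenerator D) (j : Fin D) :
    (g.coordPoly j).Monic := monic_of_ne_zero_zmod_two (g.irreducible_coordPoly j).ne_zero

theorem SobolGenerator.injective_coordPoly {D : ℕ} (g : SobolGenerator D) :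
    Function.Injective g.coordPoly := by
  intro j j' h
  unfold SobolGenerator.coordPoly at h
  split_ifs at h with h1 h2 h2
  · exact Fin.ext (h1.trans h2.symm)
  · exact absurd h.symm (g.primitive j' h2).ne_X
  · exact absurd h (g.primitive j h1).ne_X
  · exact g.distinct j j' h1 h2 h

theorem SobolGenerator.isSobolMatrix {D : ℕ} (g : SobolGenerator D) (j : Fin D) :
    IsSobolMatrix (g.coordPoly j) (g.matrix j) := by
  unfold SobolGenerator.coordPoly
  split_ifs with h
  · have : g.matrix j = fun r i => if r = i then 1 else 0 := by
      funext r i; exact g.first j h r i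
    rw [this]; exact isSobolMatrix_identity
  · exact g.sobol j h

theorem SobolGenerator.isCoprime_coordPoly {D : ℕ} (g : SobolGenerator D) {j j' : Fin D}
    (h : j ≠ j') : IsCoprime (g.coordPoly j) (g.coordPoly j') := by
  refine (g.irreducible_coordPoly j).coprime_iff_not_dvd.2 fun hd => h ?_
  exact g.injective_coordPoly <| Polynomial.eq_of_monic_of_associated (g.monic_coordPoly j)
    (g.monic_coordPoly j') ((g.irreducible_coordPoly j).associated_of_dvd
      (g.irreducible_coordPoly j') hd)

/-- The total degree of the coordinate polynomials. -/
noncomputable def SobolGenerator.totalDegree {D : ℕ} (g : SobolGenerator D) : ℕ :=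
  ∑ j, (g.coordPoly j).natDegree

/-! ### Equidistribution of digit prefixes -/

/-- If the range were proper, a nonzero functional would vanish on it, and its values on the
standard basis would be the coefficients of a relation among the rows. -/
theorem surjective_of_rows_independent {K I R : Type*} [Field K] [Fintype I] [Fintype R]
    (C : R → I → K) (h : ∀ c : R → K, (∀ i, ∑ r, c r * C r i = 0) → c = 0) :
    Function.Surjective (Matrix.mulVecLin (Matrix.of C)) := by
  classical
  rw [← LinearMap.range_eq_top]
  by_contra hne
  obtain ⟨f, hf0, hf⟩ := Submodule.exists_le_ker_of_lt_top _ (lt_top_iff_ne_top.2 hne)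
  refine hf0 (LinearMap.pi_ext' fun r => ?_)
  have hc := h (fun r => f (Pi.single r 1)) fun i => by
    have h1 : f (Matrix.mulVecLin (Matrix.of C) (Pi.single i 1)) = 0 :=
      hf (LinearMap.mem_range_self _ _)
    rw [Matrix.mulVecLin_apply, Matrix.mulVec_single_one] at h1
    rw [← h1, pi_eq_sum_univ' ((Matrix.of C).col i), map_sum]
    refine Finset.sum_congr rfl fun r _ => ?_
    rw [map_smul, smul_eq_mul, mul_comm]
    rfl
  ext
  simpa using congrFun hc r

theorem card_fiber_mul_of_surjective {V W K : Type*} [Field K] [AddCommGroup V] [Module K V]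
    [AddCommGroup W] [Module K W] [Fintype V] [Fintype W] [DecidableEq W] (T : V →ₗ[K] W)
    (hT : Function.Surjective T) (y : W) :
    Fintype.card W * (Finset.univ.filter fun x => T x = y).card = Fintype.card V := by
  have h : ∀ z, (Finset.univ.filter fun x => T x = z).card =
      (Finset.univ.filter fun x => T x = y).card := fun z =>
    AddMonoidHom.card_fiber_eq_of_mem_range T.toAddMonoidHom (hT z) (hT y)
  have := Finset.card_eq_sum_card_fiberwise (f := T) (s := Finset.univ) (t := Finset.univ)
    (fun _ _ => Finset.mem_coe.2 (Finset.mem_univ _))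
  rw [Finset.sum_congr rfl fun z _ => h z, Finset.sum_const, smul_eq_mul] at this
  exact this.symm

/-- The bits of a number below `2ᵐ`, as a vector over `𝔽₂`. -/
def bitVector (m n : ℕ) : Fin m → ZMod 2 := fun i => if n.testBit i then 1 else 0

theorem injOn_bitVector (m : ℕ) : Set.InjOn (bitVector m) (Finset.range (2 ^ m)) := by
  intro n hn n' hn' h
  have hn := Finset.mem_range.1 (Finset.mem_coe.1 hn)
  have hn' := Finset.mem_range.1 (Finset.mem_coe.1 hn')
  refine Nat.eq_of_testBit_eq fun i => ?_
  rcases lt_or_ge i m with hi | hi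
  · have := congrFun h ⟨i, hi⟩
    simp only [bitVector] at this
    cases h1 : n.testBit i <;> cases h2 : n'.testBit i <;> simp [h1, h2] at this ⊢
  · rw [Nat.testBit_lt_two_pow (hn.trans_le (Nat.pow_le_pow_right two_pos hi)),
      Nat.testBit_lt_two_pow (hn'.trans_le (Nat.pow_le_pow_right two_pos hi))]

/-- Counting indices in a block becomes counting solutions of a linear system over `𝔽₂`. -/
theorem card_filter_range_bitVector (m : ℕ) (s : (Fin m → ZMod 2) → Prop) [DecidablePred s] :
    ((Finset.range (2 ^ m)).filter fun n => s (bitVector m n)).card =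
      (Finset.univ.filter s).card := by
  have himg : (Finset.range (2 ^ m)).image (bitVector m) = Finset.univ := by
    refine Finset.eq_univ_of_card _ ?_
    rw [Finset.card_image_of_injOn (injOn_bitVector m)]
    simp
  rw [← himg, Finset.filter_image, Finset.card_image_of_injOn]
  exact (injOn_bitVector m).mono (Finset.coe_subset.2 (Finset.filter_subset _ _))

theorem sum_range_size_testBit {M : Type*} [AddCommMonoid M] (n L : ℕ) (h : n < 2 ^ L)
    (f : ℕ → M) : (∑ i ∈ Finset.range n.size, if n.testBit i then f i else 0) =
      ∑ i ∈ Finset.range L, if n.testBit i then f i else 0 := by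
  refine Finset.sum_subset (Finset.range_subset_range.2 (Nat.size_le.2 h)) fun i _ hi => ?_
  have : n < 2 ^ i := Nat.size_le.1 (not_lt.1 fun h => hi (Finset.mem_range.2 h))
  rw [Nat.testBit_lt_two_pow this]; simp

/-- The sum of the generator columns selected by the bits of `n`. -/
def SobolGenerator.digitSum {D : ℕ} (g : SobolGenerator D) (n : ℕ) (j : Fin D) (r : ℕ) : ZMod 2 :=
  ∑ i ∈ Finset.range n.size, if n.testBit i then g.matrix j r i else 0

/-- Within a block the high bits of the index contribute a constant, so the digits are an affine
function of the low bits. -/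
theorem SobolGenerator.digitSum_block {D : ℕ} (g : SobolGenerator D) (m a n : ℕ) (hn : n < 2 ^ m)
    (j : Fin D) (r : ℕ) : g.digitSum (2 ^ m * a + n) j r =
      (∑ i : Fin m, g.matrix j r i * bitVector m n i) +
        ∑ i ∈ Finset.range a, if a.testBit i then g.matrix j r (m + i) else 0 := by
  -- The crude bound `a < 2 ^ a` suffices: any common range containing all nonzero bits will do.
  have hlt : 2 ^ m * a + n < 2 ^ (m + a) := by
    have : a + 1 ≤ 2 ^ a := Nat.lt_two_pow_self
    calc 2 ^ m * a + n < 2 ^ m * a + 2 ^ m := by omega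
      _ = 2 ^ m * (a + 1) := by ring
      _ ≤ 2 ^ m * 2 ^ a := Nat.mul_le_mul_left _ this
      _ = _ := (pow_add _ _ _).symm
  unfold SobolGenerator.digitSum
  rw [sum_range_size_testBit _ _ hlt, Finset.sum_range_add]
  congr 1
  · rw [← Fin.sum_univ_eq_sum_range (fun i => if (2 ^ m * a + n).testBit i then g.matrix j r i
      else 0)]
    refine Finset.sum_congr rfl fun i _ => ?_
    rw [Nat.testBit_two_pow_mul_add _ hn, if_pos i.2, bitVector]
    simp
  · refine Finset.sum_congr rfl fun i _ => ?_
    rw [Nat.testBit_two_pow_mul_add _ hn, if_neg (by omega : ¬ m + i < m),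
      Nat.add_sub_cancel_left]

/-- In every block of `2ᵐ` consecutive Sobol points, `m = k * totalDegree`, each combination of
`k`-digit prefixes of distinct coordinates occurs equally often. -/
theorem SobolGenerator.card_filter_digit {D : ℕ} (g : SobolGenerator D) {J : Type*} [Fintype J]
    (e : J ↪ Fin D) (k a : ℕ) (y : J → Fin k → Bool) :
    2 ^ (Fintype.card J * k) * ((Finset.range (2 ^ (g.totalDegree * k))).filter fun n =>
      ∀ j (r : Fin k), g.digit (2 ^ (g.totalDegree * k) * a + n) (e j) r = y j r).card =
      2 ^ (g.totalDegree * k) := by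
  classical
  set m := g.totalDegree * k with hm
  set C : J × Fin k → Fin m → ZMod 2 := fun x i => g.matrix (e x.1) x.2 i with hC
  -- The linear part of the digit map is onto because the selected rows stay independent after
  -- truncation to `m` columns; all its fibres then have the same size.
  have hsurj : Function.Surjective (Matrix.mulVecLin (Matrix.of C)) := by
    refine surjective_of_rows_independent C fun c hc => ?_
    have hle : (∑ j, (g.coordPoly (e j)).natDegree) * k ≤ m := by
      refine Nat.mul_le_mul_right k ?_
      rw [← Finset.sum_map Finset.univ e fun j => (g.coordPoly j).natDegree]
      exact Finset.sum_le_sum_of_subset (Finset.subset_univ _)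
    have := sobol_rows_independent (p := fun j => g.coordPoly (e j))
      (C := fun j => g.matrix (e j)) (fun j => g.isSobolMatrix _) (fun j => g.monic_coordPoly _)
      (fun j => (g.irreducible_coordPoly _).natDegree_pos)
      (fun j j' h => g.isCoprime_coordPoly fun h' => h (e.injective h')) hle
      (fun j r => if h : r < k then c (j, ⟨r, h⟩) else 0) ?_
    · funext ⟨j, r⟩
      simpa using this j r r.2
    · intro i hi
      have h1 := hc ⟨i, hi⟩
      rw [Fintype.sum_prod_type] at h1
      rw [← h1]
      refine Finset.sum_congr rfl fun j _ => ?_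
      rw [Finset.sum_range]
      refine Finset.sum_congr rfl fun r _ => ?_
      simp [hC]
  set b : J × Fin k → ZMod 2 := fun x =>
    ∑ i ∈ Finset.range a, if a.testBit i then g.matrix (e x.1) x.2 (m + i) else 0
  -- The target digits, corrected by the constant contribution `b` of the block number.
  set y' : J × Fin k → ZMod 2 := fun x => (if y x.1 x.2 then 1 else 0) - b x
  have hbool : ∀ (u v : ZMod 2) (t : Bool), (decide (u + v = 1) = t) ↔
      u = (if t then 1 else 0) - v := by decide
  have hfilter : ((Finset.range (2 ^ m)).filter fun n =>
      ∀ j (r : Fin k), g.digit (2 ^ m * a + n) (e j) r = y j r) =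
      (Finset.range (2 ^ m)).filter fun n =>
        Matrix.mulVecLin (Matrix.of C) (bitVector m n) = y' := by
    refine Finset.filter_congr fun n hn => ?_
    rw [funext_iff, Prod.forall]
    refine forall_congr' fun j => forall_congr' fun r => ?_
    have := g.digitSum_block m a n (Finset.mem_range.1 hn) (e j) r
    unfold SobolGenerator.digit
    change decide (g.digitSum _ _ _ = 1) = _ ↔ _
    rw [this, hbool]
    rfl
  have hcard := card_fiber_mul_of_surjective _ hsurj y'
  rw [hfilter, card_filter_range_bitVector m fun x => Matrix.mulVecLin (Matrix.of C) x = y']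
  simpa using hcard

/-! ### Fair coin sequences and the uniform law -/

/-- The uniform law on `{false, true}`. -/
noncomputable def fairCoin : Measure Bool := (2⁻¹ : ENNReal) • Measure.count

instance : IsProbabilityMeasure fairCoin := ⟨by
  have h : (Measure.count (Set.univ : Set Bool)) = 2 := by
    rw [Measure.count_apply MeasurableSet.univ, Set.encard_univ]; simp
  rw [fairCoin, Measure.smul_apply, h, smul_eq_mul, ENNReal.inv_mul_cancel (by simp) (by simp)]⟩

theorem eq_fairCoin {μ : Measure Bool} [IsProbabilityMeasure μ] (h : μ {true} = 1 / 2) :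
    μ = fairCoin := by
  have hf : μ {false} = 1 / 2 := by
    have : ({false} : Set Bool) = {true}ᶜ := by ext b; cases b <;> simp
    rw [this, prob_compl_eq_one_sub (measurableSet_singleton _), h]
    simp
  refine Measure.ext_of_singleton fun b => ?_
  cases b <;> simp [fairCoin, hf, h]

theorem map_xor_fairCoin (c : Bool) : fairCoin.map (fun b => xor c b) = fairCoin := by
  have : IsProbabilityMeasure (fairCoin.map fun b => xor c b) :=
    Measure.isProbabilityMeasure_map (measurable_of_finite _).aemeasurable
  refine eq_fairCoin ?_
  rw [Measure.map_apply (measurable_of_finite _) (measurableSet_singleton _)]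
  have : (fun b => xor c b) ⁻¹' {true} = {!c} := by ext b; cases b <;> cases c <;> simp
  rw [this]; simp [fairCoin]

theorem integral_fairCoin (f : Bool → ℂ) : ∫ b, f b ∂fairCoin = (f true + f false) / 2 := by
  rw [fairCoin, integral_smul_measure, integral_count]
  simp; ring

/-- Functions of disjoint subfamilies of an independent family are independent. -/
theorem indepFun_of_disjoint {I Ω E F : Type*} {β : I → Type*} [∀ i, MeasurableSpace (β i)]
    [mΩ : MeasurableSpace Ω] [MeasurableSpace E] [MeasurableSpace F] {μ : Measure Ω}
    {X : ∀ i, Ω → β i} (hX : ∀ i, Measurable (X i)) (hind : iIndepFun X μ) {S T : Set I}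
    (hST : Disjoint S T) {f : Ω → E} {g : Ω → F}
    (hf : Measurable[⨆ i ∈ S, MeasurableSpace.comap (X i) inferInstance] f)
    (hg : Measurable[⨆ i ∈ T, MeasurableSpace.comap (X i) inferInstance] g) : IndepFun f g μ := by
  have h := indep_iSup_of_disjoint (fun i => (hX i).comap_le) ((iIndepFun_iff_iIndep _ _ _).1 hind)
    hST
  rw [IndepFun_iff_Indep]
  exact indep_of_indep_of_le_left (indep_of_indep_of_le_right h hg.comap_le) hf.comap_le

theorem measurable_iSup_comap {I Ω : Type*} {β : I → Type*} [∀ i, MeasurableSpace (β i)]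
    (X : ∀ i, Ω → β i) {S : Set I} {i : I} (hi : i ∈ S) :
    Measurable[⨆ i ∈ S, MeasurableSpace.comap (X i) inferInstance] (X i) :=
  (comap_measurable (X i)).mono (le_iSup₂_of_le i hi le_rfl) le_rfl

theorem summable_half_pow : Summable fun r : ℕ => (1 / 2 : ℝ) ^ (r + 1) := by
  simpa [pow_succ] using summable_geometric_two.mul_right (1 / 2 : ℝ)

theorem summable_binaryValue (b : ℕ → Bool) :
    Summable fun r : ℕ => (if b r then (1 : ℝ) else 0) * (1 / 2) ^ (r + 1) := by
  refine Summable.of_nonneg_of_le (fun r => ?_) (fun r => ?_) summable_half_pow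
  · split_ifs <;> positivity
  · split_ifs <;> simp

theorem measurable_binaryValue : Measurable binaryValue := by
  have h : ∀ b : ℕ → Bool, Tendsto (fun n => ∑ r ∈ Finset.range n,
      (if b r then (1 : ℝ) else 0) * (1 / 2) ^ (r + 1)) atTop (𝓝 (binaryValue b)) := fun b =>
    (summable_binaryValue b).hasSum.tendsto_sum_nat
  refine measurable_of_tendsto_metrizable (f := fun n (b : ℕ → Bool) => ∑ r ∈ Finset.range n,
      (if b r then (1 : ℝ) else 0) * (1 / 2) ^ (r + 1)) (fun n => ?_) (tendsto_pi_nhds.2 h)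
  refine Finset.measurable_sum _ fun r _ => Measurable.mul_const ?_ _
  exact (measurable_of_finite fun t : Bool => if t then (1 : ℝ) else 0).comp (measurable_pi_apply r)

/-- This self-similarity is the source of the functional equation of the characteristic function. -/
theorem binaryValue_eq_add (b : ℕ → Bool) :
    binaryValue b = (if b 0 then (1 : ℝ) else 0) * (1 / 2) +
      (1 / 2) * binaryValue fun r => b (r + 1) := by
  unfold binaryValue
  rw [(summable_binaryValue b).tsum_eq_zero_add, ← tsum_mul_left]
  congr 1
  · simp
  · exact tsum_congr fun r => by ring

/-- The law of a sequence of independent fair bits. -/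
noncomputable abbrev coinMeasure (I : Type*) : Measure (I → Bool) :=
  Measure.infinitePi fun _ => fairCoin

theorem map_coinMeasure_comp {I J : Type*} (e : J → I) (he : Function.Injective e) :
    (coinMeasure I).map (fun b j => b (e j)) = coinMeasure J := by
  have h : iIndepFun (fun j (b : I → Bool) => b (e j)) (coinMeasure I) :=
    (iIndepFun_infinitePi (P := fun _ : I => fairCoin) (X := fun _ b => b)
      fun _ => measurable_id).precomp he
  rw [h.map_fun_eq_infinitePi_map fun j => measurable_pi_apply _]
  congr 1
  funext j
  exact Measure.infinitePi_map_eval _ _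

/-- The first bit is independent of the shifted sequence, and the shifted sequence has the original
law. -/
theorem charFun_map_binaryValue (t : ℝ) :
    charFun ((coinMeasure ℕ).map binaryValue) t =
      (Complex.exp (t / 2 * Complex.I) + 1) / 2 *
        charFun ((coinMeasure ℕ).map binaryValue) (t / 2) := by
  have hsh : Measurable fun (b : ℕ → Bool) r => b (r + 1) := by fun_prop
  have hind : IndepFun (fun b : ℕ → Bool => b 0) (fun (b : ℕ → Bool) r => b (r + 1))
      (coinMeasure ℕ) := by
    refine indepFun_of_disjoint (X := fun i (b : ℕ → Bool) => b i) (S := {0}) (T := Set.Ioi 0)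
      (fun i => measurable_pi_apply i)
      (iIndepFun_infinitePi (P := fun _ : ℕ => fairCoin) (X := fun _ b => b)
        fun _ => measurable_id) (by simp) ?_ ?_
    · exact measurable_iSup_comap (fun i (b : ℕ → Bool) => b i) rfl
    · refine @measurable_pi_lambda _ _ _ (_) _ _ fun r => ?_
      exact measurable_iSup_comap (fun i (b : ℕ → Bool) => b i) (Nat.succ_pos r)
  rw [charFun_apply_real, charFun_apply_real,
    integral_map measurable_binaryValue.aemeasurable (by fun_prop),
    integral_map measurable_binaryValue.aemeasurable (by fun_prop)]
  set φ : Bool → ℂ := fun b => Complex.exp (t * (((if b then (1 : ℝ) else 0) * (1 / 2) : ℝ) : ℂ)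
    * Complex.I)
  set ψ : (ℕ → Bool) → ℂ := fun b => Complex.exp ((t / 2 : ℝ) * (binaryValue b : ℂ) * Complex.I)
  have hψ : Measurable ψ := by
    have := measurable_binaryValue
    fun_prop
  have hφ : Measurable φ := measurable_of_finite _
  have h1 : ∀ b : ℕ → Bool, Complex.exp (t * (binaryValue b : ℂ) * Complex.I) =
      φ (b 0) * ψ fun r => b (r + 1) := by
    intro b
    rw [binaryValue_eq_add b, ← Complex.exp_add]
    congr 1
    push_cast
    ring
  simp_rw [h1]
  have h2 := (hind.comp hφ hψ).integral_fun_mul_eq_mul_integral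
    (hφ.comp (measurable_pi_apply 0)).aestronglyMeasurable (hψ.comp hsh).aestronglyMeasurable
  simp only [Function.comp_apply] at h2
  rw [h2]
  congr 1
  · have h3 := integral_map (μ := coinMeasure ℕ) (φ := fun b => b 0) (f := φ)
      (measurable_pi_apply 0).aemeasurable hφ.aestronglyMeasurable
    rw [← h3, Measure.infinitePi_map_eval, integral_fairCoin]
    simp only [φ]
    simp
    congr 2
  · have h3 := integral_map (μ := coinMeasure ℕ) (φ := fun b r => b (r + 1)) (f := ψ)
      hsh.aemeasurable hψ.aestronglyMeasurable
    rw [← h3, map_coinMeasure_comp (fun r => r + 1) (add_left_injective 1)]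

/-- The uniform law satisfies the same equation, by `exp (it) - 1 = (exp (it/2) - 1) (exp (it/2) +
1)`. -/
theorem charFun_uniform (t : ℝ) :
    charFun (volume.restrict (Set.Icc (0 : ℝ) 1)) t =
      (Complex.exp (t / 2 * Complex.I) + 1) / 2 *
        charFun (volume.restrict (Set.Icc (0 : ℝ) 1)) (t / 2) := by
  have h : ∀ s : ℝ, s ≠ 0 → charFun (volume.restrict (Set.Icc (0 : ℝ) 1)) s =
      (Complex.exp (s * Complex.I) - 1) / (s * Complex.I) := by
    intro s hs
    have hc : (s : ℂ) * Complex.I ≠ 0 :=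
      mul_ne_zero (Complex.ofReal_ne_zero.2 hs) Complex.I_ne_zero
    have := integral_exp_mul_complex (a := 0) (b := 1) hc
    rw [charFun_apply_real, integral_Icc_eq_integral_Ioc, ← intervalIntegral.integral_of_le
      zero_le_one]
    simp only [mul_right_comm _ _ Complex.I, this]
    simp
  rcases eq_or_ne t 0 with rfl | ht
  · simp
  · rw [h t ht, h (t / 2) (by simpa using ht)]
    have : Complex.exp (t * Complex.I) = Complex.exp (t / 2 * Complex.I) ^ 2 := by
      rw [← Complex.exp_nat_mul]; congr 1; push_cast; ring
    rw [this]
    have hc : (t : ℂ) ≠ 0 := Complex.ofReal_ne_zero.2 ht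
    push_cast
    field_simp
    ring

/-- Independent fair bits are the binary digits of a uniform variable. -/
theorem map_binaryValue :
    (coinMeasure ℕ).map binaryValue = volume.restrict (Set.Icc (0 : ℝ) 1) := by
  have hp : IsProbabilityMeasure (volume.restrict (Set.Icc (0 : ℝ) 1)) := ⟨by simp⟩
  have hp' : IsProbabilityMeasure ((coinMeasure ℕ).map binaryValue) :=
    Measure.isProbabilityMeasure_map measurable_binaryValue.aemeasurable
  refine Measure.ext_of_charFun ?_
  funext t
  set φ := charFun ((coinMeasure ℕ).map binaryValue)
  set ψ := charFun (volume.restrict (Set.Icc (0 : ℝ) 1))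
  -- The common factor has modulus at most one, so the gap at `t` is at most the gap at `t / 2 ^ n`,
  -- which tends to zero because both functions are continuous and equal `1` at the origin.
  have hle : ∀ n : ℕ, ‖φ t - ψ t‖ ≤ ‖φ (t / 2 ^ n) - ψ (t / 2 ^ n)‖ := by
    intro n
    induction n with
    | zero => simp
    | succ n ih =>
      refine ih.trans ?_
      rw [show φ _ = _ from charFun_map_binaryValue (t / 2 ^ n),
        show ψ _ = _ from charFun_uniform (t / 2 ^ n), ← mul_sub, norm_mul,
        pow_succ, ← div_div]
      refine mul_le_of_le_one_left (norm_nonneg _) ?_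
      rw [norm_div, Complex.norm_ofNat, div_le_one (by norm_num)]
      refine (norm_add_le _ _).trans ?_
      have : ‖Complex.exp ((t / 2 ^ n : ℝ) / 2 * Complex.I)‖ = 1 := by
        have := Complex.norm_exp_ofReal_mul_I (t / 2 ^ n / 2)
        push_cast at this ⊢
        exact this
      rw [this, norm_one]; norm_num
  have hlim : Tendsto (fun n : ℕ => ‖φ (t / 2 ^ n) - ψ (t / 2 ^ n)‖) atTop (𝓝 0) := by
    have h0 : Tendsto (fun n : ℕ => t / 2 ^ n) atTop (𝓝 0) :=
      tendsto_const_nhds.div_atTop (tendsto_pow_atTop_atTop_of_one_lt one_lt_two)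
    have hc : Continuous fun s => ‖φ s - ψ s‖ := (continuous_charFun.sub continuous_charFun).norm
    have := (hc.tendsto 0).comp h0
    simpa [φ, ψ, charFun_zero, Function.comp_def] using this
  have := ge_of_tendsto' hlim hle
  exact sub_eq_zero.1 (norm_le_zero_iff.1 this)

/-- The vector of the real numbers with given binary digits. -/
noncomputable def binaryVector {D : ℕ} (b : Fin D → ℕ → Bool) : Euc D :=
  WithLp.toLp 2 fun j => binaryValue (b j)

theorem measurable_binaryVector {D : ℕ} : Measurable (binaryVector (D := D)) := by
  refine (WithLp.measurable_toLp _ _).comp (measurable_pi_lambda _ fun j => ?_)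
  exact measurable_binaryValue.comp (measurable_pi_apply j)

theorem map_binaryVector (D : ℕ) :
    ((coinMeasure (Fin D × ℕ)).map fun b => binaryVector fun j r => b (j, r)) =
      volume.restrict (cube D) := by
  have hcurry := Measure.infinitePi_map_curry (ι := Fin D) (κ := ℕ) fun _ _ => fairCoin
  have h1 : (coinMeasure (Fin D × ℕ)).map (fun b (j : Fin D) => binaryValue fun r => b (j, r)) =
      Measure.pi fun _ => volume.restrict (Set.Icc (0 : ℝ) 1) := by
    have hp : IsProbabilityMeasure (volume.restrict (Set.Icc (0 : ℝ) 1)) := ⟨by simp⟩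
    have h2 := Measure.infinitePi_map_pi (ι := Fin D) (fun _ => coinMeasure ℕ)
      (f := fun _ => binaryValue) fun _ => measurable_binaryValue
    rw [← hcurry, Measure.map_map (by
      refine measurable_pi_lambda _ fun j => ?_
      exact measurable_binaryValue.comp (measurable_pi_apply j))
      (MeasurableEquiv.measurable _)] at h2
    have h3 := h2
    simp_rw [map_binaryValue] at h3
    rw [Measure.infinitePi_eq_pi (fun _ : Fin D => volume.restrict (Set.Icc (0 : ℝ) 1))] at h3
    exact h3
  have hb : Measurable fun (b : Fin D × ℕ → Bool) (j : Fin D) => binaryValue fun r => b (j, r) := by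
    refine measurable_pi_lambda _ fun j => measurable_binaryValue.comp ?_
    fun_prop
  have h4 : (coinMeasure (Fin D × ℕ)).map (fun b => binaryVector fun j r => b (j, r)) =
      ((coinMeasure (Fin D × ℕ)).map
        (fun b (j : Fin D) => binaryValue fun r => b (j, r))).map (WithLp.toLp 2) := by
    rw [Measure.map_map (WithLp.measurable_toLp _ _) hb]
    rfl
  rw [h4, h1, ← Measure.restrict_pi_pi, ← volume_pi]
  have hmp := PiLp.volume_preserving_toLp (Fin D)
  have hcube : Set.univ.pi (fun _ : Fin D => Set.Icc (0 : ℝ) 1) = WithLp.toLp 2 ⁻¹' cube D := by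
    ext v; simp [cube, Pi.le_def, forall_and]
  have hms : MeasurableSet (cube D) := by
    have : cube D = ⋂ j, {v : Euc D | v j ∈ Set.Icc (0 : ℝ) 1} := by ext v; simp [cube]
    rw [this]
    refine MeasurableSet.iInter fun j => ?_
    exact measurableSet_Icc.preimage (by fun_prop)
  rw [hcube, (hmp.restrict_preimage hms).map_eq]

/-! ### Nested uniform scrambling -/

/-- A single nested uniform scramble in dimension `D`. -/
structure IsFairScramble {Ω' : Type*} [MeasurableSpace Ω'] (Q : Measure Ω') {D : ℕ}
    (ξ : Fin D → List Bool → Ω' → Bool) : Prop where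
  measurable : ∀ j w, Measurable (ξ j w)
  uniform : ∀ j w, Q {ω | ξ j w ω = true} = 1 / 2
  independent : iIndepFun (fun a : Fin D × List Bool => ξ a.1 a.2) Q

theorem IsNestedUniformScramble.isFairScramble {Ω' : Type*} [MeasurableSpace Ω'] {Q : Measure Ω'}
    {S D : ℕ} {ξ : Fin S → Fin D → List Bool → Ω' → Bool} (h : IsNestedUniformScramble Q ξ)
    (s : Fin S) : IsFairScramble Q (ξ s) where
  measurable := h.measurable s
  uniform := h.uniform s
  independent := h.independent.precomp (g := fun a : Fin D × List Bool => (s, a.1, a.2))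
    fun a b hab => by simpa [Prod.ext_iff] using hab

/-- The scrambled digits of a vector of digit sequences. -/
def scrambled {Ω' : Type*} {D : ℕ} (ξ : Fin D → List Bool → Ω' → Bool) (b : Fin D → ℕ → Bool)
    (ω : Ω') (j : Fin D) (r : ℕ) : Bool :=
  scrambleDigits (fun w => ξ j w ω) (b j) r

/-- The first `q` digits of all coordinates. -/
def headDigits {D : ℕ} (q : ℕ) (y : Fin D → ℕ → Bool) : Fin D → Fin q → Bool := fun j r => y j r

/-- The digits of all coordinates after the first `q`. -/
def tailDigits {D : ℕ} (q : ℕ) (y : Fin D → ℕ → Bool) : Fin D → ℕ → Bool := fun j r => y j (q + r)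

/-- Concatenation of the first `q` digits with the others. -/
def joinDigits {D : ℕ} (q : ℕ) (x : (Fin D → Fin q → Bool) × (Fin D → ℕ → Bool)) :
    Fin D → ℕ → Bool :=
  fun j r => if h : r < q then x.1 j ⟨r, h⟩ else x.2 j (r - q)

theorem joinDigits_head_tail {D : ℕ} (q : ℕ) (y : Fin D → ℕ → Bool) :
    joinDigits q (headDigits q y, tailDigits q y) = y := by
  funext j r
  simp only [joinDigits, headDigits, tailDigits]
  split_ifs with h
  · rfl
  · rw [Nat.add_sub_cancel' (not_lt.1 h)]

theorem measurable_headDigits {D q : ℕ} : Measurable (headDigits (D := D) q) := by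
  unfold headDigits; fun_prop

theorem measurable_tailDigits {D q : ℕ} : Measurable (tailDigits (D := D) q) := by
  unfold tailDigits; fun_prop

theorem measurable_joinDigits {D q : ℕ} : Measurable (joinDigits (D := D) q) := by
  refine measurable_pi_lambda _ fun j => measurable_pi_lambda _ fun r => ?_
  unfold joinDigits
  by_cases h : r < q
  · simp only [h, dite_true]; fun_prop
  · simp only [h, dite_false]; fun_prop

/-- The law of independent fair digits. -/
noncomputable def digitMeasure (D : ℕ) : Measure (Fin D → ℕ → Bool) :=
  (coinMeasure (Fin D × ℕ)).map fun b j r => b (j, r)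

theorem measurable_curry_digits (D : ℕ) :
    Measurable fun (b : Fin D × ℕ → Bool) (j : Fin D) (r : ℕ) => b (j, r) := by fun_prop

instance (D : ℕ) : IsProbabilityMeasure (digitMeasure D) :=
  Measure.isProbabilityMeasure_map (measurable_curry_digits D).aemeasurable

theorem map_binaryVector_digitMeasure (D : ℕ) :
    (digitMeasure D).map binaryVector = volume.restrict (cube D) := by
  rw [digitMeasure, Measure.map_map measurable_binaryVector (measurable_curry_digits D),
    ← map_binaryVector]
  rfl

section Law

variable {Ω' : Type*} [MeasurableSpace Ω'] {Q : Measure Ω'} {D : ℕ}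
  {ξ : Fin D → List Bool → Ω' → Bool}

theorem IsFairScramble.measurable_scrambled (h : IsFairScramble Q ξ) (b : Fin D → ℕ → Bool) :
    Measurable (scrambled ξ b) := by
  refine measurable_pi_lambda _ fun j => measurable_pi_lambda _ fun r => ?_
  exact (measurable_of_finite fun t => xor (b j r) t).comp (h.measurable j _)

theorem IsFairScramble.measurable_headDigits (h : IsFairScramble Q ξ) (b : Fin D → ℕ → Bool)
    (q : ℕ) : Measurable fun ω => headDigits q (scrambled ξ b ω) :=
  MSRM.measurable_headDigits.comp (h.measurable_scrambled b)

theorem IsFairScramble.measurable_tailDigits (h : IsFairScramble Q ξ) (b : Fin D → ℕ → Bool)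
    (q : ℕ) : Measurable fun ω => tailDigits q (scrambled ξ b ω) :=
  MSRM.measurable_tailDigits.comp (h.measurable_scrambled b)

/-- The length of the prefix recovers the digit position, so distinct digits of one point are
scrambled by distinct bits. -/
theorem prefix_injective (b : Fin D → ℕ → Bool) (q : ℕ) :
    Function.Injective fun x : Fin D × ℕ => (x.1, (List.range (q + x.2)).map (b x.1)) := by
  intro x y hxy
  simp only [Prod.mk.injEq] at hxy
  have := congrArg List.length hxy.2
  simp only [List.length_map, List.length_range] at this
  exact Prod.ext hxy.1 (by omega)

/-- Each scrambled digit is a fixed digit plus a fair bit of its own, hence again fair, and these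
bits are independent. -/
theorem IsFairScramble.map_tailDigits [IsProbabilityMeasure Q] (h : IsFairScramble Q ξ)
    (b : Fin D → ℕ → Bool) (q : ℕ) :
    Q.map (fun ω => tailDigits q (scrambled ξ b ω)) = digitMeasure D := by
  have hind : iIndepFun (fun (x : Fin D × ℕ) ω => scrambled ξ b ω x.1 (q + x.2)) Q :=
    (h.independent.precomp (prefix_injective b q)).comp (fun x t => xor (b x.1 (q + x.2)) t)
      fun x => measurable_of_finite _
  have hm : ∀ x : Fin D × ℕ, Measurable fun ω => scrambled ξ b ω x.1 (q + x.2) := fun x =>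
    (measurable_pi_apply x.2).comp ((measurable_pi_apply x.1).comp (h.measurable_tailDigits b q))
  have hlaw := hind.map_fun_eq_infinitePi_map hm
  have hcoin : ∀ x : Fin D × ℕ, Q.map (fun ω => scrambled ξ b ω x.1 (q + x.2)) = fairCoin := by
    intro x
    have h1 : Q.map (ξ x.1 ((List.range (q + x.2)).map (b x.1))) = fairCoin := by
      have : IsProbabilityMeasure (Q.map (ξ x.1 ((List.range (q + x.2)).map (b x.1)))) :=
        Measure.isProbabilityMeasure_map (h.measurable _ _).aemeasurable
      refine eq_fairCoin ?_
      rw [Measure.map_apply (h.measurable _ _) (measurableSet_singleton _)]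
      exact h.uniform _ _
    rw [← map_xor_fairCoin (b x.1 (q + x.2)), ← h1,
      Measure.map_map (measurable_of_finite _) (h.measurable _ _)]
    rfl
  simp_rw [hcoin] at hlaw
  rw [digitMeasure, coinMeasure, ← hlaw, Measure.map_map (measurable_curry_digits D)
    (measurable_pi_lambda _ hm)]
  rfl

theorem IsFairScramble.map_scrambled [IsProbabilityMeasure Q] (h : IsFairScramble Q ξ)
    (b : Fin D → ℕ → Bool) : Q.map (scrambled ξ b) = digitMeasure D := by
  have := h.map_tailDigits b 0
  have h0 : ∀ y : Fin D → ℕ → Bool, tailDigits 0 y = y := fun y => by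
    funext j r; simp [tailDigits]
  simpa only [h0] using this

/-- The tail digits of a scrambled point are independent of its first digits and of every
scrambled point whose original has different first digits in each coordinate. -/
theorem IsFairScramble.indepFun_tail (h : IsFairScramble Q ξ)
    {b b' : Fin D → ℕ → Bool} {q : ℕ} (hb : ∀ j, ∃ r < q, b j r ≠ b' j r) :
    IndepFun (fun ω => tailDigits q (scrambled ξ b ω))
      (fun ω => (headDigits q (scrambled ξ b ω), scrambled ξ b' ω)) Q := by
  -- `H` labels the bits used by the tail of `b`. The head of `b` uses shorter prefixes. A prefix of
  -- `b'` of length at least `q` is not one of `b`, since the two already differ within the first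
  -- `q` digits.
  set H : Set (Fin D × List Bool) :=
    Set.range fun x : Fin D × ℕ => (x.1, (List.range (q + x.2)).map (b x.1)) with hH
  have hξ := fun S i hi => measurable_iSup_comap (fun a : Fin D × List Bool => ξ a.1 a.2)
    (S := S) (i := i) hi
  refine indepFun_of_disjoint (X := fun a : Fin D × List Bool => ξ a.1 a.2) (S := H) (T := Hᶜ)
    (fun a => h.measurable _ _) h.independent disjoint_compl_right ?_ ?_
  · refine @measurable_pi_lambda _ _ _ (_) _ _ fun j => @measurable_pi_lambda _ _ _ (_) _ _
      fun r => ?_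
    exact (measurable_of_finite fun t => xor (b j (q + r)) t).comp
      (hξ H (j, (List.range (q + r)).map (b j)) ⟨(j, r), rfl⟩)
  · refine @Measurable.prodMk _ _ _ (_) (_) (_) _ _ ?_ ?_
    · refine @measurable_pi_lambda _ _ _ (_) _ _ fun j => @measurable_pi_lambda _ _ _ (_) _ _
        fun r => ?_
      refine (measurable_of_finite fun t => xor (b j r) t).comp
        (hξ Hᶜ (j, (List.range r).map (b j)) ?_)
      rintro ⟨x, hx⟩
      simp only [Prod.mk.injEq] at hx
      have := congrArg List.length hx.2
      simp only [List.length_map, List.length_range] at this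
      omega
    · refine @measurable_pi_lambda _ _ _ (_) _ _ fun j => @measurable_pi_lambda _ _ _ (_) _ _
        fun r => ?_
      refine (measurable_of_finite fun t => xor (b' j r) t).comp
        (hξ Hᶜ (j, (List.range r).map (b' j)) ?_)
      rintro ⟨x, hx⟩
      simp only [Prod.mk.injEq] at hx
      obtain ⟨rfl, hx⟩ := hx
      have hl := congrArg List.length hx
      simp only [List.length_map, List.length_range] at hl
      obtain ⟨i, hi, hne⟩ := hb x.1
      subst hl
      rw [List.map_inj_left] at hx
      exact hne (hx i (List.mem_range.2 (by omega)))

theorem IsFairScramble.indepFun_tail_head [IsProbabilityMeasure Q] (h : IsFairScramble Q ξ)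
    (b : Fin D → ℕ → Bool)
    (q : ℕ) : IndepFun (fun ω => tailDigits q (scrambled ξ b ω))
      (fun ω => headDigits q (scrambled ξ b ω)) Q := by
  rcases Nat.eq_zero_or_pos q with rfl | hq
  · have : (fun ω => headDigits 0 (scrambled ξ b ω)) = fun _ => fun _ r => r.elim0 := by
      funext ω j r; exact r.elim0
    rw [this]
    exact indepFun_const_right _ _
  -- The complement of `b` serves as an auxiliary point: it differs at digit `0` in every
  -- coordinate, which is why `q = 0` is treated apart.
  · refine (h.indepFun_tail (b' := fun j r => !(b j r)) (q := q) fun j => ⟨0, hq, by simp⟩).comp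
      measurable_id measurable_fst

end Law

/-! ### Second moments of scrambled sums -/

section Moments

variable {Ω' : Type*} [MeasurableSpace Ω'] {Q : Measure Ω'} [IsProbabilityMeasure Q] {D : ℕ}
  {ξ : Fin D → List Bool → Ω' → Bool} {F : (Fin D → ℕ → Bool) → ℝ}

/-- The average of `F` over the points with given first digits. -/
noncomputable def headMean {D : ℕ} (F : (Fin D → ℕ → Bool) → ℝ) (q : ℕ)
    (p : Fin D → Fin q → Bool) : ℝ :=
  ∫ t, F (joinDigits q (p, t)) ∂digitMeasure D

theorem integral_sq_le {Ω : Type*} [MeasurableSpace Ω] {μ : Measure Ω} [IsProbabilityMeasure μ]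
    {f : Ω → ℝ} (hf : MemLp f 2 μ) : (∫ x, f x ∂μ) ^ 2 ≤ ∫ x, f x ^ 2 ∂μ := by
  have h := variance_nonneg f μ
  rw [variance_eq_sub hf] at h
  simpa using h

theorem IsFairScramble.memLp_comp (h : IsFairScramble Q ξ) (hF : MemLp F 2 (digitMeasure D))
    (b : Fin D → ℕ → Bool) : MemLp (fun ω => F (scrambled ξ b ω)) 2 Q :=
  hF.comp_measurePreserving ⟨h.measurable_scrambled b, h.map_scrambled b⟩

theorem IsFairScramble.map_tail_head (h : IsFairScramble Q ξ) (b : Fin D → ℕ → Bool) (q : ℕ) :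
    Q.map (fun ω => (headDigits q (scrambled ξ b ω), tailDigits q (scrambled ξ b ω))) =
      (Q.map fun ω => headDigits q (scrambled ξ b ω)).prod (digitMeasure D) := by
  have := (indepFun_iff_map_prod_eq_prod_map_map
    (h.measurable_headDigits b q).aemeasurable
    (h.measurable_tailDigits b q).aemeasurable).1
    (h.indepFun_tail_head b q).symm
  rw [← h.map_tailDigits b q]
  exact this

/-- The head of a scrambled point followed by an independent fair tail is again a fair sequence;
integrals of `F` thus split by Fubini into head and tail. -/
theorem IsFairScramble.measurePreserving_joinDigits (h : IsFairScramble Q ξ)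
    (b : Fin D → ℕ → Bool) (q : ℕ) : MeasurePreserving (joinDigits q)
      ((Q.map fun ω => headDigits q (scrambled ξ b ω)).prod (digitMeasure D)) (digitMeasure D) := by
  refine ⟨measurable_joinDigits, ?_⟩
  rw [← h.map_tail_head, Measure.map_map measurable_joinDigits
    ((h.measurable_headDigits b q).prodMk (h.measurable_tailDigits b q)), ← h.map_scrambled b]
  congr 1
  funext ω
  exact joinDigits_head_tail q _

theorem IsFairScramble.integral_headMean (h : IsFairScramble Q ξ)
    (hF : MemLp F 2 (digitMeasure D)) (b : Fin D → ℕ → Bool) (q : ℕ) :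
    ∫ ω, headMean F q (headDigits q (scrambled ξ b ω)) ∂Q = ∫ y, F y ∂digitMeasure D := by
  have hm := h.measurable_headDigits b q
  have hmp := h.measurePreserving_joinDigits b q
  have : IsProbabilityMeasure (Q.map fun ω => headDigits q (scrambled ξ b ω)) :=
    Measure.isProbabilityMeasure_map hm.aemeasurable
  rw [← integral_map (φ := fun ω => headDigits q (scrambled ξ b ω)) (f := headMean F q)
    hm.aemeasurable (measurable_of_finite _).aestronglyMeasurable]
  have hint : Integrable (fun x => F (joinDigits q x))
      ((Q.map fun ω => headDigits q (scrambled ξ b ω)).prod (digitMeasure D)) :=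
    (hF.comp_measurePreserving hmp).integrable one_le_two
  have := integral_prod _ hint
  unfold headMean
  rw [← this]
  have h2 := integral_map (μ := (Q.map fun ω => headDigits q (scrambled ξ b ω)).prod
    (digitMeasure D)) (φ := joinDigits q) (f := F) measurable_joinDigits.aemeasurable
    (by rw [hmp.map_eq]; exact hF.1)
  rw [← h2, hmp.map_eq]

/-- Jensen's inequality in the tail for almost every head, then Fubini. -/
theorem IsFairScramble.integral_headMean_sq_le (h : IsFairScramble Q ξ)
    (hF : MemLp F 2 (digitMeasure D)) (b : Fin D → ℕ → Bool) (q : ℕ) :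
    ∫ ω, headMean F q (headDigits q (scrambled ξ b ω)) ^ 2 ∂Q ≤ ∫ y, F y ^ 2 ∂digitMeasure D := by
  have hm := h.measurable_headDigits b q
  have hmp := h.measurePreserving_joinDigits b q
  have : IsProbabilityMeasure (Q.map fun ω => headDigits q (scrambled ξ b ω)) :=
    Measure.isProbabilityMeasure_map hm.aemeasurable
  rw [← integral_map (φ := fun ω => headDigits q (scrambled ξ b ω))
    (f := fun p => headMean F q p ^ 2)
    hm.aemeasurable (measurable_of_finite _).aestronglyMeasurable]
  have hL2 := hF.comp_measurePreserving hmp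
  have hint := hL2.integrable_sq
  have h2 := integral_map (μ := (Q.map fun ω => headDigits q (scrambled ξ b ω)).prod
    (digitMeasure D)) (φ := joinDigits q) (f := fun y => F y ^ 2)
    measurable_joinDigits.aemeasurable (by rw [hmp.map_eq]; exact hF.integrable_sq.1)
  rw [hmp.map_eq] at h2
  rw [h2]
  have h3 := integral_prod _ hint
  simp only [Function.comp_apply] at h3
  rw [h3]
  refine integral_mono_ae Integrable.of_finite Integrable.of_finite ?_
  have hslice := hL2.1.prodMk_left
  filter_upwards [hint.prod_right_ae, hslice] with p hp hp'
  exact integral_sq_le ((memLp_two_iff_integrable_sq hp').2 hp)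

/-- The part of `F` that is not explained by the first digits. -/
noncomputable def headResidual {D : ℕ} (F : (Fin D → ℕ → Bool) → ℝ) (q : ℕ)
    (y : Fin D → ℕ → Bool) : ℝ :=
  F y - headMean F q (headDigits q y)

theorem IsFairScramble.memLp_headMean (h : IsFairScramble Q ξ) (b : Fin D → ℕ → Bool) (q : ℕ) :
    MemLp (fun ω => headMean F q (headDigits q (scrambled ξ b ω))) 2 Q := by
  have hm := h.measurable_headDigits b q
  have : IsProbabilityMeasure (Q.map fun ω => headDigits q (scrambled ξ b ω)) :=
    Measure.isProbabilityMeasure_map hm.aemeasurable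
  exact (MemLp.of_discrete (f := headMean F q)
    (μ := Q.map fun ω => headDigits q (scrambled ξ b ω))).comp_measurePreserving ⟨hm, rfl⟩

theorem IsFairScramble.memLp_headResidual (h : IsFairScramble Q ξ)
    (hF : MemLp F 2 (digitMeasure D)) (b : Fin D → ℕ → Bool) (q : ℕ) :
    MemLp (fun ω => headResidual F q (scrambled ξ b ω)) 2 Q :=
  (h.memLp_comp hF b).sub (h.memLp_headMean b q)

theorem integral_sub_sq_le {Ω : Type*} [MeasurableSpace Ω] {μ : Measure Ω} {f g : Ω → ℝ}
    (hf : MemLp f 2 μ) (hg : MemLp g 2 μ) {B : ℝ} (hfB : ∫ x, f x ^ 2 ∂μ ≤ B)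
    (hgB : ∫ x, g x ^ 2 ∂μ ≤ B) : ∫ x, (f x - g x) ^ 2 ∂μ ≤ 4 * B := by
  calc ∫ x, (f x - g x) ^ 2 ∂μ ≤ ∫ x, (2 * f x ^ 2 + 2 * g x ^ 2) ∂μ := by
        refine integral_mono (hf.sub hg).integrable_sq
          ((hf.integrable_sq.const_mul 2).add (hg.integrable_sq.const_mul 2)) fun x => ?_
        simp only
        linarith [sq_nonneg (f x + g x), add_sq (f x) (g x), sub_sq (f x) (g x)]
    _ = 2 * ∫ x, f x ^ 2 ∂μ + 2 * ∫ x, g x ^ 2 ∂μ := by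
        rw [integral_add (hf.integrable_sq.const_mul 2) (hg.integrable_sq.const_mul 2),
          integral_const_mul, integral_const_mul]
    _ ≤ 4 * B := by linarith

theorem IsFairScramble.integral_comp_sq (h : IsFairScramble Q ξ)
    (hF : MemLp F 2 (digitMeasure D)) (b : Fin D → ℕ → Bool) :
    ∫ ω, F (scrambled ξ b ω) ^ 2 ∂Q = ∫ y, F y ^ 2 ∂digitMeasure D := by
  have := integral_map (μ := Q) (φ := scrambled ξ b) (f := fun y => F y ^ 2)
    (h.measurable_scrambled b).aemeasurable
    (by rw [h.map_scrambled b]; exact hF.integrable_sq.1)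
  rw [← this, h.map_scrambled b]

theorem IsFairScramble.integral_headResidual_sq_le (h : IsFairScramble Q ξ)
    (hF : MemLp F 2 (digitMeasure D)) (b : Fin D → ℕ → Bool) (q : ℕ) :
    ∫ ω, headResidual F q (scrambled ξ b ω) ^ 2 ∂Q ≤ 4 * ∫ y, F y ^ 2 ∂digitMeasure D :=
  integral_sub_sq_le (h.memLp_comp hF b) (h.memLp_headMean b q) (h.integral_comp_sq hF b).le
    (h.integral_headMean_sq_le hF b q)

theorem IsFairScramble.integral_headMean_sub_sq_le (h : IsFairScramble Q ξ)
    (hF : MemLp F 2 (digitMeasure D)) (b : Fin D → ℕ → Bool) (q : ℕ) :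
    ∫ ω, (headMean F q (headDigits q (scrambled ξ b ω)) - ∫ y, F y ∂digitMeasure D) ^ 2 ∂Q ≤
      4 * ∫ y, F y ^ 2 ∂digitMeasure D :=
  integral_sub_sq_le (h.memLp_headMean b q) (memLp_const _) (h.integral_headMean_sq_le hF b q)
    (by simpa using integral_sq_le hF)

/-- Residuals of points whose originals differ early in each coordinate are uncorrelated. -/
theorem IsFairScramble.integral_headResidual_mul_eq_zero (h : IsFairScramble Q ξ)
    (hFm : Measurable F) (hF : MemLp F 2 (digitMeasure D)) {b b' : Fin D → ℕ → Bool} {q : ℕ}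
    (hb : ∀ j, ∃ r < q, b j r ≠ b' j r) :
    ∫ ω, headResidual F q (scrambled ξ b ω) * headResidual F q (scrambled ξ b' ω) ∂Q = 0 := by
  have hm1 := h.measurable_tailDigits b q
  have hmh := h.measurable_headDigits b q
  have hm2 := hmh.prodMk (h.measurable_scrambled b')
  have hres : Measurable (headResidual F q) :=
    hFm.sub ((measurable_of_finite (headMean F q)).comp MSRM.measurable_headDigits)
  set lam := Q.map fun ω => (headDigits q (scrambled ξ b ω), scrambled ξ b' ω) with hlam
  have : IsProbabilityMeasure lam := Measure.isProbabilityMeasure_map hm2.aemeasurable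
  have hlaw := (indepFun_iff_map_prod_eq_prod_map_map hm2.aemeasurable hm1.aemeasurable).1
    (h.indepFun_tail hb).symm
  -- Independence replaces the tail of the first point by a fresh one. Integrating over it with the
  -- other variables fixed gives zero, because `headMean` is exactly that average.
  set Ψ : ((Fin D → Fin q → Bool) × (Fin D → ℕ → Bool)) × (Fin D → ℕ → Bool) → ℝ := fun x =>
    (F (joinDigits q (x.1.1, x.2)) - headMean F q x.1.1) * headResidual F q x.1.2 with hΨ
  have hΨm : Measurable Ψ := by
    refine Measurable.mul (Measurable.sub ?_ ?_) (hres.comp (by fun_prop))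
    · exact hFm.comp (measurable_joinDigits.comp (by fun_prop))
    · exact (measurable_of_finite (headMean F q)).comp (by fun_prop)
  have h1 : ∫ ω, headResidual F q (scrambled ξ b ω) * headResidual F q (scrambled ξ b' ω) ∂Q =
      ∫ x, Ψ x ∂(lam.prod (digitMeasure D)) := by
    rw [← h.map_tailDigits b q, hlam]
    erw [← hlaw]
    rw [integral_map (hm2.prodMk hm1).aemeasurable hΨm.aestronglyMeasurable]
    refine integral_congr_ae (Eventually.of_forall fun ω => ?_)
    simp only [hΨ, headResidual, joinDigits_head_tail]
  rw [h1]
  -- Integrability need not be proved: in the other case the Bochner integral is zero by convention.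
  by_cases hint : Integrable Ψ (lam.prod (digitMeasure D))
  · rw [integral_prod _ hint]
    refine integral_eq_zero_of_ae ?_
    have hhead : ∀ᵐ x ∂lam, Integrable (fun t => F (joinDigits q (x.1, t))) (digitMeasure D) := by
      have hmp := h.measurePreserving_joinDigits b q
      have hF1 : Integrable (fun x => F (joinDigits q x))
          ((Q.map fun ω => headDigits q (scrambled ξ b ω)).prod (digitMeasure D)) :=
        (hF.comp_measurePreserving hmp).integrable one_le_two
      have hp : Q.map (fun ω => headDigits q (scrambled ξ b ω)) = lam.map Prod.fst := by
        rw [hlam, Measure.map_map measurable_fst hm2]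
        rfl
      have hpp : IsProbabilityMeasure (Q.map fun ω => headDigits q (scrambled ξ b ω)) :=
        Measure.isProbabilityMeasure_map hmh.aemeasurable
      have := hF1.prod_right_ae
      rw [hp] at this
      exact ae_of_ae_map measurable_fst.aemeasurable this
    filter_upwards [hhead] with x hx
    simp only [hΨ, Pi.zero_apply]
    rw [integral_mul_const, integral_sub hx (integrable_const _)]
    simp [headMean]
  · exact integral_undef hint

/-- From `2xy ≤ x² + y²`; this serves the pairs that share a prefix, where no cancellation is
available. -/
theorem IsFairScramble.integral_headResidual_mul_le (h : IsFairScramble Q ξ)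
    (hF : MemLp F 2 (digitMeasure D)) (b b' : Fin D → ℕ → Bool) (q : ℕ) :
    ∫ ω, headResidual F q (scrambled ξ b ω) * headResidual F q (scrambled ξ b' ω) ∂Q ≤
      4 * ∫ y, F y ^ 2 ∂digitMeasure D := by
  have h1 := h.memLp_headResidual hF b q
  have h2 := h.memLp_headResidual hF b' q
  calc _ ≤ ∫ ω, (2⁻¹ * headResidual F q (scrambled ξ b ω) ^ 2 +
        2⁻¹ * headResidual F q (scrambled ξ b' ω) ^ 2) ∂Q := by
        refine integral_mono (h1.integrable_mul h2)
          ((h1.integrable_sq.const_mul _).add (h2.integrable_sq.const_mul _)) fun ω => ?_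
        have := two_mul_le_add_sq (headResidual F q (scrambled ξ b ω))
          (headResidual F q (scrambled ξ b' ω))
        simp only
        linarith
    _ ≤ _ := by
        rw [integral_add (h1.integrable_sq.const_mul _) (h2.integrable_sq.const_mul _),
          integral_const_mul, integral_const_mul]
        linarith [h.integral_headResidual_sq_le hF b q, h.integral_headResidual_sq_le hF b' q]

end Moments

/-! ### Sums over blocks of the scrambled Sobol sequence -/

theorem scrambleDigits_congr {π : List Bool → Bool} {b b' : ℕ → Bool} {q : ℕ}
    (h : ∀ r < q, b r = b' r) {r : ℕ} (hr : r < q) :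
    scrambleDigits π b r = scrambleDigits π b' r := by
  have : (List.range r).map b = (List.range r).map b' :=
    List.map_congr_left fun i hi => h i ((List.mem_range.1 hi).trans hr)
  rw [scrambleDigits, scrambleDigits, this, h r hr]

/-- Nested scrambling can be undone digit by digit: equal earlier digits select the same permutation
for the next one. -/
theorem eq_of_scrambleDigits_eq {π : List Bool → Bool} {b b' : ℕ → Bool} {q : ℕ}
    (h : ∀ r < q, scrambleDigits π b r = scrambleDigits π b' r) : ∀ r < q, b r = b' r := by
  intro r
  induction r using Nat.strong_induction_on with
  | _ r ih =>
    intro hr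
    have hl : (List.range r).map b = (List.range r).map b' :=
      List.map_congr_left fun i hi => by
        have := List.mem_range.1 hi
        exact ih i this (this.trans hr)
    have := h r hr
    rw [scrambleDigits, scrambleDigits, hl] at this
    simpa using this

/-- The action of a scramble on the first `q` digits. -/
def scrambleHead {Ω' : Type*} {D : ℕ} (ξ : Fin D → List Bool → Ω' → Bool) (q : ℕ) (ω : Ω')
    (p : Fin D → Fin q → Bool) : Fin D → Fin q → Bool :=
  headDigits q (scrambled ξ (joinDigits q (p, fun _ _ => false)) ω)

theorem headDigits_scrambled {Ω' : Type*} {D : ℕ} (ξ : Fin D → List Bool → Ω' → Bool) (q : ℕ)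
    (ω : Ω') (b : Fin D → ℕ → Bool) :
    headDigits q (scrambled ξ b ω) = scrambleHead ξ q ω (headDigits q b) := by
  funext j r
  change scrambleDigits (fun w => ξ j w ω) (b j) r =
    scrambleDigits (fun w => ξ j w ω) (joinDigits q (headDigits q b, fun _ _ => false) j) r
  refine scrambleDigits_congr (q := q) (fun i hi => ?_) r.2
  simp [joinDigits, headDigits, hi]

theorem scrambleHead_bijective {Ω' : Type*} {D : ℕ} (ξ : Fin D → List Bool → Ω' → Bool) (q : ℕ)
    (ω : Ω') : Function.Bijective (scrambleHead ξ q ω) := by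
  rw [← Finite.injective_iff_bijective]
  intro p p' h
  funext j r
  have := eq_of_scrambleDigits_eq (q := q) (π := fun w => ξ j w ω)
    (b := joinDigits q (p, fun _ _ => false) j) (b' := joinDigits q (p', fun _ _ => false) j)
    (fun i hi => congrFun (congrFun h j) ⟨i, hi⟩) r r.2
  simpa [joinDigits] using this

/-- Every head occurs equally often in a block. The identity is multiplied out so that no quotient
of powers of two has to be handled. -/
theorem SobolGenerator.sum_block_headDigits {D : ℕ} (g : SobolGenerator D) (q a : ℕ)
    (f : (Fin D → Fin q → Bool) → ℝ) :
    (2 : ℝ) ^ (D * q) * ∑ n ∈ Finset.range (2 ^ (g.totalDegree * q)),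
      f (headDigits q (g.digit (2 ^ (g.totalDegree * q) * a + n))) =
      2 ^ (g.totalDegree * q) * ∑ p, f p := by
  have hcard : ∀ p : Fin D → Fin q → Bool, (2 : ℝ) ^ (D * q) *
      ((Finset.range (2 ^ (g.totalDegree * q))).filter fun n =>
        headDigits q (g.digit (2 ^ (g.totalDegree * q) * a + n)) = p).card =
      2 ^ (g.totalDegree * q) := by
    intro p
    have h := g.card_filter_digit (Function.Embedding.refl _) q a p
    rw [Fintype.card_fin] at h
    have h2 : 2 ^ (D * q) * ((Finset.range (2 ^ (g.totalDegree * q))).filter fun n =>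
        headDigits q (g.digit (2 ^ (g.totalDegree * q) * a + n)) = p).card =
        2 ^ (g.totalDegree * q) := by
      refine Eq.trans ?_ h
      congr 2
      ext n
      simp [funext_iff, headDigits]
    exact_mod_cast h2
  rw [← Finset.sum_fiberwise (Finset.range (2 ^ (g.totalDegree * q)))
    (fun n => headDigits q (g.digit (2 ^ (g.totalDegree * q) * a + n))), Finset.mul_sum,
    Finset.mul_sum]
  refine Finset.sum_congr rfl fun p _ => ?_
  rw [Finset.sum_congr rfl (g := fun _ => f p) fun n hn => by rw [(Finset.mem_filter.1 hn).2],
    Finset.sum_const, nsmul_eq_mul, ← mul_assoc, hcard]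

/-- The first `N` indices are covered by `N / 2 ^ m + 1` full blocks, and in each block exactly a
fraction `2 ^ (-q)` of the points has the given prefix. -/
theorem SobolGenerator.card_filter_coord_le {D : ℕ} (g : SobolGenerator D) (q N : ℕ) (j : Fin D)
    (b : ℕ → Bool) :
    (2 : ℝ) ^ q * ((Finset.range N).filter fun n => ∀ r < q, g.digit n j r = b r).card
      ≤ N + 2 ^ (g.totalDegree * q) := by
  set m := g.totalDegree * q with hm
  have hblock : ∀ a, (2 : ℝ) ^ q * ((Finset.range (2 ^ m)).filter fun n =>
      ∀ r < q, g.digit (2 ^ m * a + n) j r = b r).card = 2 ^ m := by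
    intro a
    -- Equidistribution is used for a single coordinate here.
    have h := g.card_filter_digit (J := Unit) ⟨fun _ => j, fun _ _ _ => rfl⟩ q a fun _ r => b r
    rw [Fintype.card_unit, one_mul, ← hm] at h
    have h2 : ((Finset.range (2 ^ m)).filter fun n =>
        ∀ r < q, g.digit (2 ^ m * a + n) j r = b r) =
        (Finset.range (2 ^ m)).filter fun n => ∀ (_ : Unit) (r : Fin q),
        g.digit (2 ^ m * a + n) j r = b r := by
      refine Finset.filter_congr fun n _ => ?_
      constructor
      · intro h _ r; exact h r r.2
      · intro h r hr; exact h () ⟨r, hr⟩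
    rw [h2]
    exact_mod_cast h
  have hsum : ∀ A : ℕ, (2 : ℝ) ^ q * ((Finset.range (2 ^ m * A)).filter fun n =>
      ∀ r < q, g.digit n j r = b r).card = 2 ^ m * A := by
    intro A
    induction A with
    | zero => simp
    | succ A ih =>
      rw [Finset.card_filter] at ih ⊢
      rw [mul_add_one, Finset.sum_range_add, Nat.cast_add, mul_add, ih, ← Finset.card_filter,
        hblock]
      push_cast; ring
  have hle : N ≤ 2 ^ m * (N / 2 ^ m + 1) := by
    have := Nat.lt_mul_div_succ N (b := 2 ^ m) (by positivity)
    exact this.le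
  calc _ ≤ (2 : ℝ) ^ q * ((Finset.range (2 ^ m * (N / 2 ^ m + 1))).filter fun n =>
      ∀ r < q, g.digit n j r = b r).card := by
        gcongr
    _ = 2 ^ m * ((N / 2 ^ m : ℕ) : ℝ) + 2 ^ m := by rw [hsum]; push_cast; ring
    _ ≤ N + 2 ^ m := by
        gcongr
        exact_mod_cast Nat.mul_div_le N (2 ^ m)

section Moments

variable {Ω' : Type*} [MeasurableSpace Ω'] {Q : Measure Ω'} [IsProbabilityMeasure Q] {D : ℕ}
  {ξ : Fin D → List Bool → Ω' → Bool} {F : (Fin D → ℕ → Bool) → ℝ}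

/-- Block sums of the head means are not random. -/
theorem IsFairScramble.sum_block_headMean (h : IsFairScramble Q ξ)
    (hF : MemLp F 2 (digitMeasure D)) (g : SobolGenerator D) (q a : ℕ) (ω : Ω') :
    ∑ n ∈ Finset.range (2 ^ (g.totalDegree * q)),
      headMean F q (headDigits q (scrambled ξ (g.digit (2 ^ (g.totalDegree * q) * a + n)) ω)) =
      2 ^ (g.totalDegree * q) * ∫ y, F y ∂digitMeasure D := by
  -- Every head occurs equally often before scrambling, and the scramble permutes the heads, so the
  -- block sum runs over all heads whatever `ω` is.
  have hdet : ∀ ω, (2 : ℝ) ^ (D * q) * ∑ n ∈ Finset.range (2 ^ (g.totalDegree * q)),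
      headMean F q (headDigits q (scrambled ξ (g.digit (2 ^ (g.totalDegree * q) * a + n)) ω)) =
      2 ^ (g.totalDegree * q) * ∑ p, headMean F q p := by
    intro ω
    simp_rw [headDigits_scrambled]
    rw [g.sum_block_headDigits q a fun p => headMean F q (scrambleHead ξ q ω p),
      (scrambleHead_bijective ξ q ω).sum_comp fun p => headMean F q p]
  have hconst : ∀ ω', ∑ n ∈ Finset.range (2 ^ (g.totalDegree * q)),
      headMean F q (headDigits q (scrambled ξ (g.digit (2 ^ (g.totalDegree * q) * a + n)) ω')) =
      ∑ n ∈ Finset.range (2 ^ (g.totalDegree * q)),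
      headMean F q (headDigits q (scrambled ξ (g.digit (2 ^ (g.totalDegree * q) * a + n)) ω)) :=
    fun ω' => mul_left_cancel₀ (by positivity) ((hdet ω').trans (hdet ω).symm)
  -- A deterministic sum equals its expectation, and the expectation of each term is known.
  have hint : ∫ ω', ∑ n ∈ Finset.range (2 ^ (g.totalDegree * q)),
      headMean F q (headDigits q (scrambled ξ (g.digit (2 ^ (g.totalDegree * q) * a + n)) ω')) ∂Q
      = 2 ^ (g.totalDegree * q) * ∫ y, F y ∂digitMeasure D := by
    rw [integral_finsetSum _ fun n _ => (h.memLp_headMean _ q).integrable one_le_two]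
    simp_rw [h.integral_headMean hF]
    simp
  rw [← hint]
  simp_rw [hconst]
  simp

/-- Complete blocks contribute exactly zero, so only the incomplete last block remains. It has fewer
than `2 ^ m` terms, and Cauchy–Schwarz bounds its square. -/
theorem IsFairScramble.integral_sum_headMean_sq_le (h : IsFairScramble Q ξ)
    (hF : MemLp F 2 (digitMeasure D)) (g : SobolGenerator D) (q N : ℕ) :
    ∫ ω, (∑ n ∈ Finset.range N, (headMean F q (headDigits q (scrambled ξ (g.digit n) ω)) -
      ∫ y, F y ∂digitMeasure D)) ^ 2 ∂Q ≤
      (4 * ∫ y, F y ^ 2 ∂digitMeasure D) * 4 ^ (g.totalDegree * q) := by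
  set m := g.totalDegree * q with hm
  set B := ∫ y, F y ^ 2 ∂digitMeasure D
  have hB : 0 ≤ B := integral_nonneg fun y => sq_nonneg _
  set Z : ℕ → Ω' → ℝ := fun n ω => headMean F q (headDigits q (scrambled ξ (g.digit n) ω)) -
      ∫ y, F y ∂digitMeasure D with hZ
  have hZ2 : ∀ n, MemLp (Z n) 2 Q := fun n => (h.memLp_headMean _ q).sub (memLp_const _)
  have hblocks : ∀ A ω, ∑ n ∈ Finset.range (2 ^ m * A), Z n ω = 0 := by
    intro A ω
    induction A with
    | zero => simp
    | succ A ih =>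
      rw [mul_add_one, Finset.sum_range_add, ih, zero_add, hZ, Finset.sum_sub_distrib,
        h.sum_block_headMean hF g q A ω]
      simp [hm]
  have hrest : ∀ ω, ∑ n ∈ Finset.range N, Z n ω =
      ∑ i ∈ Finset.range (N % 2 ^ m), Z (2 ^ m * (N / 2 ^ m) + i) ω := by
    intro ω
    conv_lhs => rw [← Nat.div_add_mod N (2 ^ m)]
    rw [Finset.sum_range_add, hblocks, zero_add]
  have hlt : ((N % 2 ^ m : ℕ) : ℝ) ≤ 2 ^ m := by
    exact_mod_cast (Nat.mod_lt N (by positivity)).le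
  change ∫ ω, (∑ n ∈ Finset.range N, Z n ω) ^ 2 ∂Q ≤ _
  simp_rw [hrest]
  calc _ ≤ ∫ ω, ((N % 2 ^ m : ℕ) : ℝ) *
        ∑ i ∈ Finset.range (N % 2 ^ m), Z (2 ^ m * (N / 2 ^ m) + i) ω ^ 2 ∂Q := by
        refine integral_mono (memLp_finsetSum _ fun i _ => hZ2 _).integrable_sq
          ((integrable_finsetSum _ fun i _ => (hZ2 _).integrable_sq).const_mul _) fun ω => ?_
        have := sq_sum_le_card_mul_sum_sq (s := Finset.range (N % 2 ^ m))
          (f := fun i => Z (2 ^ m * (N / 2 ^ m) + i) ω)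
        simpa using this
    _ ≤ (N % 2 ^ m : ℕ) * ∑ i ∈ Finset.range (N % 2 ^ m), 4 * B := by
        rw [integral_const_mul, integral_finsetSum _ fun i _ => (hZ2 _).integrable_sq]
        gcongr with i
        exact h.integral_headMean_sub_sq_le hF _ q
    _ = ((N % 2 ^ m : ℕ) : ℝ) * (N % 2 ^ m : ℕ) * (4 * B) := by simp; ring
    _ ≤ 2 ^ m * 2 ^ m * (4 * B) := by gcongr
    _ = _ := by rw [← mul_pow]; norm_num; ring

/-- Expand the square. Only pairs with a common `q`-digit prefix in some coordinate contribute, and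
for each point their number is controlled by a union bound over the `D` coordinates. -/
theorem IsFairScramble.integral_sum_headResidual_sq_le (h : IsFairScramble Q ξ)
    (hFm : Measurable F) (hF : MemLp F 2 (digitMeasure D)) (g : SobolGenerator D) (q N : ℕ) :
    ∫ ω, (∑ n ∈ Finset.range N, headResidual F q (scrambled ξ (g.digit n) ω)) ^ 2 ∂Q ≤
      (4 * ∫ y, F y ^ 2 ∂digitMeasure D) * (N * D * (N + 2 ^ (g.totalDegree * q)) / 2 ^ q) := by
  classical
  set B := ∫ y, F y ^ 2 ∂digitMeasure D
  have hB : 0 ≤ B := integral_nonneg fun y => sq_nonneg _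
  set R : ℕ → Ω' → ℝ := fun n ω => headResidual F q (scrambled ξ (g.digit n) ω) with hR
  have hR2 : ∀ n, MemLp (R n) 2 Q := fun n => h.memLp_headResidual hF _ q
  have hRR : ∀ n n', Integrable (fun ω => R n ω * R n' ω) Q := fun n n' =>
    (hR2 n).integrable_mul (hR2 n')
  have hpair : ∀ n n', ∫ ω, R n ω * R n' ω ∂Q ≤
      if ∃ j, ∀ r < q, g.digit n' j r = g.digit n j r then 4 * B else 0 := by
    intro n n'
    split_ifs with hbad
    · exact h.integral_headResidual_mul_le hF _ _ q
    · push Not at hbad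
      refine (h.integral_headResidual_mul_eq_zero hFm hF fun j => ?_).le
      obtain ⟨r, hr, hne⟩ := hbad j
      exact ⟨r, hr, hne.symm⟩
  have hcount : ∀ n, (((Finset.range N).filter fun n' =>
      ∃ j, ∀ r < q, g.digit n' j r = g.digit n j r).card : ℝ) ≤
      D * (N + 2 ^ (g.totalDegree * q)) / 2 ^ q := by
    intro n
    have hsub : ((Finset.range N).filter fun n' => ∃ j, ∀ r < q, g.digit n' j r = g.digit n j r) ⊆
        Finset.univ.biUnion fun j => (Finset.range N).filter fun n' =>
          ∀ r < q, g.digit n' j r = g.digit n j r := by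
      intro n' hn'
      obtain ⟨h1, j, hj⟩ := Finset.mem_filter.1 hn'
      exact Finset.mem_biUnion.2 ⟨j, Finset.mem_univ _, Finset.mem_filter.2 ⟨h1, hj⟩⟩
    have h1 := (Finset.card_le_card hsub).trans Finset.card_biUnion_le
    have h2 : (((Finset.range N).filter fun n' =>
      ∃ j, ∀ r < q, g.digit n' j r = g.digit n j r).card : ℝ) ≤ ∑ j : Fin D,
        (((Finset.range N).filter fun n' => ∀ r < q, g.digit n' j r = g.digit n j r).card : ℝ) := by
      exact_mod_cast h1
    refine h2.trans ?_
    have h3 : ∀ j : Fin D, (((Finset.range N).filter fun n' =>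
        ∀ r < q, g.digit n' j r = g.digit n j r).card : ℝ) ≤
        (N + 2 ^ (g.totalDegree * q)) / 2 ^ q := fun j => by
      rw [le_div_iff₀' (by positivity)]
      exact g.card_filter_coord_le q N j _
    refine (Finset.sum_le_sum fun j _ => h3 j).trans_eq ?_
    simp
    ring
  have hexp : ∀ ω, (∑ n ∈ Finset.range N, R n ω) ^ 2 =
      ∑ n ∈ Finset.range N, ∑ n' ∈ Finset.range N, R n ω * R n' ω := fun ω => by
    rw [sq, Finset.sum_mul_sum]
  change ∫ ω, (∑ n ∈ Finset.range N, R n ω) ^ 2 ∂Q ≤ _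
  simp_rw [hexp]
  rw [integral_finsetSum _ fun n _ => integrable_finsetSum _ fun n' _ => hRR n n']
  calc _ ≤ ∑ n ∈ Finset.range N, (4 * B) * (D * (N + 2 ^ (g.totalDegree * q)) / 2 ^ q) := by
        refine Finset.sum_le_sum fun n _ => ?_
        rw [integral_finsetSum _ fun n' _ => hRR n n']
        refine (Finset.sum_le_sum fun n' _ => hpair n n').trans ?_
        rw [← Finset.sum_filter, Finset.sum_const, nsmul_eq_mul, mul_comm]
        gcongr
        exact hcount n
    _ = _ := by simp; ring

/-- The prefix length `q` is a free parameter: a large `q` makes `N ^ 2 / 2 ^ q` small, at the price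
of longer blocks. -/
theorem IsFairScramble.integral_sum_sq_le (h : IsFairScramble Q ξ)
    (hFm : Measurable F) (hF : MemLp F 2 (digitMeasure D)) (g : SobolGenerator D) (q N : ℕ) :
    ∫ ω, (∑ n ∈ Finset.range N, (F (scrambled ξ (g.digit n) ω) -
      ∫ y, F y ∂digitMeasure D)) ^ 2 ∂Q ≤
      (8 * ∫ y, F y ^ 2 ∂digitMeasure D) *
        (N * D * (N + 2 ^ (g.totalDegree * q)) / 2 ^ q + 4 ^ (g.totalDegree * q)) := by
  set B := ∫ y, F y ^ 2 ∂digitMeasure D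
  set U : Ω' → ℝ := fun ω => ∑ n ∈ Finset.range N, headResidual F q (scrambled ξ (g.digit n) ω)
  set V : Ω' → ℝ := fun ω => ∑ n ∈ Finset.range N,
    (headMean F q (headDigits q (scrambled ξ (g.digit n) ω)) - ∫ y, F y ∂digitMeasure D)
  have hU : MemLp U 2 Q := memLp_finsetSum _ fun n _ => h.memLp_headResidual hF _ q
  have hV : MemLp V 2 Q := memLp_finsetSum _ fun n _ =>
    (h.memLp_headMean _ q).sub (memLp_const _)
  have hsplit : ∀ ω, ∑ n ∈ Finset.range N, (F (scrambled ξ (g.digit n) ω) -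
      ∫ y, F y ∂digitMeasure D) = U ω + V ω := fun ω => by
    rw [← Finset.sum_add_distrib]
    exact Finset.sum_congr rfl fun n _ => by rw [headResidual]; ring
  simp_rw [hsplit]
  calc _ ≤ ∫ ω, (2 * U ω ^ 2 + 2 * V ω ^ 2) ∂Q := by
        refine integral_mono (hU.add hV).integrable_sq
          ((hU.integrable_sq.const_mul 2).add (hV.integrable_sq.const_mul 2)) fun ω => ?_
        simp only
        linarith [sq_nonneg (U ω - V ω), add_sq (U ω) (V ω), sub_sq (U ω) (V ω)]
    _ = 2 * ∫ ω, U ω ^ 2 ∂Q + 2 * ∫ ω, V ω ^ 2 ∂Q := by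
        rw [integral_add (hU.integrable_sq.const_mul 2) (hV.integrable_sq.const_mul 2),
          integral_const_mul, integral_const_mul]
    _ ≤ 2 * ((4 * B) * (N * D * (N + 2 ^ (g.totalDegree * q)) / 2 ^ q)) +
        2 * ((4 * B) * 4 ^ (g.totalDegree * q)) := by
        gcongr
        · exact h.integral_sum_headResidual_sq_le hFm hF g q N
        · exact h.integral_sum_headMean_sq_le hF g q N
    _ = _ := by ring

end Moments

/-! ### The strong law of large numbers for scrambled Sobol points -/

/-- The sum of the series has finite expectation, so the series converges almost surely and its
terms vanish. -/
theorem ae_tendsto_zero_of_summable_integral {Ω : Type*} [MeasurableSpace Ω] {μ : Measure Ω}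
    {X : ℕ → Ω → ℝ} (hX : ∀ k, Integrable (X k) μ) (h0 : ∀ k ω, 0 ≤ X k ω) {u : ℕ → ℝ}
    (hu : Summable u) (hle : ∀ k, ∫ ω, X k ω ∂μ ≤ u k) :
    ∀ᵐ ω ∂μ, Tendsto (fun k => X k ω) atTop (𝓝 0) := by
  have hne : ∫⁻ ω, ∑' k, ENNReal.ofReal (X k ω) ∂μ ≠ ⊤ := by
    rw [lintegral_tsum fun k => (hX k).1.aemeasurable.ennreal_ofReal]
    refine ne_top_of_le_ne_top (hu.tsum_ofReal_ne_top) (ENNReal.tsum_le_tsum fun k => ?_)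
    rw [← ofReal_integral_eq_lintegral_ofReal (hX k) (Eventually.of_forall (h0 k))]
    exact ENNReal.ofReal_le_ofReal (hle k)
  filter_upwards [ae_lt_top' (AEMeasurable.tsum fun k =>
    (hX k).1.aemeasurable.ennreal_ofReal) hne] with ω hω
  have h1 := ENNReal.tendsto_atTop_zero_of_tsum_ne_top hω.ne
  have h2 := (ENNReal.tendsto_toReal ENNReal.zero_ne_top).comp h1
  refine h2.congr fun k => ?_
  simp [ENNReal.toReal_ofReal (h0 k ω)]

theorem tendsto_succ_pow_atTop (p : ℕ) :
    Tendsto (fun k : ℕ => (k + 1) ^ (p + 1)) atTop atTop := by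
  refine tendsto_atTop_mono (fun k => ?_) tendsto_id
  calc k ≤ k + 1 := Nat.le_succ k
    _ ≤ (k + 1) ^ (p + 1) := Nat.le_self_pow (Nat.succ_ne_zero p) _

/-- Polynomial subsequences have consecutive ratios tending to one, as needed to interpolate between
them. -/
theorem eventually_succ_pow_le (p : ℕ) {a : ℝ} (ha : 1 < a) :
    ∀ᶠ k : ℕ in atTop, (((k + 1 + 1) ^ p : ℕ) : ℝ) ≤ a * ((k + 1) ^ p : ℕ) := by
  have h1 : Tendsto (fun k : ℕ => (1 + 1 / ((k : ℝ) + 1)) ^ p) atTop (𝓝 1) := by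
    have := (tendsto_one_div_add_atTop_nhds_zero_nat (𝕜 := ℝ)).const_add 1
    simpa using this.pow p
  filter_upwards [h1.eventually_le_const ha] with k hk
  have hk1 : (0 : ℝ) < (k : ℝ) + 1 := by positivity
  push_cast
  calc ((k : ℝ) + 1 + 1) ^ p = (1 + 1 / ((k : ℝ) + 1)) ^ p * ((k : ℝ) + 1) ^ p := by
        rw [← mul_pow]; congr 1; field_simp
    _ ≤ a * ((k : ℝ) + 1) ^ p := by gcongr

section

variable {Ω' : Type*} [MeasurableSpace Ω'] {Q : Measure Ω'} [IsProbabilityMeasure Q] {D : ℕ}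
  {ξ : Fin D → List Bool → Ω' → Bool} {F : (Fin D → ℕ → Bool) → ℝ}

theorem IsFairScramble.integral_average_sq_le (h : IsFairScramble Q ξ)
    (hFm : Measurable F) (hF : MemLp F 2 (digitMeasure D)) (g : SobolGenerator D) {k : ℕ}
    (hk : 0 < k) :
    ∫ ω, ((∑ n ∈ Finset.range (k ^ (2 * g.totalDegree + 1)), F (scrambled ξ (g.digit n) ω)) /
      (k ^ (2 * g.totalDegree + 1) : ℕ) - ∫ y, F y ∂digitMeasure D) ^ 2 ∂Q ≤
      (8 * ∫ y, F y ^ 2 ∂digitMeasure D) * (8 * D + 1) * (1 / (k : ℝ) ^ 2) := by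
  set B := ∫ y, F y ^ 2 ∂digitMeasure D
  have hB : 0 ≤ B := integral_nonneg fun y => sq_nonneg _
  set μ := ∫ y, F y ∂digitMeasure D
  set t := g.totalDegree with ht
  set N := k ^ (2 * t + 1) with hN
  -- With `q = 2 * l` one has `k ^ 2 / 4 ≤ 2 ^ q ≤ k ^ 2`, hence `2 ^ (t * q) ≤ k ^ (2 * t) = N /
  -- k`. Both error terms, divided by `N ^ 2`, are then of order `1 / k ^ 2`.
  set l := Nat.log 2 k
  set q := 2 * l with hq
  have hk0 : (0 : ℝ) < k := Nat.cast_pos.2 hk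
  have hN0 : (0 : ℝ) < N := by rw [hN]; push_cast; positivity
  have hl1 : (2 : ℝ) ^ l ≤ k := by exact_mod_cast Nat.pow_log_le_self 2 hk.ne'
  have hl2 : (k : ℝ) ≤ 2 * 2 ^ l := by
    have := (Nat.lt_pow_succ_log_self one_lt_two k).le
    rw [Nat.pow_succ, mul_comm] at this
    exact_mod_cast this
  have hq1 : (2 : ℝ) ^ q ≤ k ^ 2 := by
    rw [hq, mul_comm, pow_mul]; gcongr
  have hq2 : (k : ℝ) ^ 2 ≤ 4 * 2 ^ q := by
    calc (k : ℝ) ^ 2 ≤ (2 * 2 ^ l) ^ 2 := by gcongr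
      _ = 4 * 2 ^ q := by rw [mul_pow, hq, mul_comm 2 l, pow_mul]; norm_num
  have hm : (2 : ℝ) ^ (t * q) ≤ k ^ (2 * t) := by
    rw [mul_comm t q, pow_mul, pow_mul (k : ℝ) 2 t]; gcongr
  have hNk : (N : ℝ) = k ^ (2 * t) * k := by rw [hN]; push_cast; rw [pow_succ]
  have hk1 : (1 : ℝ) ≤ k := by exact_mod_cast hk
  have hmN : (2 : ℝ) ^ (t * q) ≤ N := by
    rw [hNk]; exact hm.trans (le_mul_of_one_le_right (by positivity) hk1)
  have h4 : (4 : ℝ) ^ (t * q) ≤ N ^ 2 / k ^ 2 := by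
    have : (4 : ℝ) ^ (t * q) = (2 ^ (t * q)) ^ 2 := by
      rw [show (4 : ℝ) = 2 ^ 2 by norm_num, ← pow_mul, ← pow_mul, mul_comm]
    rw [this, hNk, mul_pow, mul_div_cancel_right₀ _ (by positivity)]
    gcongr
  have h5 : (N : ℝ) * D * (N + 2 ^ (t * q)) / 2 ^ q ≤ 8 * D * (N ^ 2 / k ^ 2) := by
    have h2q : (0 : ℝ) < 2 ^ q := by positivity
    calc (N : ℝ) * D * (N + 2 ^ (t * q)) / 2 ^ q ≤ N * D * (N + N) / (k ^ 2 / 4) := by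
          gcongr
          linarith
      _ = _ := by field_simp; ring
  have hmain := h.integral_sum_sq_le hFm hF g q N
  have heq : ∀ ω, ((∑ n ∈ Finset.range N, F (scrambled ξ (g.digit n) ω)) / (N : ℝ) - μ) ^ 2 =
      (1 / (N : ℝ) ^ 2) * (∑ n ∈ Finset.range N, (F (scrambled ξ (g.digit n) ω) - μ)) ^ 2 := by
    intro ω
    rw [Finset.sum_sub_distrib, Finset.sum_const, Finset.card_range, nsmul_eq_mul]
    field_simp
  simp_rw [heq]
  rw [integral_const_mul]
  calc _ ≤ (1 / (N : ℝ) ^ 2) * ((8 * B) * (8 * D * (N ^ 2 / k ^ 2) + N ^ 2 / k ^ 2)) := by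
        refine mul_le_mul_of_nonneg_left (hmain.trans ?_) (by positivity)
        gcongr
    _ = _ := by field_simp

theorem IsFairScramble.tendsto_average_of_nonneg (h : IsFairScramble Q ξ)
    (hFm : Measurable F) (hF : MemLp F 2 (digitMeasure D)) (hF0 : ∀ y, 0 ≤ F y)
    (g : SobolGenerator D) :
    ∀ᵐ ω ∂Q, Tendsto (fun N : ℕ => (∑ n ∈ Finset.range N, F (scrambled ξ (g.digit n) ω)) / N)
      atTop (𝓝 (∫ y, F y ∂digitMeasure D)) := by
  set μ := ∫ y, F y ∂digitMeasure D
  set c : ℕ → ℕ := fun k => (k + 1) ^ (2 * g.totalDegree + 1)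
  set X : ℕ → Ω' → ℝ := fun k ω =>
    ((∑ n ∈ Finset.range (c k), F (scrambled ξ (g.digit n) ω)) / (c k : ℕ) - μ) ^ 2
  have hL2 : ∀ N : ℕ, MemLp (fun ω => (∑ n ∈ Finset.range N, F (scrambled ξ (g.digit n) ω)) / N
      - μ) 2 Q := fun N => by
    simp_rw [div_eq_inv_mul]
    exact ((memLp_finsetSum _ fun n _ => h.memLp_comp hF _).const_mul _).sub (memLp_const _)
  have hsum : Summable fun k : ℕ => (8 * ∫ y, F y ^ 2 ∂digitMeasure D) * (8 * D + 1) *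
      (1 / (((k + 1 : ℕ) : ℝ)) ^ 2) :=
    ((summable_nat_add_iff 1).2 (Real.summable_one_div_nat_pow.2 one_lt_two)).mul_left _
  have hX := ae_tendsto_zero_of_summable_integral (μ := Q) (X := X)
    (fun k => (hL2 (c k)).integrable_sq) (fun k ω => sq_nonneg _) hsum
    fun k => h.integral_average_sq_le hFm hF g (Nat.succ_pos k)
  filter_upwards [hX] with ω hω
  -- Nonnegativity makes the partial sums monotone, so convergence along subsequences with ratio
  -- close to one gives convergence along all `N`.
  refine tendsto_div_of_monotone_of_exists_subseq_tendsto_div _ _ ?_ fun a ha =>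
    ⟨c, eventually_succ_pow_le _ ha, tendsto_succ_pow_atTop _, ?_⟩
  · refine monotone_nat_of_le_succ fun N => ?_
    rw [Finset.sum_range_succ]
    exact le_add_of_nonneg_right (hF0 _)
  · have h1 : Tendsto (fun k => |(∑ n ∈ Finset.range (c k), F (scrambled ξ (g.digit n) ω)) /
        (c k : ℕ) - μ|) atTop (𝓝 0) := by
      have := (Real.continuous_sqrt.tendsto 0).comp hω
      simpa [X, Function.comp_def, Real.sqrt_sq_eq_abs] using this
    exact tendsto_iff_norm_sub_tendsto_zero.2 (by simpa using h1)

theorem IsFairScramble.tendsto_average (h : IsFairScramble Q ξ)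
    (hFm : Measurable F) (hF : MemLp F 2 (digitMeasure D)) (g : SobolGenerator D) :
    ∀ᵐ ω ∂Q, Tendsto (fun N : ℕ => (∑ n ∈ Finset.range N, F (scrambled ξ (g.digit n) ω)) / N)
      atTop (𝓝 (∫ y, F y ∂digitMeasure D)) := by
  have hp : MemLp (fun y => max (F y) 0) 2 (digitMeasure D) := hF.pos_part
  have hn : MemLp (fun y => max (-F y) 0) 2 (digitMeasure D) := hF.neg_part
  filter_upwards [h.tendsto_average_of_nonneg (hFm.max measurable_const) hp
      (fun y => le_max_right _ _) g,
    h.tendsto_average_of_nonneg (hFm.neg.max measurable_const) hn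
      (fun y => le_max_right _ _) g] with ω h1 h2
  have hF12 : ∀ x : ℝ, x = max x 0 - max (-x) 0 := fun x => by
    rw [max_zero_sub_max_neg_zero_eq_self]
  have hint : ∫ y, F y ∂digitMeasure D =
      ∫ y, max (F y) 0 ∂digitMeasure D - ∫ y, max (-F y) 0 ∂digitMeasure D := by
    rw [← integral_sub (hp.integrable one_le_two) (hn.integrable one_le_two)]
    exact integral_congr_ae (Eventually.of_forall fun y => hF12 (F y))
  rw [hint]
  refine (h1.sub h2).congr fun N => ?_
  rw [← sub_div, ← Finset.sum_sub_distrib]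
  congr 1
  exact Finset.sum_congr rfl fun n _ => (hF12 _).symm

end

/-- Averages of a square-integrable function over the scrambled Sobol points converge almost
surely to its integral over the cube. -/
theorem IsNestedUniformScramble.tendsto_average {Ω' : Type*} [MeasurableSpace Ω'] {Q : Measure Ω'}
    [IsProbabilityMeasure Q] {S D : ℕ} {ξ : Fin S → Fin D → List Bool → Ω' → Bool}
    (h : IsNestedUniformScramble Q ξ) (g : SobolGenerator D) {f : Euc D → ℝ} (hfm : Measurable f)
    (hf : MemLp f 2 (volume.restrict (cube D))) (s : Fin S) :
    ∀ᵐ ω ∂Q, Tendsto (fun N : ℕ => (N : ℝ)⁻¹ * ∑ n ∈ Finset.range N,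
      f (scrambledPoint g ξ ω s n)) atTop (𝓝 (∫ v in cube D, f v)) := by
  have hmp : MeasurePreserving (binaryVector (D := D)) (digitMeasure D)
      (volume.restrict (cube D)) := ⟨measurable_binaryVector, map_binaryVector_digitMeasure D⟩
  have := (h.isFairScramble s).tendsto_average (hfm.comp measurable_binaryVector)
    (hf.comp_measurePreserving hmp) g
  have hint : ∫ y, (f ∘ binaryVector) y ∂digitMeasure D = ∫ v in cube D, f v := by
    rw [← map_binaryVector_digitMeasure, integral_map measurable_binaryVector.aemeasurable
      hfm.aestronglyMeasurable]
    rfl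
  rw [hint] at this
  filter_upwards [this] with ω hω
  refine hω.congr fun N => ?_
  rw [div_eq_inv_mul]
  rfl

theorem IsNestedUniformScramble.measurable_scrambledPoint {Ω' : Type*} [MeasurableSpace Ω']
    {Q : Measure Ω'} {S D : ℕ} {ξ : Fin S → Fin D → List Bool → Ω' → Bool}
    (h : IsNestedUniformScramble Q ξ) (g : SobolGenerator D) (s : Fin S) (n : ℕ) :
    Measurable fun ω => scrambledPoint g ξ ω s n :=
  measurable_binaryVector.comp ((h.isFairScramble s).measurable_scrambled (g.digit n))

/-! ### Fourier inversion almost everywhere -/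

section Inversion

open scoped FourierTransform RealInnerProductSpace ContDiff

variable {V : Type*} [NormedAddCommGroup V] [InnerProductSpace ℝ V] [FiniteDimensional ℝ V]
  [MeasurableSpace V] [BorelSpace V]

theorem integral_fourier_mul_swap {f g : V → ℂ} (hf : Integrable f) (hg : Integrable g) :
    ∫ x, 𝓕 f x * g x = ∫ x, f x * 𝓕 g x := by
  have := VectorFourier.integral_fourierIntegral_smul_eq_flip (μ := volume) (ν := volume)
    (L := innerₗ V) (f := f) (g := g) Real.continuous_fourierChar
    (by exact continuous_inner) hf hg
  simp only [smul_eq_mul, flip_innerₗ] at this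
  exact this

theorem integral_fourierInv_mul_swap {f g : V → ℂ} (hf : Integrable f) (hg : Integrable g) :
    ∫ x, 𝓕⁻ f x * g x = ∫ x, f x * 𝓕⁻ g x := by
  have h1 : ∫ x, 𝓕⁻ f x * g x = ∫ x, 𝓕 f x * g (-x) := by
    rw [← integral_neg_eq_self]
    simp_rw [Real.fourierInv_eq_fourier_neg, neg_neg]
  rw [h1, integral_fourier_mul_swap hf hg.comp_neg]
  simp_rw [Real.fourierInv_eq_fourier_comp_neg]

/-- Inversion by duality: against a smooth compactly supported test function both transforms can be
moved onto the test function, where Schwartz inversion applies. No continuity of `f` is assumed, so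
the equality holds only almost everywhere. -/
theorem fourier_fourierInv_ae_eq {f : V → ℂ} (hf : Integrable f) (hf' : Integrable (𝓕⁻ f)) :
    𝓕 (𝓕⁻ f) =ᵐ[volume] f := by
  have hcont : Continuous (𝓕 (𝓕⁻ f)) :=
    VectorFourier.fourierIntegral_continuous Real.continuous_fourierChar
      (by exact continuous_inner) hf'
  refine ae_eq_of_integral_contDiff_smul_eq (hcont.locallyIntegrable) hf.locallyIntegrable ?_
  intro θ hθ hθc
  have hc : HasCompactSupport fun x => (θ x : ℂ) := hθc.comp_left Complex.ofReal_zero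
  have hd : ContDiff ℝ ∞ fun x => (θ x : ℂ) := Complex.ofRealCLM.contDiff.comp hθ
  set Θ : SchwartzMap V ℂ := hc.toSchwartzMap hd
  have hΘ : ∀ x, Θ x = θ x := fun x => rfl
  have h1 : ∫ x, 𝓕 (𝓕⁻ f) x * Θ x = ∫ x, f x * Θ x := by
    rw [integral_fourier_mul_swap hf' Θ.integrable]
    rw [← SchwartzMap.fourier_coe, integral_fourierInv_mul_swap hf (𝓕 Θ).integrable]
    rw [← SchwartzMap.fourierInv_coe, FourierTransform.fourierInv_fourier_eq]
  simp_rw [hΘ] at h1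
  simpa only [Complex.real_smul, mul_comm] using h1

end Inversion

/-! ### The damped transforms -/

section Transforms

variable {k : ℕ} {Ω : Type*} [MeasurableSpace Ω] {P : Measure Ω} {Y : Ω → Euc k}
  {φ : Euc k → ℝ} {K : Euc k}

open scoped FourierTransform RealInnerProductSpace

theorem real_inner_eq_sum {k : ℕ} (x y : Euc k) : ⟪x, y⟫ = ∑ r, x r * y r := by
  rw [PiLp.inner_apply]
  exact Finset.sum_congr rfl fun r _ => by simp [mul_comm]

/-- The damped function `x ↦ exp(⟨K, x⟩) φ(x)`. -/
noncomputable def dampedFun {k : ℕ} (φ : Euc k → ℝ) (K : Euc k) (x : Euc k) : ℂ :=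
  ((Real.exp (∑ r, K r * x r) * φ x : ℝ) : ℂ)

theorem IsAdmissibleShift.integrable_damped (h : IsAdmissibleShift P Y φ K) :
    Integrable (dampedFun φ K) :=
  h.damped.ofReal

/-- The shift by `iK` in the argument acts as the damping factor `exp ⟨K, x⟩`, since `-i · iK = K`.
-/
theorem extFourier_contour (φ : Euc k → ℝ) (K w : Euc k) :
    extFourier φ (contour K w) =
      ∫ x, Complex.exp (-(⟪w, x⟫ : ℝ) * Complex.I) * dampedFun φ K x := by
  refine integral_congr_ae (Eventually.of_forall fun x => ?_)
  simp only [dampedFun, contour]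
  rw [Complex.ofReal_mul, ← mul_assoc, Complex.ofReal_exp, ← Complex.exp_add, real_inner_eq_sum]
  congr 2
  push_cast
  rw [Finset.mul_sum, neg_mul, Finset.sum_mul, ← Finset.sum_neg_distrib, ← Finset.sum_neg_distrib,
    ← Finset.sum_add_distrib]
  refine Finset.sum_congr rfl fun r _ => ?_
  linear_combination (-(K r : ℂ) * x r) * Complex.I_mul_I

/-- Here the sign is opposite, since `i · iK = -K`. -/
theorem extCharFun_contour (P : Measure Ω) (Y : Ω → Euc k) (K w : Euc k) :
    extCharFun P Y (contour K w) = ∫ ω, Complex.exp ((⟪w, Y ω⟫ : ℝ) * Complex.I) *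
      (Real.exp (-∑ r, K r * Y ω r) : ℝ) ∂P := by
  refine integral_congr_ae (Eventually.of_forall fun ω => ?_)
  simp only [contour]
  rw [Complex.ofReal_exp, ← Complex.exp_add, real_inner_eq_sum]
  congr 1
  push_cast
  rw [Finset.mul_sum, Finset.sum_mul, ← Finset.sum_neg_distrib, ← Finset.sum_add_distrib]
  refine Finset.sum_congr rfl fun r _ => ?_
  linear_combination ((K r : ℂ) * Y ω r) * Complex.I_mul_I

theorem continuous_extFourier_contour (h : IsAdmissibleShift P Y φ K) :
    Continuous fun w => extFourier φ (contour K w) := by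
  simp_rw [extFourier_contour]
  refine continuous_of_dominated (bound := fun x => ‖dampedFun φ K x‖) (fun w => ?_)
    (fun w => Eventually.of_forall fun x => ?_) h.integrable_damped.norm
    (Eventually.of_forall fun x => by fun_prop)
  · exact (Continuous.aestronglyMeasurable (by fun_prop)).mul h.integrable_damped.1
  · rw [norm_mul]
    have := Complex.norm_exp_ofReal_mul_I (-⟪w, x⟫)
    push_cast at this
    rw [this, one_mul]

theorem continuous_extCharFun_contour (hY : Measurable Y) (h : IsAdmissibleShift P Y φ K) :
    Continuous fun w => extCharFun P Y (contour K w) := by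
  simp_rw [extCharFun_contour]
  refine continuous_of_dominated (bound := fun ω => Real.exp (-∑ r, K r * Y ω r)) (fun w => ?_)
    (fun w => Eventually.of_forall fun ω => ?_) h.moment
    (Eventually.of_forall fun ω => by fun_prop)
  · refine AEStronglyMeasurable.mul (Measurable.aestronglyMeasurable ?_)
      (Complex.continuous_ofReal.comp_aestronglyMeasurable h.moment.1)
    have : Measurable fun ω => (⟪w, Y ω⟫ : ℝ) := measurable_const.inner hY
    fun_prop
  · rw [norm_mul, Complex.norm_exp_ofReal_mul_I, one_mul, Complex.norm_real, Real.norm_eq_abs,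
      Real.abs_exp]

/-- The product `Φ_Y(w + iK) φ̂(w + iK)`. -/
noncomputable def transformProduct {k : ℕ} {Ω : Type*} [MeasurableSpace Ω] (P : Measure Ω)
    (Y : Ω → Euc k) (φ : Euc k → ℝ) (K w : Euc k) : ℂ :=
  extCharFun P Y (contour K w) * extFourier φ (contour K w)

theorem continuous_transformProduct (hY : Measurable Y) (h : IsAdmissibleShift P Y φ K) :
    Continuous (transformProduct P Y φ K) :=
  (continuous_extCharFun_contour hY h).mul (continuous_extFourier_contour h)

/-- The joint integrand of the damped expectation. -/
noncomputable def dampedPair {k : ℕ} {Ω : Type*} (Y : Ω → Euc k) (φ : Euc k → ℝ) (K : Euc k)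
    (x : Ω × Euc k) : ℂ :=
  (Real.exp (-∑ r, K r * Y x.1 r) : ℝ) * dampedFun φ K (Y x.1 - x.2)

/-- The two dampings combine into `exp (-⟨K, m⟩)`, which is free of `ω` and can be undone after
inversion. -/
theorem dampedPair_eq {Ω₀ : Type*} (Y : Ω₀ → Euc k) (φ : Euc k → ℝ) (K : Euc k) (ω : Ω₀)
    (m : Euc k) :
    dampedPair Y φ K (ω, m) = ((Real.exp (-∑ r, K r * m r) * φ (Y ω - m) : ℝ) : ℂ) := by
  rw [dampedPair, dampedFun, ← Complex.ofReal_mul, ← mul_assoc, ← Real.exp_add]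
  congr 3
  rw [← Finset.sum_neg_distrib, ← Finset.sum_neg_distrib, ← Finset.sum_add_distrib]
  exact Finset.sum_congr rfl fun r _ => by rw [PiLp.sub_apply]; ring

/-- By translation invariance the norm integrates over `m` to the exponential weight times the `L¹`
norm of the damped function; the exponential moment does the rest. -/
theorem integrable_dampedPair [SFinite P] (hY : Measurable Y) (h : IsAdmissibleShift P Y φ K) :
    Integrable (dampedPair Y φ K) (P.prod volume) := by
  -- The damped function is only almost everywhere measurable, so the composition needs a map that
  -- pulls null sets back to null sets.
  have hqmp : Measure.QuasiMeasurePreserving (fun x : Ω × Euc k => Y x.1 - x.2) (P.prod volume)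
      volume := by
    have h1 : MeasurePreserving (fun x : Ω × Euc k => (x.1, Y x.1 - x.2)) (P.prod volume)
        (P.prod volume) :=
      (MeasurePreserving.id P).skew_product (g := fun ω m => Y ω - m) (by fun_prop)
        (Eventually.of_forall fun ω => (volume.measurePreserving_sub_left (Y ω)).map_eq)
    exact Measure.quasiMeasurePreserving_snd.comp h1.quasiMeasurePreserving
  have hm : AEStronglyMeasurable (dampedPair Y φ K) (P.prod volume) := by
    refine AEStronglyMeasurable.mul ?_ (h.integrable_damped.1.comp_quasiMeasurePreserving hqmp)
    exact Complex.continuous_ofReal.comp_aestronglyMeasurable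
      (h.moment.1.comp_quasiMeasurePreserving Measure.quasiMeasurePreserving_fst)
  rw [integrable_prod_iff hm]
  refine ⟨Eventually.of_forall fun ω => (h.integrable_damped.comp_sub_left (Y ω)).const_mul
    ((Real.exp (-∑ r, K r * Y ω r) : ℝ) : ℂ), ?_⟩
  have : ∀ ω, ∫ m, ‖dampedPair Y φ K (ω, m)‖ =
      Real.exp (-∑ r, K r * Y ω r) * ∫ x, ‖dampedFun φ K x‖ := fun ω => by
    simp only [dampedPair, norm_mul, Complex.norm_real, Real.norm_eq_abs, Real.abs_exp]
    rw [integral_const_mul, integral_sub_left_eq_self (fun x => ‖dampedFun φ K x‖)]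
  simp_rw [this]
  exact h.moment.mul_const _

/-- The damped expectation is a convolution: after Fubini, the substitution `x = Y ω - m` factors
its transform. The factor `2 * Real.pi` comes from the normalization of `𝓕`. -/
theorem fourierInv_integral_dampedPair [SFinite P] (hY : Measurable Y)
    (h : IsAdmissibleShift P Y φ K) (u : Euc k) :
    𝓕⁻ (fun m => ∫ ω, dampedPair Y φ K (ω, m) ∂P) u =
      transformProduct P Y φ K ((2 * Real.pi) • u) := by
  have hint := integrable_dampedPair hY h
  rw [Real.fourierInv_eq']
  have h1 : ∀ m, Complex.exp (((2 * Real.pi * ⟪m, u⟫ : ℝ) : ℂ) * Complex.I) •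
      ∫ ω, dampedPair Y φ K (ω, m) ∂P = ∫ ω, Complex.exp (((2 * Real.pi * ⟪m, u⟫ : ℝ) : ℂ) *
        Complex.I) * dampedPair Y φ K (ω, m) ∂P := fun m => by
    rw [integral_const_mul, smul_eq_mul]
  simp_rw [h1]
  have hint2 : Integrable (fun x : Ω × Euc k => Complex.exp (((2 * Real.pi * ⟪x.2, u⟫ : ℝ) : ℂ) *
        Complex.I) * dampedPair Y φ K x) (P.prod volume) := by
    refine hint.bdd_mul (c := 1) (Continuous.aestronglyMeasurable (by fun_prop) |>.comp_snd
      (f := fun m : Euc k => Complex.exp (((2 * Real.pi * ⟪m, u⟫ : ℝ) : ℂ) * Complex.I)))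
      (Eventually.of_forall fun x => (Complex.norm_exp_ofReal_mul_I _).le)
  rw [← integral_integral_swap (f := fun ω m => Complex.exp (((2 * Real.pi * ⟪m, u⟫ : ℝ) : ℂ) *
        Complex.I) * dampedPair Y φ K (ω, m)) hint2]
  have h2 : ∀ ω, ∫ m, Complex.exp (((2 * Real.pi * ⟪m, u⟫ : ℝ) : ℂ) * Complex.I) *
      dampedPair Y φ K (ω, m) = (Complex.exp ((⟪(2 * Real.pi) • u, Y ω⟫ : ℝ) * Complex.I) *
      (Real.exp (-∑ r, K r * Y ω r) : ℝ)) * extFourier φ (contour K ((2 * Real.pi) • u)) := by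
    intro ω
    rw [extFourier_contour, ← integral_const_mul, ← integral_sub_left_eq_self _ volume (Y ω)]
    refine integral_congr_ae (Eventually.of_forall fun x => ?_)
    simp only [dampedPair, sub_sub_cancel]
    have hexp : Complex.exp (((2 * Real.pi * ⟪Y ω - x, u⟫ : ℝ) : ℂ) * Complex.I) =
        Complex.exp ((⟪(2 * Real.pi) • u, Y ω⟫ : ℝ) * Complex.I) *
          Complex.exp (-(⟪(2 * Real.pi) • u, x⟫ : ℝ) * Complex.I) := by
      rw [← Complex.exp_add]
      congr 1
      rw [inner_sub_left, real_inner_smul_left, real_inner_smul_left, real_inner_comm,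
        real_inner_comm x]
      push_cast
      ring
    rw [hexp]
    ring
  simp_rw [h2]
  rw [integral_mul_const, ← extCharFun_contour]
  rfl

/-- The Fourier representation of a translated expectation, for almost every translation. -/
theorem ae_integral_eq_fourierValue [SFinite P] (hY : Measurable Y)
    (h : IsAdmissibleShift P Y φ K) :
    ∀ᵐ m : Euc k, Integrable (fun ω => φ (Y ω - m)) P ∧
      ∫ ω, φ (Y ω - m) ∂P = fourierValue P Y φ K m := by
  have hint := integrable_dampedPair hY h
  set c : Euc k → ℂ := fun m => ∫ ω, dampedPair Y φ K (ω, m) ∂P with hc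
  have hcint : Integrable c := hint.integral_prod_right
  have hpi : (2 * Real.pi) ≠ 0 := by positivity
  have hinv : 𝓕⁻ c = fun u => transformProduct P Y φ K ((2 * Real.pi) • u) :=
    funext fun u => fourierInv_integral_dampedPair hY h u
  have hcinv : Integrable (𝓕⁻ c) := by
    rw [hinv]
    exact (show Integrable (transformProduct P Y φ K) volume from h.product).comp_smul hpi
  filter_upwards [fourier_fourierInv_ae_eq hcint hcinv, hint.prod_left_ae] with m hm hmi
  have hφ : ∀ ω, φ (Y ω - m) = Real.exp (∑ r, K r * m r) * (dampedPair Y φ K (ω, m)).re := by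
    intro ω
    rw [dampedPair_eq, Complex.ofReal_re, ← mul_assoc, ← Real.exp_add]
    simp
  refine ⟨?_, ?_⟩
  · simp_rw [hφ]
    exact hmi.re.const_mul _
  · simp_rw [hφ]
    rw [integral_const_mul]
    have hre : ∫ ω, (dampedPair Y φ K (ω, m)).re ∂P = (c m).re := integral_re hmi
    rw [hre, ← hm, hinv, Real.fourier_eq', fourierValue]
    -- The substitution `w = 2πv` produces the constant `(2π)⁻ᵏ` of the Fourier integrand.
    have hscale := Measure.integral_comp_smul volume (fun w : Euc k =>
      Complex.exp ((-⟪w, m⟫ : ℝ) * Complex.I) • transformProduct P Y φ K w) (2 * Real.pi)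
    have h3 : ∫ v : Euc k, Complex.exp (((-2 * Real.pi * ⟪v, m⟫ : ℝ) : ℂ) * Complex.I) •
        transformProduct P Y φ K ((2 * Real.pi) • v) = |((2 * Real.pi) ^ k)⁻¹| •
        ∫ w : Euc k, Complex.exp ((-⟪w, m⟫ : ℝ) * Complex.I) • transformProduct P Y φ K w := by
      rw [finrank_euclideanSpace_fin] at hscale
      rw [← hscale]
      refine integral_congr_ae (Eventually.of_forall fun v => ?_)
      simp only [real_inner_smul_left]
      congr 4
      ring
    rw [h3, abs_of_pos (by positivity), ← Complex.re_ofReal_mul, Complex.real_smul,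
      ← integral_const_mul, ← integral_const_mul]
    congr 1
    refine integral_congr_ae (Eventually.of_forall fun w => ?_)
    simp only [fourierIntegrand, transformProduct, smul_eq_mul]
    have hexp : Complex.exp (∑ r, ((K r : ℂ) - Complex.I * (w r : ℂ)) * (m r : ℂ)) =
        (Real.exp (∑ r, K r * m r) : ℝ) * Complex.exp ((-⟪w, m⟫ : ℝ) * Complex.I) := by
      rw [Complex.ofReal_exp, ← Complex.exp_add, real_inner_eq_sum]
      congr 1
      push_cast
      rw [neg_mul, Finset.sum_mul, ← Finset.sum_neg_distrib, ← Finset.sum_add_distrib]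
      exact Finset.sum_congr rfl fun r _ => by ring
    rw [hexp]
    ring

end Transforms

/-! ### Coordinate projections -/

/-- The coordinate projection as a continuous linear map. -/
noncomputable def projL {k d : ℕ} (p : Fin k ↪o Fin d) : Euc d →L[ℝ] Euc k :=
  LinearMap.toContinuousLinearMap
    { toFun := proj p
      map_add' := fun x y => by ext r; simp [proj]
      map_smul' := fun c x => by ext r; simp [proj] }

theorem projL_apply {k d : ℕ} (p : Fin k ↪o Fin d) (x : Euc d) : projL p x = proj p x := rfl

theorem proj_sub {k d : ℕ} (p : Fin k ↪o Fin d) (x y : Euc d) :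
    proj p (x - y) = proj p x - proj p y := (projL p).map_sub x y

theorem proj_single {k d : ℕ} (p : Fin k ↪o Fin d) (j : Fin d) :
    proj p (EuclideanSpace.single j 1) =
      ∑ r, if p r = j then EuclideanSpace.single r (1 : ℝ) else 0 := by
  ext s
  simp only [proj, WithLp.ofLp_sum, Finset.sum_apply]
  rw [Finset.sum_eq_single s]
  · by_cases h : p s = j <;> simp [h]
  · intro r _ hr
    split_ifs <;> simp [hr.symm]
  · simp

theorem projL_surjective {k d : ℕ} (p : Fin k ↪o Fin d) : Function.Surjective (projL p) := by
  intro y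
  refine ⟨∑ r, y r • EuclideanSpace.single (p r) (1 : ℝ), ?_⟩
  ext s
  simp only [projL_apply, proj, WithLp.ofLp_sum, Finset.sum_apply]
  rw [Finset.sum_eq_single s]
  · simp
  · intro r _ hr
    simp [hr.symm]
  · simp

/-- Preimages of null sets under a surjective linear map are null. The exceptional set need not be
measurable, so it is first enlarged to a measurable null set. -/
theorem ae_proj {k d : ℕ} (p : Fin k ↪o Fin d) {q : Euc k → Prop} (hq : ∀ᵐ y, q y) :
    ∀ᵐ x : Euc d, q (proj p x) := by
  have h : ∀ᵐ y : Euc k, y ∈ (toMeasurable volume {y | ¬ q y})ᶜ := by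
    rw [ae_iff]
    simpa [measure_toMeasurable] using ae_iff.1 hq
  have h2 := (ae_comp_linearMap_mem_iff (μ := (volume : Measure (Euc d))) (ν := volume)
    (projL p).toLinearMap (projL_surjective p) (measurableSet_toMeasurable _ _).compl).2 h
  filter_upwards [h2] with x hx
  by_contra hc
  exact hx (subset_toMeasurable _ _ hc)

/-! ### Bounds from the Orlicz heart -/

section Loss

variable {d : ℕ} {ell : Euc d → ℝ} {Ω : Type*} [MeasurableSpace Ω] {P : Measure Ω}
  {X : Ω → Euc d}

theorem IsLossFunction.continuous (h : IsLossFunction ell) : Continuous ell :=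
  h.convex.locallyLipschitz.continuous

/-- The linear lower bound at the componentwise absolute value gives `|X_j| ≤ ∑ |X_i| ≤ ell(|X|) +
c`. -/
theorem IsLossFunction.integrable_coord [IsProbabilityMeasure P] (h : IsLossFunction ell)
    (hX : Measurable X) (hheart : MemOrliczHeart P ell X) (j : Fin d) :
    Integrable (fun ω => X ω j) P := by
  obtain ⟨c, hc⟩ := h.lower
  have h1 := hheart 1 one_pos
  refine (h1.add (integrable_const c)).mono' (Measurable.aestronglyMeasurable (by fun_prop))
    (Eventually.of_forall fun ω => ?_)
  have h2 := hc (WithLp.toLp 2 fun j => 1 * |X ω j|)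
  have h3 : |X ω j| ≤ ∑ i, 1 * |X ω i| := by
    simp_rw [one_mul]
    exact Finset.single_le_sum (f := fun i => |X ω i|) (fun i _ => abs_nonneg _)
      (Finset.mem_univ j)
  simp only [Pi.add_apply, Real.norm_eq_abs]
  linarith

/-- All moderate translates of the loss have a common integrable bound. -/
theorem IsLossFunction.exists_bound [IsProbabilityMeasure P] (h : IsLossFunction ell)
    (hX : Measurable X) (hheart : MemOrliczHeart P ell X) (R : ℝ) :
    ∃ B : Ω → ℝ, Integrable B P ∧ ∀ ω, ∀ u : Euc d, (∀ j, |u j| ≤ R) → |ell (X ω - u)| ≤ B ω := by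
  obtain ⟨c, hc⟩ := h.lower
  set A : Ω → Euc d := fun ω => WithLp.toLp 2 fun j => 2 * |X ω j|
  set e : Euc d := WithLp.toLp 2 fun _ => 2 * R
  refine ⟨fun ω => (|ell (A ω)| + |ell e|) + ((∑ j, |X ω j|) + (d * R + |c|)),
    ((hheart 2 two_pos).norm.add (integrable_const _)).add ((integrable_finsetSum _ fun j _ =>
      (h.integrable_coord hX hheart j).norm).add (integrable_const _)), fun ω u hu => ?_⟩
  -- Componentwise `X - u ≤ ½ (2|X|) + ½ (2R)`; monotonicity and convexity separate the two parts,
  -- using the Orlicz heart at `t = 2`.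
  have hup : ell (X ω - u) ≤ (1 / 2) * ell (A ω) + (1 / 2) * ell e := by
    have h1 := h.convex.2 (Set.mem_univ (A ω)) (Set.mem_univ e) (by norm_num : (0 : ℝ) ≤ 1 / 2)
      (by norm_num : (0 : ℝ) ≤ 1 / 2) (by norm_num)
    refine (h.mono _ _ fun j => ?_).trans h1
    simp only [A, e, PiLp.sub_apply, PiLp.add_apply, PiLp.smul_apply, smul_eq_mul]
    have := neg_abs_le (u j)
    have := le_abs_self (X ω j)
    have := hu j
    linarith
  have hlow : -((∑ j, |X ω j|) + (d * R + |c|)) ≤ ell (X ω - u) := by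
    refine le_trans ?_ (hc (X ω - u))
    have h1 : ∑ j, (-|X ω j| - R) ≤ ∑ j, (X ω - u) j := by
      refine Finset.sum_le_sum fun j _ => ?_
      rw [PiLp.sub_apply]
      have := neg_abs_le (X ω j)
      have := le_abs_self (u j)
      have := hu j
      linarith
    rw [Finset.sum_sub_distrib, Finset.sum_neg_distrib] at h1
    simp only [Finset.sum_const, Finset.card_univ, Fintype.card_fin, nsmul_eq_mul] at h1
    have := le_abs_self c
    linarith
  have hs : 0 ≤ (∑ j, |X ω j|) + (d * R + |c|) := by
    -- The sign of `R` is not assumed: for `d > 0` the bound on `u` forces it, and for `d = 0` the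
    -- product vanishes.
    have : (0 : ℝ) ≤ d * R := by
      rcases Nat.eq_zero_or_pos d with rfl | hd
      · simp
      · exact mul_nonneg (Nat.cast_nonneg _) ((abs_nonneg _).trans (hu ⟨0, hd⟩))
    have h2 : 0 ≤ ∑ j, |X ω j| := Finset.sum_nonneg fun j _ => abs_nonneg _
    have := abs_nonneg c
    linarith
  have := le_abs_self (ell (A ω))
  have := le_abs_self (ell e)
  have := abs_nonneg (ell (A ω))
  have := abs_nonneg (ell e)
  exact abs_le.2 ⟨by linarith, by linarith⟩

theorem fderiv_le_sub_of_convexOn {E : Type*} [NormedAddCommGroup E] [NormedSpace ℝ E] {f : E → ℝ}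
    (hf : ConvexOn ℝ Set.univ f) {x : E} (hd : DifferentiableAt ℝ f x) (v : E) :
    fderiv ℝ f x v ≤ f (x + v) - f x := by
  have hconv : ConvexOn ℝ Set.univ fun t : ℝ => f (x + t • v) := by
    have := hf.comp_affineMap (AffineMap.lineMap x (x + v) : ℝ →ᵃ[ℝ] E)
    have he : f ∘ (AffineMap.lineMap x (x + v) : ℝ →ᵃ[ℝ] E) = fun t : ℝ => f (x + t • v) := by
      funext t; simp [AffineMap.lineMap_apply, add_comm]
    rwa [he, Set.preimage_univ] at this
  have hder : HasDerivAt (fun t : ℝ => f (x + t • v)) (fderiv ℝ f x v) 0 := by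
    have h1 : HasDerivAt (fun t : ℝ => x + t • v) v 0 := by
      simpa using ((hasDerivAt_id (0 : ℝ)).smul_const v).const_add x
    have h2 : HasFDerivAt f (fderiv ℝ f x) (x + (0 : ℝ) • v) := by
      simpa using hd.hasFDerivAt
    exact h2.comp_hasDerivAt 0 h1
  have := hconv.le_slope_of_hasDerivAt (Set.mem_univ 0) (Set.mem_univ 1) one_pos hder
  simpa [slope_def_field] using this

/-- Convexity bounds the derivative by the unit differences on both sides; where `ell` is not
differentiable, `fderiv` is zero by convention. -/
theorem abs_partialDeriv_le (h : IsLossFunction ell) (j : Fin d) (x : Euc d) :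
    |partialDeriv j ell x| ≤ |ell (x + EuclideanSpace.single j 1)| +
      |ell (x - EuclideanSpace.single j 1)| + |ell x| := by
  unfold partialDeriv
  by_cases hd : DifferentiableAt ℝ ell x
  · have h1 := fderiv_le_sub_of_convexOn h.convex hd (EuclideanSpace.single j 1)
    have h2 := fderiv_le_sub_of_convexOn h.convex hd (-EuclideanSpace.single j 1)
    rw [map_neg, ← sub_eq_add_neg] at h2
    have h3 := abs_le.1 (le_refl |ell (x + EuclideanSpace.single j 1)|)
    have h4 := abs_le.1 (le_refl |ell (x - EuclideanSpace.single j 1)|)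
    have h5 := abs_le.1 (le_refl |ell x|)
    exact abs_le.2 ⟨by linarith, by linarith⟩
  · rw [fderiv_zero_of_not_differentiableAt hd]
    simp only [_root_.zero_apply, abs_zero]
    positivity

theorem abs_coord_le_of_mem_ball {m₀ m : Euc d} (hm : m ∈ Metric.ball m₀ 1) (j : Fin d) :
    |m j| ≤ ‖m₀‖ + 1 := by
  have h1 := PiLp.norm_apply_le m j
  have h2 : ‖m‖ ≤ ‖m₀‖ + 1 := by
    have := norm_le_norm_add_norm_sub' m m₀
    rw [Metric.mem_ball, dist_eq_norm] at hm
    linarith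
  exact h1.trans h2

theorem IsLossFunction.continuousAt_expectedLoss [IsProbabilityMeasure P]
    (h : IsLossFunction ell) (hX : Measurable X) (hheart : MemOrliczHeart P ell X) (m₀ : Euc d) :
    ContinuousAt (expectedLoss P ell X) m₀ := by
  obtain ⟨B, hB, hle⟩ := h.exists_bound hX hheart (‖m₀‖ + 1)
  refine continuousAt_of_dominated (bound := B) (Eventually.of_forall fun m => ?_) ?_ hB
    (Eventually.of_forall fun ω => (h.continuous.comp (by fun_prop)).continuousAt)
  · exact (h.continuous.measurable.comp (hX.sub_const m)).aestronglyMeasurable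
  · filter_upwards [Metric.ball_mem_nhds m₀ one_pos] with m hm
    exact Eventually.of_forall fun ω => hle ω m (abs_coord_le_of_mem_ball hm)

theorem IsLossFunction.continuousAt_integral_partialDeriv [IsProbabilityMeasure P]
    (h : IsLossFunction ell) (hX : Measurable X) (hheart : MemOrliczHeart P ell X) (m₀ : Euc d)
    (hcont : ∀ᵐ ω ∂P, ContinuousAt (fun m : Euc d => fderiv ℝ ell (X ω - m)) m₀) (j : Fin d) :
    ContinuousAt (fun m => ∫ ω, partialDeriv j ell (X ω - m) ∂P) m₀ := by
  -- One unit of room for `m` in the ball and one for the unit differences that bound the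
  -- derivative.
  obtain ⟨B, hB, hle⟩ := h.exists_bound hX hheart (‖m₀‖ + 2)
  refine continuousAt_of_dominated (bound := fun ω => B ω + B ω + B ω)
    (Eventually.of_forall fun m => ?_) ?_ ((hB.add hB).add hB) ?_
  · exact ((measurable_fderiv_apply_const ℝ ell _).comp (hX.sub_const m)).aestronglyMeasurable
  · filter_upwards [Metric.ball_mem_nhds m₀ one_pos] with m hm
    refine Eventually.of_forall fun ω => ?_
    have hm' := abs_coord_le_of_mem_ball hm
    have hs : ∀ i, |(EuclideanSpace.single j (1 : ℝ) : Euc d) i| ≤ 1 := fun i => by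
      by_cases hi : i = j <;> simp [hi]
    have h1 := hle ω (m - EuclideanSpace.single j 1) fun i => by
      rw [PiLp.sub_apply]
      have := abs_sub (m i) ((EuclideanSpace.single j (1 : ℝ) : Euc d) i)
      linarith [hm' i, hs i]
    have h2 := hle ω (m + EuclideanSpace.single j 1) fun i => by
      rw [PiLp.add_apply]
      have := abs_add_le (m i) ((EuclideanSpace.single j (1 : ℝ) : Euc d) i)
      linarith [hm' i, hs i]
    have h3 := hle ω m fun i => by linarith [hm' i]
    refine (abs_partialDeriv_le h j _).trans ?_
    rw [sub_sub_eq_add_sub, add_sub_right_comm] at h1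
    rw [← sub_sub] at h2
    exact add_le_add_three h1 h2 h3
  · filter_upwards [hcont] with ω hω
    exact hω.clm_apply continuousAt_const

end Loss

/-! ### The exact system and its Fourier representation -/

section Exact

variable {d : ℕ} {ι : Type*} [Fintype ι] {Ω : Type*} [MeasurableSpace Ω] {P : Measure Ω}
  {X : Ω → Euc d} {A : LossDecomposition d ι} {M : Set (Euc d)}

theorem measurable_proj {k d : ℕ} (p : Fin k ↪o Fin d) : Measurable (proj p) :=
  (projL p).continuous.measurable

theorem partialDeriv_loss {x : Euc d}
    (hx : ∀ i, DifferentiableAt ℝ (A.comp i).loss (proj (A.comp i).p x)) (j : Fin d) :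
    partialDeriv j A.loss x = A.lin j + ∑ i, ∑ r, if (A.comp i).p r = j then
      partialDeriv r (A.comp i).loss (proj (A.comp i).p x) else 0 := by
  have hlin : HasFDerivAt (fun x : Euc d => A.const + ∑ j, A.lin j * x j)
      (∑ j, A.lin j • (EuclideanSpace.proj j : Euc d →L[ℝ] ℝ)) x := by
    refine HasFDerivAt.const_add _ (HasFDerivAt.fun_sum fun j _ => ?_)
    exact ((EuclideanSpace.proj j : Euc d →L[ℝ] ℝ).hasFDerivAt (x := x)).const_mul (A.lin j)
  have hcomp : ∀ i, HasFDerivAt (fun x => (A.comp i).loss (proj (A.comp i).p x))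
      ((fderiv ℝ (A.comp i).loss (proj (A.comp i).p x)).comp (projL (A.comp i).p)) x := fun i =>
    HasFDerivAt.comp x (hx i).hasFDerivAt ((projL (A.comp i).p).hasFDerivAt)
  have htot : HasFDerivAt A.loss _ x := hlin.add (HasFDerivAt.fun_sum fun i _ => hcomp i)
  unfold partialDeriv
  rw [htot.fderiv]
  simp only [_root_.add_apply, _root_.sum_apply,
    _root_.smul_apply, ContinuousLinearMap.comp_apply, projL_apply, proj_single,
    map_sum]
  congr 1
  · simp
  · refine Finset.sum_congr rfl fun i _ => Finset.sum_congr rfl fun r _ => ?_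
    split_ifs <;> simp

theorem LossDecomposition.Admissible.ae_expectedLoss_eq [IsProbabilityMeasure P]
    (hX : Measurable X) (hXint : ∀ j, Integrable (fun ω => X ω j) P)
    (hadm : A.Admissible P X M) :
    ∀ᵐ m : Euc d, expectedLoss P A.loss X m =
      A.aggregate0 (LossDecomposition.mean P X)
        (fun i φ K m => fourierValue P (fun ω => proj (A.comp i).p (X ω)) φ K m) m := by
  have h := fun i => ae_proj (A.comp i).p
    (ae_integral_eq_fourierValue (Y := fun ω => proj (A.comp i).p (X ω))
      ((measurable_proj (A.comp i).p).comp hX) (hadm.shift0 i))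
  filter_upwards [ae_all_iff.2 h] with m hm
  unfold expectedLoss LossDecomposition.loss LossDecomposition.aggregate0
  simp_rw [proj_sub]
  have hj : ∀ j, Integrable (fun ω => A.lin j * (X ω - m) j) P := fun j =>
    ((hXint j).sub (integrable_const _)).const_mul _
  have hlin : Integrable (fun ω => ∑ j, A.lin j * (X ω - m) j) P :=
    integrable_finsetSum _ fun j _ => hj j
  have hconst : Integrable (fun _ : Ω => A.const) P := integrable_const _
  have haff : Integrable (fun ω => A.const + ∑ j, A.lin j * (X ω - m) j) P := hconst.add hlin
  rw [integral_add haff (integrable_finsetSum _ fun i _ => (hm i).1),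
    integral_add hconst hlin, integral_finsetSum _ fun i _ => (hm i).1,
    integral_finsetSum _ fun j _ => hj j]
  congr 1
  · congr 1
    · simp
    · refine Finset.sum_congr rfl fun j _ => ?_
      rw [integral_const_mul]
      simp_rw [PiLp.sub_apply]
      rw [integral_sub (hXint j) (integrable_const _)]
      simp [LossDecomposition.mean]
  · exact Finset.sum_congr rfl fun i _ => (hm i).2

/-- Lebesgue null sets are translation invariant, and the density makes them null for the law of
`X`. -/
theorem ae_sub_of_absolutelyContinuous (hX : Measurable X) (hdens : P.map X ≪ volume)
    {q : Euc d → Prop} (hq : ∀ᵐ x, q x) (m : Euc d) : ∀ᵐ ω ∂P, q (X ω - m) := by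
  have h1 : ∀ᵐ x : Euc d, q (x - m) :=
    (measurePreserving_sub_right volume m).quasiMeasurePreserving.ae hq
  exact ae_of_ae_map hX.aemeasurable (hdens.ae_le h1)

theorem LossDecomposition.Admissible.ae_integral_partialDeriv_eq [IsProbabilityMeasure P]
    (hX : Measurable X) (hdens : P.map X ≪ volume) (hadm : A.Admissible P X M) (j : Fin d) :
    ∀ᵐ m : Euc d, ∫ ω, partialDeriv j A.loss (X ω - m) ∂P =
      A.aggregate1
        (fun i φ K m => fourierValue P (fun ω => proj (A.comp i).p (X ω)) φ K m) m j := by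
  have h := fun i => ae_all_iff.2 fun r => ae_proj (A.comp i).p
    (ae_integral_eq_fourierValue (Y := fun ω => proj (A.comp i).p (X ω))
      ((measurable_proj (A.comp i).p).comp hX) (hadm.shift1 i r))
  have hd : ∀ᵐ x : Euc d, ∀ i, DifferentiableAt ℝ (A.comp i).loss (proj (A.comp i).p x) :=
    ae_all_iff.2 fun i => ae_proj (A.comp i).p (hadm.differentiable i)
  filter_upwards [ae_all_iff.2 h] with m hm
  have hae : ∀ᵐ ω ∂P, partialDeriv j A.loss (X ω - m) = A.lin j + ∑ i, ∑ r,
      if (A.comp i).p r = j then partialDeriv r (A.comp i).loss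
        (proj (A.comp i).p (X ω) - proj (A.comp i).p m) else 0 := by
    filter_upwards [ae_sub_of_absolutelyContinuous hX hdens hd m] with ω hω
    rw [partialDeriv_loss hω]
    simp_rw [proj_sub]
  rw [integral_congr_ae hae]
  have hint : ∀ i r, Integrable (fun ω => if (A.comp i).p r = j then
      partialDeriv r (A.comp i).loss (proj (A.comp i).p (X ω) - proj (A.comp i).p m) else 0) P := by
    intro i r
    split_ifs
    · exact (hm i r).1
    · exact integrable_zero _ _ _
  rw [integral_add (integrable_const _) (integrable_finsetSum _ fun i _ =>
    integrable_finsetSum _ fun r _ => hint i r), integral_finsetSum _ fun i _ =>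
    integrable_finsetSum _ fun r _ => hint i r]
  unfold LossDecomposition.aggregate1
  congr 1
  · simp
  · refine Finset.sum_congr rfl fun i _ => ?_
    rw [integral_finsetSum _ fun r _ => hint i r]
    refine Finset.sum_congr rfl fun r _ => ?_
    split_ifs
    · exact (hm i r).2
    · simp

/-- A set of full Lebesgue measure is dense, so both values are limits along it. -/
theorem eq_of_ae_eq_of_continuousAt {f g : Euc d → ℝ} {x : Euc d} (h : f =ᵐ[volume] g)
    (hf : ContinuousAt f x) (hg : ContinuousAt g x) : f x = g x := by
  have hd : Dense {y | f y = g y} := Measure.dense_of_ae h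
  have hne : (𝓝[{y | f y = g y}] x).NeBot := mem_closure_iff_nhdsWithin_neBot.1 (hd x)
  have tf : Tendsto f (𝓝[{y | f y = g y}] x) (𝓝 (f x)) := hf.tendsto.mono_left nhdsWithin_le_nhds
  have tg : Tendsto g (𝓝[{y | f y = g y}] x) (𝓝 (g x)) := hg.tendsto.mono_left nhdsWithin_le_nhds
  refine tendsto_nhds_unique_of_eventuallyEq tf tg ?_
  filter_upwards [self_mem_nhdsWithin] with y hy using hy

/-- A solution of the exact system solves its Fourier representation. -/
theorem fourierKKT_eq_zero [IsProbabilityMeasure P] (hX : Measurable X)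
    (hdens : P.map X ≪ volume) (hloss : IsLossFunction A.loss)
    (hheart : MemOrliczHeart P A.loss X) (hadm : A.Admissible P X M) {z : PrimalDual d}
    (hz : IsExactKKT P A.loss X z)
    (hC1 : ∀ᵐ ω ∂P, DifferentiableAt ℝ (fun m : Euc d => fderiv ℝ A.loss (X ω - m)) z.1)
    (hcont : ContinuousAt (A.fourierKKT P X) z) : A.fourierKKT P X z = 0 := by
  obtain ⟨hpos, h1, h0⟩ := hz
  have hXint := hloss.integrable_coord hX hheart
  set ev : ∀ i, (Euc (A.comp i).k → ℝ) → Euc (A.comp i).k → Euc (A.comp i).k → ℝ :=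
    fun i φ K m => fourierValue P (fun ω => proj (A.comp i).p (X ω)) φ K m with hev
  -- With `lam` frozen at `z.2 > 0`, continuity of the aggregates is recovered from that of the
  -- whole map by dividing by `z.2`.
  have hslice : ContinuousAt (fun m => A.fourierKKT P X (m, z.2)) z.1 :=
    ContinuousAt.comp (f := fun m : Euc d => (m, z.2)) (g := A.fourierKKT P X) hcont (by fun_prop)
  have hg0 : ContinuousAt (fun m => A.aggregate0 (LossDecomposition.mean P X) ev m) z.1 :=
    hslice.snd.neg.congr (Eventually.of_forall fun m => neg_neg _)
  have hg1 : ∀ j, ContinuousAt (fun m => A.aggregate1 ev m j) z.1 := by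
    intro j
    have h2 : ContinuousAt (fun m => (A.fourierKKT P X (m, z.2)).1 j) z.1 :=
      ContinuousAt.comp (f := fun m => (A.fourierKKT P X (m, z.2)).1) (g := fun y : Euc d => y j)
        (Continuous.continuousAt (by fun_prop)) hslice.fst
    have h3 : ContinuousAt (fun m => (1 - (A.fourierKKT P X (m, z.2)).1 j) / z.2) z.1 :=
      (continuousAt_const.sub h2).div_const _
    refine h3.congr (Eventually.of_forall fun m => ?_)
    simp only [LossDecomposition.fourierKKT, LossDecomposition.kktMap]
    field_simp
    simp [hev]
  have e0 := eq_of_ae_eq_of_continuousAt (hadm.ae_expectedLoss_eq hX hXint)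
    (hloss.continuousAt_expectedLoss hX hheart z.1) hg0
  have e1 := fun j => eq_of_ae_eq_of_continuousAt (hadm.ae_integral_partialDeriv_eq hX hdens j)
    (hloss.continuousAt_integral_partialDeriv hX hheart z.1 (hC1.mono fun ω h => h.continuousAt) j)
    (hg1 j)
  rw [h0] at e0
  refine Prod.ext ?_ ?_
  · ext j
    change 1 - z.2 * A.aggregate1 ev z.1 j = 0
    rw [← e1 j]
    linarith [h1 j]
  · change -A.aggregate0 (LossDecomposition.mean P X) ev z.1 = 0
    rw [← e0, neg_zero]

end Exact

/-! ### The transformed integrand as a function of the shift -/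

section Integrand

variable {k D : ℕ} {Ω : Type*} [MeasurableSpace Ω] {P : Measure Ω} {Y : Ω → Euc k}
  {φ : Euc k → ℝ} {K : Euc k} {G : DomainTransform k D}

/-- The phase `⟨K - i w, u⟩`. -/
noncomputable def phase {k : ℕ} (K w u : Euc k) : ℂ :=
  ∑ r, ((K r : ℂ) - Complex.I * (w r : ℂ)) * (u r : ℂ)

theorem phase_add (K w u u' : Euc k) : phase K w (u + u') = phase K w u + phase K w u' := by
  simp [phase, mul_add, Finset.sum_add_distrib]

theorem phase_sub (K w u u' : Euc k) : phase K w (u - u') = phase K w u - phase K w u' := by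
  simp [phase, mul_sub, Finset.sum_sub_distrib]

theorem phase_re (K w u : Euc k) : (phase K w u).re = ∑ r, K r * u r := by
  simp [phase]

theorem norm_phase_le (K w u : Euc k) :
    ‖phase K w u‖ ≤ (∑ r, ‖(K r : ℂ) - Complex.I * (w r : ℂ)‖) * ‖u‖ := by
  rw [Finset.sum_mul]
  refine (norm_sum_le _ _).trans (Finset.sum_le_sum fun r _ => ?_)
  rw [norm_mul]
  gcongr
  rw [Complex.norm_real]
  exact PiLp.norm_apply_le u r

theorem hasFDerivAt_phase (K w u : Euc k) :
    HasFDerivAt (phase K w) (∑ r, ((EuclideanSpace.proj r : Euc k →L[ℝ] ℝ).smulRight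
      ((K r : ℂ) - Complex.I * (w r : ℂ)))) u := by
  have h : phase K w = fun u => (∑ r, ((EuclideanSpace.proj r : Euc k →L[ℝ] ℝ).smulRight
      ((K r : ℂ) - Complex.I * (w r : ℂ)))) u := by
    funext u
    simp [phase, mul_comm]
  rw [h]
  exact ContinuousLinearMap.hasFDerivAt _

/-- The shift enters only through an exponential, so moving it multiplies the integrand by an
explicit factor. All regularity in `m` comes from this. -/
theorem transformedIntegrand_add (m u : Euc k) (v : Euc D) :
    transformedIntegrand G P Y φ K (m + u) v =
      Complex.exp (phase K (G.inv v) u) * transformedIntegrand G P Y φ K m v := by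
  have h := phase_add K (G.inv v) m u
  unfold phase at h
  simp only [transformedIntegrand, fourierIntegrand, phase]
  rw [h, Complex.exp_add]
  ring

theorem partialDeriv_transformedIntegrand (r : Fin k) (m : Euc k) (v : Euc D) :
    partialDeriv r (fun m' => transformedIntegrand G P Y φ K m' v) m =
      ((K r : ℂ) - Complex.I * (G.inv v r : ℂ)) * transformedIntegrand G P Y φ K m v := by
  have h1 : (fun m' => transformedIntegrand G P Y φ K m' v) = fun m' =>
      Complex.exp (phase K (G.inv v) m') * transformedIntegrand G P Y φ K 0 v := by
    funext m'
    rw [← transformedIntegrand_add, zero_add]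
  have h2 := ((hasFDerivAt_phase K (G.inv v) m).cexp).mul_const
    (transformedIntegrand G P Y φ K 0 v)
  have h3 := transformedIntegrand_add (G := G) (P := P) (Y := Y) (φ := φ) (K := K) 0 m v
  rw [zero_add] at h3
  unfold partialDeriv
  rw [h1, h2.fderiv, h3]
  simp only [_root_.smul_apply, _root_.sum_apply, ContinuousLinearMap.smulRight_apply, smul_eq_mul]
  rw [Finset.sum_eq_single r (fun s _ hs => by simp [hs]) (by simp)]
  simp
  ring

theorem measurable_transformedIntegrand (hY : Measurable Y) (h : IsAdmissibleShift P Y φ K) :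
    Measurable fun q : Euc k × Euc D => transformedIntegrand G P Y φ K q.1 q.2 := by
  have h1 : Measurable fun q : Euc k × Euc D => transformProduct P Y φ K (G.inv q.2) :=
    (continuous_transformProduct hY h).measurable.comp (G.measurable_inv.comp measurable_snd)
  have h2 : Measurable fun q : Euc k × Euc D => G.inv q.2 := G.measurable_inv.comp measurable_snd
  have h3 : Measurable fun q : Euc k × Euc D => Complex.exp (phase K (G.inv q.2) q.1) := by
    unfold phase
    fun_prop
  have h4 : Measurable fun q : Euc k × Euc D => ((G.jac q.2 : ℝ) : ℂ) :=
    Complex.measurable_ofReal.comp (G.measurable_jac.comp measurable_snd)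
  have h5 := ((h3.const_mul ((((2 * Real.pi) ^ k)⁻¹ : ℝ) : ℂ)).mul h1).mul h4
  have h6 : (fun q : Euc k × Euc D => transformedIntegrand G P Y φ K q.1 q.2) = fun q =>
      ((((2 * Real.pi) ^ k)⁻¹ : ℝ) : ℂ) * Complex.exp (phase K (G.inv q.2) q.1) *
        transformProduct P Y φ K (G.inv q.2) * ((G.jac q.2 : ℝ) : ℂ) := by
    funext q
    simp only [transformedIntegrand, fourierIntegrand, transformProduct, phase]
    ring
  rw [h6]
  exact h5

theorem measurable_transformedIntegrand_apply (hY : Measurable Y) (h : IsAdmissibleShift P Y φ K)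
    (m : Euc k) : Measurable (transformedIntegrand G P Y φ K m) := by
  have := (measurable_transformedIntegrand (G := G) hY h).comp
    (measurable_prodMk_left : Measurable (Prod.mk m))
  exact this

instance isProbabilityMeasure_restrict_cube :
    IsProbabilityMeasure (volume.restrict (cube D) : Measure (Euc D)) := by
  rw [← map_binaryVector_digitMeasure]
  exact Measure.isProbabilityMeasure_map measurable_binaryVector.aemeasurable

/-- Only `K` contributes to the modulus, so the bound is uniform in the unbounded variable `w`. -/
theorem norm_exp_phase_le (K w u : Euc k) :
    ‖Complex.exp (phase K w u)‖ ≤ Real.exp (∑ r, |K r| * ‖u‖) := by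
  rw [Complex.norm_exp, phase_re]
  refine Real.exp_le_exp.2 (Finset.sum_le_sum fun r _ => (le_abs_self _).trans ?_)
  rw [abs_mul]
  exact mul_le_mul_of_nonneg_left (PiLp.norm_apply_le u r) (abs_nonneg _)

/-- Since the factor of a shift is bounded, square-integrability at one point spreads to every `m`.
-/
theorem SquareIntegrableAt.memLp (hY : Measurable Y) (h : IsAdmissibleShift P Y φ K) {m₀ : Euc k}
    (hs : SquareIntegrableAt G P Y φ K m₀) (m : Euc k) :
    MemLp (transformedIntegrand G P Y φ K m) 2 (volume.restrict (cube D)) := by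
  refine (hs.1.const_mul ((Real.exp (∑ r, |K r| * ‖m - m₀‖) : ℝ) : ℂ)).mono
    (measurable_transformedIntegrand_apply hY h m).aestronglyMeasurable
    (Eventually.of_forall fun v => ?_)
  have := transformedIntegrand_add (G := G) (P := P) (Y := Y) (φ := φ) (K := K) m₀ (m - m₀) v
  rw [add_sub_cancel] at this
  rw [this, norm_mul, norm_mul, Complex.norm_real, Real.norm_eq_abs, Real.abs_exp]
  exact mul_le_mul_of_nonneg_right (norm_exp_phase_le _ _ _) (norm_nonneg _)

/-- The mean of the transformed integrand over the cube is the Fourier integral. -/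
theorem setIntegral_transformedIntegrand (hY : Measurable Y) (h : IsAdmissibleShift P Y φ K)
    {m₀ : Euc k} (hs : SquareIntegrableAt G P Y φ K m₀) (m : Euc k) :
    ∫ v in cube D, (transformedIntegrand G P Y φ K m v).re = fourierValue P Y φ K m := by
  have hint := (hs.memLp hY h m).integrable one_le_two
  have hcont : Continuous (fourierIntegrand P Y φ K m) := by
    have h1 := continuous_transformProduct hY h
    have h2 : Continuous fun w : Euc k => (((2 * Real.pi) ^ k)⁻¹ : ℝ) *
      Complex.exp (∑ r, ((K r : ℂ) - Complex.I * (w r : ℂ)) * (m r : ℂ)) := by fun_prop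
    refine (h2.mul h1).congr fun w => ?_
    exact (mul_assoc _ _ _).symm
  have hre := integral_re hint
  simp only [RCLike.re_eq_complex_re] at hre
  rw [hre]
  unfold fourierValue
  congr 1
  rw [← G.map_eq, integral_map G.measurable_inv.aemeasurable
    (by rw [G.map_eq]; exact hcont.aestronglyMeasurable),
    integral_withDensity_eq_integral_toReal_smul G.measurable_jac.ennreal_ofReal
      (Eventually.of_forall fun v => ENNReal.ofReal_lt_top)]
  refine integral_congr_ae (Eventually.of_forall fun v => ?_)
  simp only [ENNReal.toReal_ofReal (G.jac_nonneg v), transformedIntegrand, Complex.real_smul]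
  ring

/-- The first-order remainder of `u ↦ exp(⟨K - i w, u⟩)` on a small ball. -/
theorem norm_exp_phase_remainder_le (K w : Euc k) {δ : ℝ} (hδ : δ ≤ 1) {u u' : Euc k}
    (hu : u ∈ Metric.closedBall 0 δ) (hu' : u' ∈ Metric.closedBall 0 δ) :
    ‖Complex.exp (phase K w u) - Complex.exp (phase K w u') - phase K w (u - u')‖ ≤
      min (Real.exp (∑ r, |K r|) + 1)
        (Real.exp ((∑ r, ‖(K r : ℂ) - Complex.I * (w r : ℂ)‖) * δ) - 1) *
        ((∑ r, ‖(K r : ℂ) - Complex.I * (w r : ℂ)‖) * ‖u - u'‖) := by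
  set B := min (Real.exp (∑ r, |K r|) + 1)
        (Real.exp ((∑ r, ‖(K r : ℂ) - Complex.I * (w r : ℂ)‖) * δ) - 1)
  set Θ := ∑ r, ‖(K r : ℂ) - Complex.I * (w r : ℂ)‖
  set L : Euc k →L[ℝ] ℂ := ∑ r, ((EuclideanSpace.proj r : Euc k →L[ℝ] ℝ).smulRight
      ((K r : ℂ) - Complex.I * (w r : ℂ))) with hLdef
  have hL : ∀ x, L x = phase K w x := fun x => by simp [hLdef, phase, mul_comm]
  have hLn : ‖L‖ ≤ Θ := ContinuousLinearMap.opNorm_le_bound _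
    (Finset.sum_nonneg fun r _ => norm_nonneg _) fun x => by rw [hL]; exact norm_phase_le K w x
  -- The mean value inequality is applied to `exp ∘ phase - phase`, with derivative `(exp - 1) • L`.
  -- One bound on `exp - 1` is uniform in `w`, the other vanishes with `δ`; the minimum keeps both.
  have hder : ∀ x ∈ Metric.closedBall (0 : Euc k) δ, HasFDerivWithinAt
      (fun x => Complex.exp (phase K w x) - phase K w x)
      (Complex.exp (phase K w x) • L - L) (Metric.closedBall 0 δ) x := fun x _ =>
    ((hasFDerivAt_phase K w x).cexp.sub (hasFDerivAt_phase K w x)).hasFDerivWithinAt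
  have hbound : ∀ x ∈ Metric.closedBall (0 : Euc k) δ,
      ‖Complex.exp (phase K w x) • L - L‖ ≤ B * Θ := by
    intro x hx
    have hx' : ‖x‖ ≤ δ := by simpa using hx
    have h1 : Complex.exp (phase K w x) • L - L = (Complex.exp (phase K w x) - 1) • L := by
      ext x; simp [sub_mul]
    rw [h1, norm_smul]
    refine mul_le_mul (le_min ?_ ?_) hLn (norm_nonneg _) ?_
    · refine (norm_sub_le _ _).trans ?_
      rw [norm_one]
      refine add_le_add_left ((norm_exp_phase_le K w x).trans (Real.exp_le_exp.2 ?_)) 1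
      exact Finset.sum_le_sum fun r _ =>
        mul_le_of_le_one_right (abs_nonneg _) (hx'.trans hδ)
    · have h2 := Complex.norm_exp_sub_sum_le_exp_norm_sub_sum (phase K w x) 1
      simp only [Finset.sum_range_one, pow_zero, Nat.factorial_zero, Nat.cast_one, div_one] at h2
      refine h2.trans (sub_le_sub_right (Real.exp_le_exp.2 ?_) 1)
      exact (norm_phase_le K w x).trans (mul_le_mul_of_nonneg_left hx'
        (Finset.sum_nonneg fun r _ => norm_nonneg _))
    · have hδ0 : 0 ≤ δ := (norm_nonneg x).trans hx'
      refine le_min (by positivity) (sub_nonneg.2 (Real.one_le_exp ?_))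
      exact mul_nonneg (Finset.sum_nonneg fun r _ => norm_nonneg _) hδ0
  have := (convex_closedBall (0 : Euc k) δ).norm_image_sub_le_of_norm_hasFDerivWithin_le hder
    hbound hu' hu
  rw [phase_sub]
  rw [← mul_assoc]
  rwa [sub_sub_sub_comm] at this

end Integrand

/-! ### The RQMC estimator -/

section Rqmc

variable {S D : ℕ}

/-- The RQMC estimator as a linear functional of the integrand. -/
noncomputable def rqmcL (pts : Fin S → ℕ → Euc D) (N : ℕ) : (Euc D → ℂ) →ₗ[ℝ] ℝ where
  toFun := rqmc pts N
  map_add' f g := by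
    simp [rqmc, Finset.sum_add_distrib, mul_add]
  map_smul' c f := by
    simp only [rqmc, Pi.smul_apply, Complex.real_smul, Complex.re_ofReal_mul, ← Finset.mul_sum,
      RingHom.id_apply, smul_eq_mul]
    simp_rw [mul_left_comm _ c]

theorem abs_rqmc_le (pts : Fin S → ℕ → Euc D) (N : ℕ) {f : Euc D → ℂ} {b : Euc D → ℝ}
    (h : ∀ v, ‖f v‖ ≤ b v) : |rqmc pts N f| ≤ rqmc pts N fun v => (b v : ℂ) := by
  unfold rqmc
  rw [abs_mul, abs_of_nonneg (inv_nonneg.2 (Nat.cast_nonneg S))]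
  refine mul_le_mul_of_nonneg_left ((Finset.abs_sum_le_sum_abs _ _).trans
    (Finset.sum_le_sum fun s _ => ?_)) (inv_nonneg.2 (Nat.cast_nonneg S))
  rw [abs_mul, abs_of_nonneg (inv_nonneg.2 (Nat.cast_nonneg N))]
  refine mul_le_mul_of_nonneg_left ((Finset.abs_sum_le_sum_abs _ _).trans
    (Finset.sum_le_sum fun n _ => ?_)) (inv_nonneg.2 (Nat.cast_nonneg N))
  rw [Complex.ofReal_re]
  exact (Complex.abs_re_le_norm _).trans (h _)

variable {Ω' : Type*} [MeasurableSpace Ω'] {Q : Measure Ω'} [IsProbabilityMeasure Q]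
  {ξ : Fin S → Fin D → List Bool → Ω' → Bool}

/-- Strong law of large numbers for the RQMC estimator. -/
theorem IsNestedUniformScramble.tendsto_rqmc (h : IsNestedUniformScramble Q ξ) (hS : 0 < S)
    (g : SobolGenerator D) {f : Euc D → ℂ} (hfm : Measurable f)
    (hf : MemLp f 2 (volume.restrict (cube D))) :
    Tendsto (fun a : Ω' × ℕ => rqmc (scrambledPoint g ξ a.1) a.2 f) ((ae Q).curry atTop)
      (𝓝 (∫ v in cube D, (f v).re)) := by
  have h1 : ∀ᵐ ω ∂Q, Tendsto (fun N => rqmc (scrambledPoint g ξ ω) N f) atTop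
      (𝓝 (∫ v in cube D, (f v).re)) := by
    have h2 := ae_all_iff.2 fun s => h.tendsto_average g (Complex.measurable_re.comp hfm) hf.re s
    filter_upwards [h2] with ω hω
    have h3 := (tendsto_finsetSum Finset.univ fun s _ => hω s).const_mul (S : ℝ)⁻¹
    have h4 : (S : ℝ)⁻¹ * ∑ _s : Fin S, ∫ v in cube D, (f v).re = ∫ v in cube D, (f v).re := by
      rw [Finset.sum_const, Finset.card_univ, Fintype.card_fin, nsmul_eq_mul,
        inv_mul_cancel_left₀ (by positivity)]
    simp only [Function.comp_def] at h3
    rw [h4] at h3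
    exact h3
  intro U hU
  rw [mem_map, ← Filter.eventually_mem_set, Filter.eventually_curry_iff]
  filter_upwards [h1] with ω hω using hω hU

end Rqmc

/-! ### Strict differentiability along a filter -/

section Strict

variable {α E F : Type*} [NormedAddCommGroup E] [NormedSpace ℝ E] [NormedAddCommGroup F]
  [NormedSpace ℝ F] {𝓕 : Filter α}

/-- The maps `f a` tend to `c` at `x` along `𝓕`, and are strictly differentiable at `x` with
derivative `L`, up to errors that vanish along `𝓕`. -/
structure StrictAlong (𝓕 : Filter α) (f : α → E → F) (L : E →L[ℝ] F) (c : F) (x : E) : Prop where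
  tendsto : Tendsto (fun a => f a x) 𝓕 (𝓝 c)
  isLittleO : (fun p : α × E × E => f p.1 p.2.1 - f p.1 p.2.2 - L (p.2.1 - p.2.2))
    =o[𝓕 ×ˢ 𝓝 (x, x)] fun p => p.2.1 - p.2.2

namespace StrictAlong

variable {f g : α → E → F} {L L' : E →L[ℝ] F} {c c' : F} {x : E}

theorem of_hasStrictFDerivAt {f : E → F} (h : HasStrictFDerivAt f L x) :
    StrictAlong 𝓕 (fun _ => f) L (f x) x :=
  ⟨tendsto_const_nhds, h.isLittleO.comp_tendsto tendsto_snd⟩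

theorem add (hf : StrictAlong 𝓕 f L c x) (hg : StrictAlong 𝓕 g L' c' x) :
    StrictAlong 𝓕 (fun a y => f a y + g a y) (L + L') (c + c') x := by
  refine ⟨hf.tendsto.add hg.tendsto, (hf.isLittleO.add hg.isLittleO).congr_left fun p => ?_⟩
  rw [_root_.add_apply]
  abel

theorem sum {ι : Type*} (s : Finset ι) {f : ι → α → E → F} {L : ι → E →L[ℝ] F} {c : ι → F}
    (h : ∀ i ∈ s, StrictAlong 𝓕 (f i) (L i) (c i) x) :
    StrictAlong 𝓕 (fun a y => ∑ i ∈ s, f i a y) (∑ i ∈ s, L i) (∑ i ∈ s, c i) x := by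
  refine ⟨tendsto_finsetSum s fun i hi => (h i hi).tendsto,
    (Asymptotics.IsLittleO.fun_sum fun i hi => (h i hi).isLittleO).congr_left fun p => ?_⟩
  rw [_root_.sum_apply, Finset.sum_sub_distrib, Finset.sum_sub_distrib]

theorem clm_comp {G : Type*} [NormedAddCommGroup G] [NormedSpace ℝ G] (T : F →L[ℝ] G)
    (h : StrictAlong 𝓕 f L c x) : StrictAlong 𝓕 (fun a y => T (f a y)) (T.comp L) (T c) x := by
  refine ⟨(T.continuous.tendsto c).comp h.tendsto,
    ((T.isBigO_comp _ _).trans_isLittleO h.isLittleO).congr_left fun p => ?_⟩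
  simp

theorem comp_clm {G : Type*} [NormedAddCommGroup G] [NormedSpace ℝ G] (T : G →L[ℝ] E) {y : G}
    (h : StrictAlong 𝓕 f L c (T y)) : StrictAlong 𝓕 (fun a y => f a (T y)) (L.comp T) c y := by
  refine ⟨h.tendsto, ?_⟩
  have ht : Tendsto (fun p : α × G × G => (p.1, T p.2.1, T p.2.2)) (𝓕 ×ˢ 𝓝 (y, y))
      (𝓕 ×ˢ 𝓝 (T y, T y)) := by
    refine Filter.tendsto_fst.prodMk (Tendsto.comp (g := Prod.map T T) ?_ Filter.tendsto_snd)
    exact (T.continuous.prodMap T.continuous).tendsto (y, y)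
  refine ((h.isLittleO.comp_tendsto ht).trans_isBigO
    (k := fun p : α × G × G => p.2.1 - p.2.2) ?_).congr_left fun p => ?_
  · refine (T.isBigO_comp (fun p : α × G × G => p.2.1 - p.2.2) _).congr_left fun p => ?_
    simp
  · simp

theorem prodMk {G : Type*} [NormedAddCommGroup G] [NormedSpace ℝ G] {g : α → E → G}
    {L' : E →L[ℝ] G} {c' : G} (hf : StrictAlong 𝓕 f L c x) (hg : StrictAlong 𝓕 g L' c' x) :
    StrictAlong 𝓕 (fun a y => (f a y, g a y)) (L.prod L') (c, c') x :=
  ⟨hf.tendsto.prodMk_nhds hg.tendsto, hf.isLittleO.prod_left hg.isLittleO⟩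

theorem pi {ι : Type*} [Fintype ι] {f : α → E → ι → ℝ} {L : ι → E →L[ℝ] ℝ} {c : ι → ℝ}
    (h : ∀ i, StrictAlong 𝓕 (fun a y => f a y i) (L i) (c i) x) :
    StrictAlong 𝓕 f (ContinuousLinearMap.pi L) c x :=
  ⟨tendsto_pi_nhds.2 fun i => (h i).tendsto, Asymptotics.isLittleO_pi.2 fun i => (h i).isLittleO⟩

theorem isBigO (h : StrictAlong 𝓕 f L c x) :
    (fun p : α × E × E => f p.1 p.2.1 - f p.1 p.2.2) =O[𝓕 ×ˢ 𝓝 (x, x)] fun p => p.2.1 - p.2.2 := by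
  refine (h.isLittleO.isBigO.add (L.isBigO_comp _ _)).congr_left fun p => ?_
  abel

/-- Strict differentiability gives a uniform Lipschitz bound, so convergence at `x` extends to
arguments that move towards `x`. -/
theorem tendsto_fst (h : StrictAlong 𝓕 f L c x) :
    Tendsto (fun p : α × E × E => f p.1 p.2.1) (𝓕 ×ˢ 𝓝 (x, x)) (𝓝 c) := by
  have ht : Tendsto (fun p : α × E × E => (p.1, p.2.1, x)) (𝓕 ×ˢ 𝓝 (x, x)) (𝓕 ×ˢ 𝓝 (x, x)) := by
    refine Filter.tendsto_fst.prodMk (Tendsto.comp (g := fun q : E × E => (q.1, x)) ?_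
      Filter.tendsto_snd)
    exact Continuous.tendsto' (by fun_prop) _ _ rfl
  have h1 := h.isBigO.comp_tendsto ht
  have h2 : Tendsto (fun p : α × E × E => p.2.1 - x) (𝓕 ×ˢ 𝓝 (x, x)) (𝓝 0) := by
    have : Tendsto (fun q : E × E => q.1 - x) (𝓝 (x, x)) (𝓝 0) :=
      Continuous.tendsto' (by fun_prop) _ _ (sub_self x)
    exact this.comp tendsto_snd
  have h3 := h1.trans_tendsto h2
  have h4 := h3.add (h.tendsto.comp (Filter.tendsto_fst (g := 𝓝 (x, x))))
  rw [zero_add] at h4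
  refine h4.congr fun p => ?_
  simp

theorem tendsto_snd (h : StrictAlong 𝓕 f L c x) :
    Tendsto (fun p : α × E × E => f p.1 p.2.2) (𝓕 ×ˢ 𝓝 (x, x)) (𝓝 c) := by
  have ht : Tendsto (fun p : α × E × E => (p.1, p.2.2, p.2.1)) (𝓕 ×ˢ 𝓝 (x, x))
      (𝓕 ×ˢ 𝓝 (x, x)) := by
    refine Filter.tendsto_fst.prodMk (Tendsto.comp (g := Prod.swap) ?_ Filter.tendsto_snd)
    exact Continuous.tendsto' (by fun_prop) _ _ rfl
  exact h.tendsto_fst.comp ht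

theorem mul {f g : α → E → ℝ} {L L' : E →L[ℝ] ℝ} {c c' : ℝ} (hf : StrictAlong 𝓕 f L c x)
    (hg : StrictAlong 𝓕 g L' c' x) :
    StrictAlong 𝓕 (fun a y => f a y * g a y) (c' • L + c • L') (c * c') x := by
  refine ⟨hf.tendsto.mul hg.tendsto, ?_⟩
  have hO : ∀ M : E →L[ℝ] ℝ, (fun p : α × E × E => M (p.2.1 - p.2.2)) =O[𝓕 ×ˢ 𝓝 (x, x)]
      fun p => ‖p.2.1 - p.2.2‖ := fun M => (M.isBigO_comp _ _).norm_right
  -- With `h = y - y'`, the error splits as `(f y - f y' - L h) * g y + f y' * (g y - g y' - L' h) +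
  -- L h * (g y - c') + L' h * (f y' - c)`.
  have e1 := hf.isLittleO.norm_right.mul_isBigO (hg.tendsto_fst.isBigO_one ℝ)
  have e2 := (hf.tendsto_snd.isBigO_one ℝ).mul_isLittleO hg.isLittleO.norm_right
  have e3 := (hO L).mul_isLittleO ((Asymptotics.isLittleO_one_iff ℝ).2
    (by simpa using hg.tendsto_fst.sub_const c'))
  have e4 := (hO L').mul_isLittleO ((Asymptotics.isLittleO_one_iff ℝ).2
    (by simpa using hf.tendsto_snd.sub_const c))
  simp only [mul_one, one_mul] at e1 e2 e3 e4
  refine (((e1.add e2).add (e3.add e4)).of_norm_right).congr_left fun p => ?_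
  simp only [_root_.add_apply, _root_.smul_apply, smul_eq_mul]
  ring

/-- The pointwise limit along the filter is strictly differentiable. -/
theorem hasStrictFDerivAt [𝓕.NeBot] {f₀ : E → F} (h : StrictAlong 𝓕 f L c x)
    (hlim : ∀ y, Tendsto (fun a => f a y) 𝓕 (𝓝 (f₀ y))) : HasStrictFDerivAt f₀ L x := by
  refine .of_isLittleO (Asymptotics.isLittleO_iff.2 fun ε hε => ?_)
  obtain ⟨pa, ha, pb, hb, hab⟩ := eventually_prod_iff.1 (Asymptotics.isLittleO_iff.1 h.isLittleO hε)
  filter_upwards [hb] with q hq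
  refine le_of_tendsto (((hlim q.1).sub (hlim q.2)).sub_const _).norm ?_
  filter_upwards [ha] with a haa using hab haa hq

end StrictAlong

end Strict

/-! ### Strict differentiability of the RQMC estimators -/

section Component

variable {k D : ℕ} {Ω : Type*} [MeasurableSpace Ω] {P : Measure Ω} {Y : Ω → Euc k}
  {φ : Euc k → ℝ} {K : Euc k} {G : DomainTransform k D}

/-- Dominated convergence. `Θ` may be unbounded, and the cap `C` provides the dominating function `C
* ‖b‖`. -/
theorem tendsto_integral_min_exp_mul {μ : Measure (Euc D)} {C : ℝ} (hC : 0 ≤ C)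
    {Θ b : Euc D → ℝ} (hΘ : Measurable Θ) (hΘ0 : ∀ v, 0 ≤ Θ v) (hb : Integrable b μ) :
    Tendsto (fun n : ℕ => ∫ v, min C (Real.exp (Θ v * (n + 1 : ℝ)⁻¹) - 1) * b v ∂μ) atTop
      (𝓝 0) := by
  have h0 : (0 : ℝ) = ∫ v, min C (Real.exp (Θ v * 0) - 1) * b v ∂μ := by simp [hC]
  rw [h0]
  refine tendsto_integral_of_dominated_convergence (fun v => C * ‖b v‖) (fun n => ?_)
    (hb.norm.const_mul C) (fun n => Eventually.of_forall fun v => ?_)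
    (Eventually.of_forall fun v => ?_)
  · exact Measurable.aestronglyMeasurable (by fun_prop) |>.mul hb.1
  · rw [norm_mul]
    refine mul_le_mul_of_nonneg_right ?_ (norm_nonneg _)
    rw [Real.norm_eq_abs, abs_of_nonneg]
    · exact min_le_left _ _
    · refine le_min hC (sub_nonneg.2 (Real.one_le_exp ?_))
      exact mul_nonneg (hΘ0 v) (by positivity)
  · have h1 : Tendsto (fun n : ℕ => ((n : ℝ) + 1)⁻¹) atTop (𝓝 0) := by
      simpa using tendsto_one_div_add_atTop_nhds_zero_nat (𝕜 := ℝ)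
    have h2 : Continuous fun t : ℝ => min C (Real.exp (Θ v * t) - 1) * b v := by fun_prop
    exact (h2.tendsto 0).comp h1

variable {Ω' : Type*} [MeasurableSpace Ω'] {Q : Measure Ω'} [IsProbabilityMeasure Q] {S : ℕ}
  {ξ : Fin S → Fin D → List Bool → Ω' → Bool}

/-- No uniform law of large numbers is needed. On a small ball the remainder is at most `‖m - m'‖ *
osc n`, where `n` is fixed beforehand so that the integral of `osc n` is below `ε / 2`. The strong
law is applied to `osc n` and to the partial derivatives `q r * H`, functions that do not depend on
`m` or `m'`. -/
theorem exists_strictAlong_rqmc (hξ : IsNestedUniformScramble Q ξ) (hS : 0 < S)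
    (g : SobolGenerator D) (hY : Measurable Y) (h : IsAdmissibleShift P Y φ K) {m₀ : Euc k}
    (hs : SquareIntegrableAt G P Y φ K m₀) :
    ∃ L : Euc k →L[ℝ] ℝ, StrictAlong ((ae Q).curry atTop)
      (fun (a : Ω' × ℕ) m =>
        rqmc (scrambledPoint g ξ a.1) a.2 (transformedIntegrand G P Y φ K m))
      L (fourierValue P Y φ K m₀) m₀ := by
  have hmeas : ∀ m, Measurable (transformedIntegrand G P Y φ K m) := 
    measurable_transformedIntegrand_apply hY h
  set H := transformedIntegrand G P Y φ K m₀
  set q : Fin k → Euc D → ℂ := fun r v => (K r : ℂ) - Complex.I * (G.inv v r : ℂ) with hq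
  have hqm : ∀ r, Measurable (q r) := fun r => by
    have := G.measurable_inv
    fun_prop
  have hD2 : ∀ r, MemLp (fun v => q r v * H v) 2 (volume.restrict (cube D)) := fun r => by
    simpa only [partialDeriv_transformedIntegrand] using hs.2 r
  have hDm : ∀ r, Measurable fun v => q r v * H v := fun r => (hqm r).mul (hmeas m₀)
  set Θ : Euc D → ℝ := fun v => ∑ r, ‖q r v‖ with hΘ
  have hΘm : Measurable Θ := Finset.measurable_fun_sum _ fun r _ => (hqm r).norm
  have hΘ0 : ∀ v, 0 ≤ Θ v := fun v => Finset.sum_nonneg fun r _ => norm_nonneg _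
  set b : Euc D → ℝ := fun v => Θ v * ‖H v‖ with hb
  have hbm : Measurable b := hΘm.mul (hmeas m₀).norm
  have hb2 : MemLp b 2 (volume.restrict (cube D)) := by
    have : b = fun v => ∑ r, ‖q r v * H v‖ := by
      funext v
      simp [hb, hΘ, Finset.sum_mul]
    rw [this]
    exact memLp_finsetSum _ fun r _ => (hD2 r).norm
  set C : ℝ := Real.exp (∑ r, |K r|) + 1 with hC
  have hC0 : 0 ≤ C := by positivity
  set osc : ℕ → Euc D → ℝ := fun n v =>
    min C (Real.exp (Θ v * (n + 1 : ℝ)⁻¹) - 1) * b v with hosc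
  have hoscm : ∀ n, Measurable (osc n) := fun n => by fun_prop
  have hosc2 : ∀ n, MemLp (osc n) 2 (volume.restrict (cube D)) := fun n => by
    refine (hb2.const_mul C).mono (hoscm n).aestronglyMeasurable (Eventually.of_forall fun v => ?_)
    simp only [hosc, norm_mul]
    refine mul_le_mul_of_nonneg_right ?_ (norm_nonneg _)
    rw [Real.norm_eq_abs, abs_of_nonneg, Real.norm_eq_abs, abs_of_nonneg hC0]
    · exact min_le_left _ _
    · refine le_min hC0 (sub_nonneg.2 (Real.one_le_exp ?_))
      exact mul_nonneg (hΘ0 v) (by positivity)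
  have hosc_lim := tendsto_integral_min_exp_mul hC0 hΘm hΘ0 (hb2.integrable one_le_two)
  set dv : Fin k → ℝ := fun r => ∫ v in cube D, (q r v * H v).re with hdv
  set L : Euc k →L[ℝ] ℝ := ∑ r, dv r • (EuclideanSpace.proj r : Euc k →L[ℝ] ℝ) with hL
  have hLapp : ∀ u, L u = ∑ r, dv r * u r := fun u => by simp [hL]
  refine ⟨L, ?_, Asymptotics.isLittleO_iff.2 fun ε hε => ?_⟩
  · rw [← setIntegral_transformedIntegrand hY h hs m₀]
    exact hξ.tendsto_rqmc hS g (hmeas m₀) hs.1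
  · obtain ⟨n, hn⟩ := (hosc_lim.eventually_lt_const (half_pos hε)).exists
    have hev1 : ∀ᶠ a in (ae Q).curry atTop,
        rqmc (scrambledPoint g ξ a.1) a.2 (fun v => (osc n v : ℂ)) < ε / 2 := by
      have h1 := hξ.tendsto_rqmc hS g (Complex.measurable_ofReal.comp (hoscm n))
        (hosc2 n).ofReal
      simp only [Function.comp_def, Complex.ofReal_re] at h1
      exact h1.eventually_lt_const hn
    have hev2 : ∀ᶠ a in (ae Q).curry atTop,
        ∑ r, |rqmc (scrambledPoint g ξ a.1) a.2 (fun v => q r v * H v) - dv r| < ε / 2 := by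
      have h1 : Tendsto (fun a : Ω' × ℕ => ∑ r,
          |rqmc (scrambledPoint g ξ a.1) a.2 (fun v => q r v * H v) - dv r|)
          ((ae Q).curry atTop) (𝓝 (∑ r, |dv r - dv r|)) :=
        tendsto_finsetSum _ fun r _ => ((hξ.tendsto_rqmc hS g (hDm r) (hD2 r)).sub_const _).abs
      simp only [sub_self, abs_zero, Finset.sum_const_zero] at h1
      exact h1.eventually_lt_const (half_pos hε)
    have hδ : (0 : ℝ) < (n + 1 : ℝ)⁻¹ := by positivity
    have hδ1 : (n + 1 : ℝ)⁻¹ ≤ 1 := inv_le_one_of_one_le₀ (by simp)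
    have hball := Metric.closedBall_mem_nhds m₀ hδ
    filter_upwards [(hev1.and hev2).prod_mk (prod_mem_nhds hball hball)] with p hp
    obtain ⟨a, m, m'⟩ := p
    obtain ⟨⟨h1, h2⟩, h3, h4⟩ := hp
    simp only at h1 h2 h3 h4 ⊢
    set pts := scrambledPoint g ξ a.1
    have hu : m - m₀ ∈ Metric.closedBall (0 : Euc k) (n + 1 : ℝ)⁻¹ := by
      simpa [dist_eq_norm] using h3
    have hu' : m' - m₀ ∈ Metric.closedBall (0 : Euc k) (n + 1 : ℝ)⁻¹ := by
      simpa [dist_eq_norm] using h4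
    have hrem : |rqmc pts a.2 (transformedIntegrand G P Y φ K m -
        transformedIntegrand G P Y φ K m' - ∑ r, (m - m') r • fun v => q r v * H v)| ≤
        ‖m - m'‖ * rqmc pts a.2 (fun v => (osc n v : ℂ)) := by
      have hbd := abs_rqmc_le pts a.2 (f := transformedIntegrand G P Y φ K m -
        transformedIntegrand G P Y φ K m' - ∑ r, (m - m') r • fun v => q r v * H v)
        (b := fun v => ‖m - m'‖ * osc n v) fun v => by
          have e1 := transformedIntegrand_add (G := G) (P := P) (Y := Y) (φ := φ) (K := K)
            m₀ (m - m₀) v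
          have e2 := transformedIntegrand_add (G := G) (P := P) (Y := Y) (φ := φ) (K := K)
            m₀ (m' - m₀) v
          rw [add_sub_cancel] at e1 e2
          have e3 : (∑ r, (m - m') r • fun v => q r v * H v) v =
              phase K (G.inv v) (m - m₀ - (m' - m₀)) * H v := by
            rw [sub_sub_sub_cancel_right]
            simp only [Finset.sum_apply, Pi.smul_apply, phase, Finset.sum_mul, hq,
              Complex.real_smul]
            exact Finset.sum_congr rfl fun r _ => by ring
          have e4 := norm_exp_phase_remainder_le K (G.inv v) hδ1 hu hu'
          rw [Pi.sub_apply, Pi.sub_apply, e1, e2, e3, ← sub_mul, ← sub_mul, norm_mul]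
          refine (mul_le_mul_of_nonneg_right e4 (norm_nonneg _)).trans (le_of_eq ?_)
          rw [sub_sub_sub_cancel_right]
          simp only [hosc, hb, hΘ, hq, hC]
          ring
      refine hbd.trans (le_of_eq ?_)
      have := (rqmcL pts a.2).map_smul ‖m - m'‖ fun v => (osc n v : ℂ)
      simp only [smul_eq_mul] at this
      rw [show rqmc pts a.2 = rqmcL pts a.2 from rfl, ← this]
      congr 1
      funext v
      simp
    -- By linearity the error is the estimator of the pointwise remainder plus the sampling error of
    -- the partial derivatives.
    have hsplit : rqmc pts a.2 (transformedIntegrand G P Y φ K m) -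
        rqmc pts a.2 (transformedIntegrand G P Y φ K m') - L (m - m') =
        rqmc pts a.2 (transformedIntegrand G P Y φ K m -
          transformedIntegrand G P Y φ K m' - ∑ r, (m - m') r • fun v => q r v * H v) +
        ∑ r, (rqmc pts a.2 (fun v => q r v * H v) - dv r) * (m - m') r := by
      rw [show rqmc pts a.2 = rqmcL pts a.2 from rfl, hLapp, map_sub, map_sub, map_sum]
      simp only [map_smul, smul_eq_mul, sub_mul, Finset.sum_sub_distrib]
      rw [Finset.sum_congr rfl fun r _ => mul_comm ((m - m') r) _]
      ring
    rw [hsplit, Real.norm_eq_abs]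
    refine (abs_add_le _ _).trans ?_
    have h5 : |∑ r, (rqmc pts a.2 (fun v => q r v * H v) - dv r) * (m - m') r| ≤
        (∑ r, |rqmc pts a.2 (fun v => q r v * H v) - dv r|) * ‖m - m'‖ := by
      rw [Finset.sum_mul]
      refine (Finset.abs_sum_le_sum_abs _ _).trans (Finset.sum_le_sum fun r _ => ?_)
      rw [abs_mul]
      exact mul_le_mul_of_nonneg_left (PiLp.norm_apply_le (m - m') r) (abs_nonneg _)
    have h6 := mul_le_mul_of_nonneg_right h1.le (norm_nonneg (m - m'))
    have h7 := mul_le_mul_of_nonneg_right h2.le (norm_nonneg (m - m'))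
    linarith

theorem tendsto_rqmc_fourierValue (hξ : IsNestedUniformScramble Q ξ) (hS : 0 < S)
    (g : SobolGenerator D) (hY : Measurable Y) (h : IsAdmissibleShift P Y φ K) {m₀ : Euc k}
    (hs : SquareIntegrableAt G P Y φ K m₀) (m : Euc k) :
    Tendsto (fun a : Ω' × ℕ =>
      rqmc (scrambledPoint g ξ a.1) a.2 (transformedIntegrand G P Y φ K m))
      ((ae Q).curry atTop) (𝓝 (fourierValue P Y φ K m)) := by
  rw [← setIntegral_transformedIntegrand hY h hs m]
  exact hξ.tendsto_rqmc hS g (measurable_transformedIntegrand_apply hY h m) (hs.memLp hY h m)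

end Component

namespace StrictAlong

variable {α E F : Type*} [NormedAddCommGroup E] [NormedSpace ℝ E] [NormedAddCommGroup F]
  [NormedSpace ℝ F] {𝓕 : Filter α} {f g : α → E → F} {L L' : E →L[ℝ] F} {c c' : F} {x : E}

theorem const (c : F) : StrictAlong 𝓕 (fun _ (_ : E) => c) 0 c x :=
  of_hasStrictFDerivAt (hasStrictFDerivAt_const c x)

theorem neg (h : StrictAlong 𝓕 f L c x) : StrictAlong 𝓕 (fun a y => -f a y) (-L) (-c) x := by
  simpa using h.clm_comp (-ContinuousLinearMap.id ℝ F)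

end StrictAlong

/-! ### The RQMC first-order map -/

section KKT

variable {d : ℕ} {ι : Type*} [Fintype ι] {A : LossDecomposition d ι}

theorem exists_strictAlong_kktMap {α : Type*} {𝓕 : Filter α} (mean : Euc d)
    (ev : α → ∀ i, (Euc (A.comp i).k → ℝ) → Euc (A.comp i).k → Euc (A.comp i).k → ℝ)
    (ev₀ : ∀ i, (Euc (A.comp i).k → ℝ) → Euc (A.comp i).k → Euc (A.comp i).k → ℝ)
    {z : PrimalDual d}
    (h0 : ∀ i, ∃ L, StrictAlong 𝓕 (fun a => ev a i (A.comp i).loss (A.comp i).K0) L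
      (ev₀ i (A.comp i).loss (A.comp i).K0 (proj (A.comp i).p z.1)) (proj (A.comp i).p z.1))
    (h1 : ∀ i r, ∃ L, StrictAlong 𝓕
      (fun a => ev a i (partialDeriv r (A.comp i).loss) (A.comp i).K1) L
      (ev₀ i (partialDeriv r (A.comp i).loss) (A.comp i).K1 (proj (A.comp i).p z.1))
      (proj (A.comp i).p z.1)) :
    ∃ L, StrictAlong 𝓕 (fun a => A.kktMap mean (ev a)) L (A.kktMap mean ev₀ z) z := by
  choose L0 hL0 using h0
  choose L1 hL1 using h1
  let T : ∀ i, PrimalDual d →L[ℝ] Euc (A.comp i).k := fun i =>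
    (projL (A.comp i).p).comp (ContinuousLinearMap.fst ℝ (Euc d) ℝ)
  have hc0 := fun i => (hL0 i).comp_clm (T i) (y := z)
  have hc1 := fun i r => (hL1 i r).comp_clm (T i) (y := z)
  have haff : StrictAlong 𝓕
      (fun (_ : α) (z : PrimalDual d) => A.const + ∑ j, A.lin j * (mean j - z.1 j))
      (fderiv ℝ (fun z : PrimalDual d => A.const + ∑ j, A.lin j * (mean j - z.1 j)) z)
      (A.const + ∑ j, A.lin j * (mean j - z.1 j)) z := by
    refine StrictAlong.of_hasStrictFDerivAt (ContDiffAt.hasStrictFDerivAt (n := 1) ?_ one_ne_zero)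
    have : ∀ j : Fin d, ContDiff ℝ 1 fun z : PrimalDual d => z.1 j := fun j =>
      ((EuclideanSpace.proj j : Euc d →L[ℝ] ℝ).comp
        (ContinuousLinearMap.fst ℝ (Euc d) ℝ)).contDiff
    exact (contDiff_const.add (ContDiff.sum fun j _ =>
      contDiff_const.mul (contDiff_const.sub (this j)))).contDiffAt
  have hg0 := (haff.add (StrictAlong.sum Finset.univ fun i _ => hc0 i)).neg
  have hif : ∀ (j : Fin d) i r, ∃ L, StrictAlong 𝓕 (fun a (z : PrimalDual d) =>
      if (A.comp i).p r = j then ev a i (partialDeriv r (A.comp i).loss) (A.comp i).K1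
        (proj (A.comp i).p z.1) else 0) L (if (A.comp i).p r = j then
          ev₀ i (partialDeriv r (A.comp i).loss) (A.comp i).K1 (proj (A.comp i).p z.1) else 0)
          z := by
    intro j i r
    split_ifs
    · exact ⟨_, hc1 i r⟩
    · exact ⟨_, StrictAlong.const 0⟩
  choose L2 hL2 using hif
  have hlam : StrictAlong 𝓕 (fun (_ : α) (z : PrimalDual d) => z.2)
      (ContinuousLinearMap.snd ℝ (Euc d) ℝ) z.2 z :=
    StrictAlong.of_hasStrictFDerivAt (ContinuousLinearMap.snd ℝ (Euc d) ℝ).hasStrictFDerivAt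
  have hg1 := fun j => (StrictAlong.const (𝓕 := 𝓕) (x := z) (1 : ℝ)).add
    (hlam.mul ((StrictAlong.const (A.lin j)).add (StrictAlong.sum Finset.univ fun i _ =>
      StrictAlong.sum Finset.univ fun r _ => hL2 j i r))).neg
  have hvec := (StrictAlong.pi (f := fun a (z : PrimalDual d) j =>
    1 + -(z.2 * (A.lin j + ∑ i, ∑ r, if (A.comp i).p r = j then
      ev a i (partialDeriv r (A.comp i).loss) (A.comp i).K1 (proj (A.comp i).p z.1) else 0)))
      hg1).clm_comp
    ((EuclideanSpace.equiv (Fin d) ℝ).symm : (Fin d → ℝ) →L[ℝ] Euc d)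
  simp only [← sub_eq_add_neg] at hvec
  exact ⟨_, hvec.prodMk hg0⟩

theorem tendsto_kktMap {α : Type*} {𝓕 : Filter α} (mean : Euc d)
    (ev : α → ∀ i, (Euc (A.comp i).k → ℝ) → Euc (A.comp i).k → Euc (A.comp i).k → ℝ)
    (ev₀ : ∀ i, (Euc (A.comp i).k → ℝ) → Euc (A.comp i).k → Euc (A.comp i).k → ℝ)
    {z : PrimalDual d}
    (h0 : ∀ i m, Tendsto (fun a => ev a i (A.comp i).loss (A.comp i).K0 m) 𝓕
      (𝓝 (ev₀ i (A.comp i).loss (A.comp i).K0 m)))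
    (h1 : ∀ i r m, Tendsto (fun a => ev a i (partialDeriv r (A.comp i).loss) (A.comp i).K1 m) 𝓕
      (𝓝 (ev₀ i (partialDeriv r (A.comp i).loss) (A.comp i).K1 m))) :
    Tendsto (fun a => A.kktMap mean (ev a) z) 𝓕 (𝓝 (A.kktMap mean ev₀ z)) := by
  refine Tendsto.prodMk_nhds ?_ (((tendsto_finsetSum _ fun i _ => h0 i _).const_add _).neg)
  refine ((PiLp.continuous_toLp 2 fun _ : Fin d => ℝ).tendsto _).comp
    (tendsto_pi_nhds.2 fun j => ?_)
  refine ((Tendsto.const_add _ (tendsto_finsetSum _ fun i _ => tendsto_finsetSum _ fun r _ =>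
    ?_)).const_mul _).const_sub _
  split_ifs
  · exact h1 i r _
  · exact tendsto_const_nhds

variable {Ω : Type*} [MeasurableSpace Ω] {P : Measure Ω} {X : Ω → Euc d} {M : Set (Euc d)}
  {Ω' : Type*} [MeasurableSpace Ω'] {Q : Measure Ω'} {S : ℕ}
  {g : ∀ D, SobolGenerator D} {ξ : ∀ D, Fin S → Fin D → List Bool → Ω' → Bool}

theorem measurable_rqmc_transformedIntegrand {k D : ℕ} {Y : Ω → Euc k} {φ : Euc k → ℝ} {K : Euc k}
    {G : DomainTransform k D} {ξ : Fin S → Fin D → List Bool → Ω' → Bool}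
    (hξ : IsNestedUniformScramble Q ξ) (g : SobolGenerator D) (hY : Measurable Y)
    (h : IsAdmissibleShift P Y φ K) (N : ℕ) :
    Measurable fun q : Ω' × Euc k =>
      rqmc (scrambledPoint g ξ q.1) N (transformedIntegrand G P Y φ K q.2) := by
  have h1 : ∀ s n, Measurable fun q : Ω' × Euc k => (q.2, scrambledPoint g ξ q.1 s n) :=
    fun s n => measurable_snd.prodMk ((hξ.measurable_scrambledPoint g s n).comp measurable_fst)
  have h2 : ∀ s n, Measurable fun q : Ω' × Euc k =>
      (transformedIntegrand G P Y φ K q.2 (scrambledPoint g ξ q.1 s n)).re := fun s n => by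
    have h3 := (measurable_transformedIntegrand (G := G) hY h).comp (h1 s n)
    exact Complex.measurable_re.comp h3
  exact (Finset.measurable_fun_sum _ fun s _ => (Finset.measurable_fun_sum _ fun n _ =>
    h2 s n).const_mul _).const_mul _

theorem measurable_rqmcKKT (hX : Measurable X) (hadm : A.Admissible P X M)
    (hξ : ∀ D, IsNestedUniformScramble Q (ξ D)) (N : ℕ) :
    Measurable fun q : Ω' × PrimalDual d => rqmcKKT A P X g ξ N q.1 q.2 := by
  have hp : ∀ i, Measurable fun q : Ω' × PrimalDual d => (q.1, proj (A.comp i).p q.2.1) := fun i =>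
    measurable_fst.prodMk ((measurable_proj _).comp (measurable_fst.comp measurable_snd))
  have hY := fun i => (measurable_proj (A.comp i).p).comp hX
  have h0 := fun i => (measurable_rqmc_transformedIntegrand (G := (A.comp i).G) (hξ (A.comp i).D)
    (g (A.comp i).D) (hY i) (hadm.shift0 i) N).comp (hp i)
  have h1 := fun i r => (measurable_rqmc_transformedIntegrand (G := (A.comp i).G) (hξ (A.comp i).D)
    (g (A.comp i).D) (hY i) (hadm.shift1 i r) N).comp (hp i)
  unfold rqmcKKT LossDecomposition.kktMap LossDecomposition.aggregate0
    LossDecomposition.aggregate1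
  refine Measurable.prodMk ?_ (((Measurable.add (by fun_prop)
    (Finset.measurable_fun_sum _ fun i _ => h0 i)) : Measurable _).neg)
  refine (PiLp.continuous_toLp 2 fun _ : Fin d => ℝ).measurable.comp
    (measurable_pi_lambda _ fun j => ?_)
  refine ((measurable_snd.comp measurable_snd).mul ((Finset.measurable_fun_sum _ fun i _ =>
    Finset.measurable_fun_sum _ fun r _ => ?_).const_add _)).const_sub _
  split_ifs
  · exact h1 i r
  · exact measurable_const

variable [IsProbabilityMeasure Q]

instance neBot_curry_ae_atTop : ((ae Q).curry (atTop : Filter ℕ)).NeBot := by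
  refine neBot_iff.2 fun h => ?_
  have h1 : ∀ᶠ _ in (ae Q).curry (atTop : Filter ℕ), False := by simp [h]
  rw [eventually_curry_iff] at h1
  obtain ⟨ω, hω⟩ := h1.exists
  exact hω.exists.choose_spec

/-- One and the same `L` is the derivative along the random maps and the derivative of their limit,
so strong regularity of the limit gives information on the random equations. -/
theorem exists_strictAlong_rqmcKKT (hX : Measurable X) (hadm : A.Admissible P X M) (hS : 0 < S)
    (hξ : ∀ D, IsNestedUniformScramble Q (ξ D)) {z : PrimalDual d} (hz : z.1 ∈ M) :
    ∃ L, StrictAlong ((ae Q).curry atTop)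
      (fun (a : Ω' × ℕ) => rqmcKKT A P X g ξ a.2 a.1) L (A.fourierKKT P X z) z ∧
      HasStrictFDerivAt (A.fourierKKT P X) L z := by
  have hY := fun i => (measurable_proj (A.comp i).p).comp hX
  obtain ⟨L, hL⟩ := exists_strictAlong_kktMap (A := A) (𝓕 := (ae Q).curry atTop) (z := z)
    (LossDecomposition.mean P X)
    (fun (a : Ω' × ℕ) i φ K m => rqmc (scrambledPoint (g (A.comp i).D) (ξ (A.comp i).D) a.1) a.2
      (transformedIntegrand (A.comp i).G P (fun ω => proj (A.comp i).p (X ω)) φ K m))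
    (fun i φ K m => fourierValue P (fun ω => proj (A.comp i).p (X ω)) φ K m)
    (fun i => exists_strictAlong_rqmc (hξ _) hS _ (hY i) (hadm.shift0 i) (hadm.square0 i _ hz))
    (fun i r => exists_strictAlong_rqmc (hξ _) hS _ (hY i) (hadm.shift1 i r)
      (hadm.square1 i r _ hz))
  refine ⟨L, hL, hL.hasStrictFDerivAt fun y => tendsto_kktMap _ _ _ (fun i m => ?_)
    fun i r m => ?_⟩
  · exact tendsto_rqmc_fourierValue (hξ _) hS _ (hY i) (hadm.shift0 i) (hadm.square0 i _ hz) m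
  · exact tendsto_rqmc_fourierValue (hξ _) hS _ (hY i) (hadm.shift1 i r) (hadm.square1 i r _ hz) m

end KKT

/-! ### Roots of perturbed equations -/

section Newton

/-- Fixed points of a contraction of a ball that moves the centre little. -/
theorem exists_fixedPoint_of_contraction {E : Type*} [NormedAddCommGroup E] [CompleteSpace E]
    {T : E → E} {x : E} {η : ℝ}
    (hT : ∀ z ∈ Metric.closedBall x η, ∀ z' ∈ Metric.closedBall x η,
      ‖T z - T z'‖ ≤ 1 / 2 * ‖z - z'‖) (hx : ‖T x - x‖ ≤ η / 2) :
    ∃ y ∈ Metric.closedBall x η, T y = y ∧ Tendsto (fun n => T^[n] x) atTop (𝓝 y) ∧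
      (∀ z ∈ Metric.closedBall x η, T z = z → z = y) ∧ ‖y - x‖ ≤ 2 * ‖T x - x‖ := by
  have hη : 0 ≤ η := by linarith [norm_nonneg (T x - x)]
  have hxm : x ∈ Metric.closedBall x η := Metric.mem_closedBall_self hη
  have hmaps : Set.MapsTo T (Metric.closedBall x η) (Metric.closedBall x η) := by
    intro z hz
    have h1 := hT z hz x hxm
    rw [mem_closedBall_iff_norm] at hz ⊢
    have h2 := norm_sub_le_norm_sub_add_norm_sub (T z) (T x) x
    linarith
  have hcon : ContractingWith (1 / 2) (hmaps.restrict T _ _) := by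
    refine ⟨by rw [← NNReal.coe_lt_coe]; norm_num, LipschitzWith.of_dist_le_mul fun z z' => ?_⟩
    have := hT z z.2 z' z'.2
    rw [Subtype.dist_eq, Subtype.dist_eq, dist_eq_norm, dist_eq_norm]
    simpa using this
  obtain ⟨y, hy, hfix, hlim, -⟩ := hcon.exists_fixedPoint' Metric.isClosed_closedBall.isComplete
    hmaps hxm (edist_ne_top _ _)
  refine ⟨y, hy, hfix, hlim, fun z hz hzf => ?_, ?_⟩
  · have h1 := hT z hz y hy
    rw [hzf, hfix] at h1
    exact sub_eq_zero.1 (norm_eq_zero.1 (by linarith [norm_nonneg (z - y)]))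
  · have h1 := hT y hy x hxm
    rw [hfix] at h1
    have h2 := norm_sub_le_norm_sub_add_norm_sub y (T x) x
    linarith

/-- The exceptional null set may depend on the neighbourhood; a countable neighbourhood basis leaves
only countably many of them. -/
theorem ae_tendsto_of_tendsto_curry {Ω' : Type*} [MeasurableSpace Ω'] {Q : Measure Ω'}
    {E : Type*} [TopologicalSpace E] [FirstCountableTopology E]
    {f : Ω' × ℕ → E} {x : E} (h : Tendsto f ((ae Q).curry atTop) (𝓝 x)) :
    ∀ᵐ ω ∂Q, Tendsto (fun N => f (ω, N)) atTop (𝓝 x) := by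
  obtain ⟨B, hB⟩ := (𝓝 x).exists_antitone_basis
  have h1 : ∀ᵐ ω ∂Q, ∀ n, ∀ᶠ N in atTop, f (ω, N) ∈ B n :=
    ae_all_iff.2 fun n => eventually_curry_iff.1 (h.eventually (hB.mem n))
  filter_upwards [h1] with ω hω
  exact hB.tendsto_right_iff.2 fun n _ => hω n

variable {E : Type*} [NormedAddCommGroup E] [NormedSpace ℝ E]

/-- The derivative at a strongly regular root is injective. -/
theorem IsStronglyRegular.injective_fderiv {F : E → E} {z₀ : E} (h : IsStronglyRegular F z₀)
    (h0 : F z₀ = 0) : Function.Injective (fderiv ℝ F z₀) := by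
  obtain ⟨-, U₁, hU₁, U₂, hU₂, ζ, -, hζ⟩ := h
  obtain ⟨-, -, huniq⟩ := hζ 0 (mem_of_mem_nhds hU₁)
  refine (injective_iff_map_eq_zero _).2 fun v hv => ?_
  -- A small multiple of a kernel vector added to `z₀` stays in `U₂` and solves the linearized
  -- equation for `δ = 0`, so uniqueness forces the vector to vanish.
  have ht : Tendsto (fun t : ℝ => z₀ + t • v) (𝓝[≠] 0) (𝓝 z₀) :=
    (Continuous.tendsto' (by fun_prop) _ _ (by simp)).mono_left nhdsWithin_le_nhds
  obtain ⟨t, ht1, ht2⟩ := ((ht.eventually hU₂).and self_mem_nhdsWithin).exists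
  have e1 := huniq _ ht1 (by simp [h0, hv])
  have e2 := huniq z₀ (mem_of_mem_nhds hU₂) (by simp [h0])
  rw [← e2, add_eq_left] at e1
  exact (smul_eq_zero.1 e1).resolve_left ht2

/-- The simplified Newton step for `f = 0` with the fixed derivative `L`. -/
def newtonStep (L : E ≃L[ℝ] E) (f : E → E) (z : E) : E := z - L.symm (f z)

theorem newtonStep_eq_self_iff (L : E ≃L[ℝ] E) (f : E → E) (z : E) :
    newtonStep L f z = z ↔ f z = 0 := by
  simp [newtonStep]

/-- Two Newton steps differ by `-L⁻¹` of the strict remainder. The constant `1 / (2 * (B + 1))`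
makes this at most half the distance, and the `+ 1` avoids division by zero. -/
theorem StrictAlong.exists_contraction {α : Type*} {𝓕 : Filter α} {f : α → E → E} {L : E ≃L[ℝ] E}
    {c x : E} (h : StrictAlong 𝓕 f (L : E →L[ℝ] E) c x) :
    ∃ η > 0, ∀ᶠ a in 𝓕, ∀ z ∈ Metric.closedBall x η, ∀ z' ∈ Metric.closedBall x η,
      ‖newtonStep L (f a) z - newtonStep L (f a) z'‖ ≤ 1 / 2 * ‖z - z'‖ := by
  set B := ‖(L.symm : E →L[ℝ] E)‖ with hB
  have hB0 : 0 ≤ B := norm_nonneg _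
  obtain ⟨pa, ha, pb, hb, hab⟩ := eventually_prod_iff.1
    (Asymptotics.isLittleO_iff.1 h.isLittleO (c := 1 / (2 * (B + 1))) (by positivity))
  rw [nhds_prod_eq] at hb
  obtain ⟨η, hη, hsub⟩ := (Metric.nhds_basis_closedBall.prod_self.mem_iff).1 hb
  refine ⟨η, hη, ha.mono fun a haa z hz z' hz' => ?_⟩
  have h1 := hab haa (hsub (Set.mk_mem_prod hz hz'))
  simp only at h1
  have h2 : newtonStep L (f a) z - newtonStep L (f a) z' =
      -((L.symm : E →L[ℝ] E) (f a z - f a z' - L (z - z'))) := by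
    simp [newtonStep]
    abel
  rw [h2, norm_neg]
  refine ((L.symm : E →L[ℝ] E).le_opNorm _).trans ((mul_le_mul_of_nonneg_left h1 hB0).trans ?_)
  rw [← mul_assoc]
  refine mul_le_mul_of_nonneg_right ?_ (norm_nonneg _)
  rw [mul_one_div, div_le_div_iff₀ (by positivity) two_pos]
  linarith

/-- Random equations whose maps are strictly differentiable at `x` along almost every path, with
invertible derivative and limit value zero, have measurable locally unique solutions tending to
`x`. -/
theorem StrictAlong.exists_measurable_roots [CompleteSpace E] [MeasurableSpace E] [BorelSpace E]
    [SecondCountableTopology E] {Ω' : Type*} [MeasurableSpace Ω'] {Q : Measure Ω'}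
    {f : Ω' × ℕ → E → E} {L : E ≃L[ℝ] E} {x : E}
    (h : StrictAlong ((ae Q).curry atTop) f (L : E →L[ℝ] E) 0 x)
    (hm : ∀ N, Measurable fun q : Ω' × E => f (q.1, N) q.2) :
    ∃ η : ℝ, 0 < η ∧ ∃ zN : ℕ → Ω' → E, (∀ N, Measurable (zN N)) ∧ ∀ᵐ ω ∂Q,
      (∀ᶠ N in atTop, zN N ω ∈ Metric.closedBall x η ∧ f (ω, N) (zN N ω) = 0 ∧
        ∀ z ∈ Metric.closedBall x η, f (ω, N) z = 0 → z = zN N ω) ∧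
      Tendsto (fun N => zN N ω) atTop (𝓝 x) := by
  obtain ⟨η, hη, hcon⟩ := h.exists_contraction
  have hstep : Tendsto (fun a => ‖newtonStep L (f a) x - x‖) ((ae Q).curry atTop) (𝓝 0) := by
    have h1 : Tendsto (fun a => ‖L.symm (f a x)‖) ((ae Q).curry atTop) (𝓝 ‖L.symm (0 : E)‖) :=
      ((L.symm.continuous.tendsto 0).comp h.tendsto).norm
    rw [map_zero, norm_zero] at h1
    refine h1.congr fun a => ?_
    rw [newtonStep, sub_sub_cancel_left, norm_neg]
  have hiter : ∀ N n, Measurable fun ω => (newtonStep L (f (ω, N)))^[n] x := by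
    intro N n
    induction n with
    | zero => exact measurable_const
    | succ n ih =>
      simp_rw [Function.iterate_succ_apply']
      have h1 : Measurable fun ω => f (ω, N) ((newtonStep L (f (ω, N)))^[n] x) :=
        (hm N).comp (measurable_id.prodMk ih)
      exact ih.sub (L.symm.continuous.measurable.comp h1)
  -- The root is defined as a limit of iterates so that it is measurable for every `N`; where the
  -- iterates diverge its value is irrelevant.
  set y : Ω' × ℕ → E := fun a => limUnder atTop fun n => (newtonStep L (f a))^[n] x with hy
  have hroot : ∀ᶠ a in (ae Q).curry atTop, y a ∈ Metric.closedBall x η ∧ f a (y a) = 0 ∧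
      (∀ z ∈ Metric.closedBall x η, f a z = 0 → z = y a) ∧
      ‖y a - x‖ ≤ 2 * ‖newtonStep L (f a) x - x‖ := by
    filter_upwards [hcon, hstep.eventually_lt_const (half_pos hη)] with a h1 h2
    obtain ⟨w, hw, hfix, hlim, huniq, hle⟩ := exists_fixedPoint_of_contraction h1 h2.le
    have : y a = w := hlim.limUnder_eq
    rw [this]
    exact ⟨hw, (newtonStep_eq_self_iff L _ _).1 hfix, fun z hz hz0 =>
      huniq z hz ((newtonStep_eq_self_iff L _ _).2 hz0), hle⟩
  have hlim : Tendsto y ((ae Q).curry atTop) (𝓝 x) := by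
    rw [tendsto_iff_norm_sub_tendsto_zero]
    refine squeeze_zero' (Eventually.of_forall fun a => norm_nonneg _)
      (hroot.mono fun a ha => ha.2.2.2) ?_
    simpa using hstep.const_mul 2
  refine ⟨η, hη, fun N ω => y (ω, N), fun N => ?_, ?_⟩
  · exact (StronglyMeasurable.limUnder fun n => (hiter N n).stronglyMeasurable).measurable
  · filter_upwards [eventually_curry_iff.1 hroot, ae_tendsto_of_tendsto_curry hlim] with ω h1 h2
    exact ⟨h1.mono fun N hN => ⟨hN.1, hN.2.1, hN.2.2.1⟩, h2⟩

end Newton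

end MSRM

/-! ### The main theorem. -/

theorem theorem5p5 {d : ℕ} {ι : Type*} [Fintype ι]
    {Ω : Type*} [MeasurableSpace Ω] (P : Measure Ω) [IsProbabilityMeasure P]
    {Ω' : Type*} [MeasurableSpace Ω'] (Q : Measure Ω') [IsProbabilityMeasure Q]
    -- the loss vector, with a joint density, and the loss function
    (X : Ω → MSRM.Euc d) (hX : Measurable X) (hdens : P.map X ≪ volume)
    (A : MSRM.LossDecomposition d ι)
    (hloss : MSRM.IsLossFunction A.loss) (hheart : MSRM.MemOrliczHeart P A.loss X)
    (hdiff : ∀ m₀ : MSRM.Euc d, ∀ᵐ ω ∂P,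
      DifferentiableAt ℝ (fun m : MSRM.Euc d => A.loss (X ω - m)) m₀)
    -- the decision set `𝒵 = M × (0, lamBar]`
    (M : Set (MSRM.Euc d)) (hM : IsCompact M) (lamBar : ℝ)
    -- admissible contour shifts and square-integrability
    (hadm : A.Admissible P X M)
    -- the exact solution and its regularity conditions
    (zstar : MSRM.PrimalDual d) (hzstar : MSRM.IsExactKKT P A.loss X zstar)
    (hint : zstar ∈ interior (M ×ˢ Set.Ioc 0 lamBar))
    (hC1 : ∀ m₀ : MSRM.Euc d, ∀ᵐ ω ∂P,
      DifferentiableAt ℝ (fun m : MSRM.Euc d => fderiv ℝ A.loss (X ω - m)) m₀)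
    (hC2 : MSRM.SecondOrderCondition (MSRM.expectedLoss P A.loss X) zstar.1)
    (hreg : MSRM.IsStronglyRegular (A.fourierKKT P X) zstar)
    -- the randomized Sobol points
    {S : ℕ} (hS : 0 < S) (g : ∀ D, MSRM.SobolGenerator D)
    (ξ : ∀ D, Fin S → Fin D → List Bool → Ω' → Bool)
    (hξ : ∀ D, MSRM.IsNestedUniformScramble Q (ξ D)) :
    ∃ η : ℝ, 0 < η ∧ ∃ zN : ℕ → Ω' → MSRM.PrimalDual d, (∀ N, Measurable (zN N)) ∧
      ∀ᵐ ω ∂Q,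
        (∀ᶠ N in atTop,
          zN N ω ∈ M ×ˢ Set.Ioc 0 lamBar ∧
          zN N ω ∈ Metric.closedBall zstar η ∧
          MSRM.rqmcKKT A P X g ξ N ω (zN N ω) = 0 ∧
          ∀ z ∈ Metric.closedBall zstar η, MSRM.rqmcKKT A P X g ξ N ω z = 0 → z = zN N ω) ∧
        Tendsto (fun N => zN N ω) atTop (𝓝 zstar) := by
  have hF0 : A.fourierKKT P X zstar = 0 := MSRM.fourierKKT_eq_zero hX hdens hloss hheart hadm
    hzstar (hC1 zstar.1) hreg.1.continuousAt
  obtain ⟨L, hL, hLd⟩ := MSRM.exists_strictAlong_rqmcKKT (g := g) hX hadm hS hξ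
    (interior_subset hint).1
  have hinj : Function.Injective L := by
    rw [← hLd.hasFDerivAt.fderiv]
    exact hreg.injective_fderiv hF0
  -- In finite dimension an injective endomorphism is a continuous linear equivalence.
  let e : MSRM.PrimalDual d ≃L[ℝ] MSRM.PrimalDual d :=
    (LinearEquiv.ofInjectiveEndo (L : MSRM.PrimalDual d →ₗ[ℝ] MSRM.PrimalDual d)
      hinj).toContinuousLinearEquiv
  have he : (e : MSRM.PrimalDual d →L[ℝ] MSRM.PrimalDual d) = L :=
    ContinuousLinearMap.ext fun v => rfl
  rw [hF0, ← he] at hL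
  obtain ⟨η, hη, zN, hzm, hz⟩ := hL.exists_measurable_roots
    (MSRM.measurable_rqmcKKT hX hadm hξ)
  refine ⟨η, hη, zN, hzm, hz.mono fun ω hω => ⟨?_, hω.2⟩⟩
  -- Feasibility comes from convergence: `zstar` is interior, so the roots eventually lie in the
  -- decision set.
  filter_upwards [hω.1, hω.2.eventually (mem_interior_iff_mem_nhds.1 hint)] with N h1 h2
  exact ⟨h2, h1⟩
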